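/- **Setting.** Let $q_0>0$, $\alpha,\theta_\pm\in\mathbb R$ with $\theta_++\theta_-=\pi$, put $q_\pm(t)=q_0e^{i(\alpha t+\theta_\pm)}$, and fix $t\in\mathbb R$. For $q:\mathbb R\times\mathbb R\to\mathbb C$ let $$J=\begin{pmatrix}-1&0\\0&1\end{pmatrix},\quad Q(x)=\begin{pmatrix}0&q(x,t)\\q(-x,-t)&0\end{pmatrix},\quad Q_\pm=\begin{pmatrix}0&q_\pm(t)\\q_\mp(-t)&0\end{pmatrix},$$ and consider the scattering problem $v_x=(ikJ+Q)v$. Let $\mathbb K=\{(k,\lambda)\in\mathbb C^2:\lambda^2=k^2+q_0^2\}$ be the two-sheeted Riemann surface of $\lambda=\sqrt{k^2+q_0^2}$, with branch points $\pm iq_0$. On sheet I, $\lambda=(r_1r_2)^{1/2}e^{i(\theta_1+\theta_2)/2}$, where $k\mp iq_0=r_{1,2}e^{i\theta_{1,2}}$ and $\theta_{1},\theta_2\in[-\frac\pi2,\frac{3\pi}2)$. Let $\mathbb K^{+}$ and $\mathbb K^-$ be the parts of sheet I over $\{\Im k>0\}\setminus(0,iq_0]$ and $\{\Im k<0\}\setminus[-iq_0,0)$.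 Closures and boundaries are taken in $\mathbb K$, so the two edges of the cut $[-iq_0,iq_0]$ are distinct. Let $\phi,\bar\phi,\psi,\bar\psi$ be the solutions of the scattering problem with $$\phi\sim\begin{pmatrix}\lambda+k\\iq_+(-t)\end{pmatrix}e^{-i\lambda x},\quad \bar\phi\sim\begin{pmatrix}-iq_-(t)\\\lambda+k\end{pmatrix}e^{i\lambda x}\quad(x\to-\infty),$$ $$\psi\sim\begin{pmatrix}-iq_+(t)\\\lambda+k\end{pmatrix}e^{i\lambda x},\quad \bar\psi\sim\begin{pmatrix}\lambda+k\\iq_-(-t)\end{pmatrix}e^{-i\lambda x}\quad(x\to+\infty),$$ for which moreover $M=e^{i\lambda x}\phi$, $\bar M=e^{-i\lambda x}\bar\phi$, $N=e^{-i\lambda x}\psi$, $\bar N=e^{i\lambda x}\bar\psi$ satisfy the integral equations $m(x)=c+\int_{\mathbb R} G(x-x')\,((Q-Q_\mp)m)(x')\,dx'$ (with $Q_-$ for $M,\bar M$ and $Q_+$ for $N,\bar N$). Here $c$ is the constant vector in the asymptotics and $G$ is, respectively, $G_-,\bar G_-,G_+,\bar G_+$, where, with the Heaviside function $\theta$, $$G_-=\tfrac{\theta(x)}{2\lambda}\left[(1+e^{2i\lambda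 x})\lambda I-i(e^{2i\lambda x}-1)(ikJ+Q_-)\right],\quad \bar G_-=\tfrac{\theta(x)}{2\lambda}\left[(1+e^{-2i\lambda x})\lambda I+i(e^{-2i\lambda x}-1)(ikJ+Q_-)\right],$$ $$G_+=-\tfrac{\theta(-x)}{2\lambda}\left[(1+e^{-2i\lambda x})\lambda I+i(e^{-2i\lambda x}-1)(ikJ+Q_+)\right],\quad \bar G_+=-\tfrac{\theta(-x)}{2\lambda}\left[(1+e^{2i\lambda x})\lambda I-i(e^{2i\lambda x}-1)(ikJ+Q_+)\right].$$ With $W(u,v)=u_1v_2-u_2v_1$ define $$a=\frac{W(\phi,\psi)}{2\lambda(\lambda+k)},\quad \bar a=-\frac{W(\bar\phi,\bar\psi)}{2\lambda(\lambda+k)},\quad b=-\frac{W(\phi,\bar\psi)}{2\lambda(\lambda+k)},\quad \bar b=\frac{W(\bar\phi,\psi)}{2\lambda(\lambda+k)}.$$ **Theorem.** Suppose the entries of $Q-Q_-$ are in $L^{1,1}((-\infty,0])$ and those of $Q-Q_+$ are in $L^{1,1}([0,\infty))$, where $f\in L^{1,1}(S)$ means $\int_S|f(x)|(1+|x|)\,dx<\infty$.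 Then, at points of $\mathbb K$ other than $\pm iq_0$, $\phi,\psi$ exist and are unique if $\Im\lambda\ge0$, and $\bar\phi,\bar\psi$ exist and are unique if $\Im\lambda\le0$; the Wronskians defining $a$ and $\bar a$ do not depend on $x$; and $\phi=b\psi+a\bar\psi$, $\bar\phi=\bar a\psi+\bar b\bar\psi$ if $\lambda\in\mathbb R$. Moreover: 1. $a$ is continuous on $(\overline{\mathbb K^+}\cup\partial\mathbb K^-)\setminus\{\pm iq_0\}$ and analytic in $\mathbb K^+$; 2. $\bar a$ is continuous on $(\overline{\mathbb K^-}\cup\partial\mathbb K^+)\setminus\{\pm iq_0\}$ and analytic in $\mathbb K^-$; 3. $b$ and $\bar b$ are continuous on the set of points of $\mathbb K$ over $\mathbb R\cup(-iq_0,iq_0)$ (including both edges of the cut); 4. if in addition, for some constant $a_0>0$, the entries of $Q-Q_-$ are $O(e^{-a_0x^2})$ as $x\to-\infty$ and those of $Q-Q_+$ are $O(e^{-a_0x^2})$ as $x\to+\infty$, then all four eigenfunctions exist and are unique, and the two linear relations hold, at every point of $\mathbb K\setminus\{\pm iq_0\}$, and $a\lambda$, $\bar a\lambda$, $b\lambda$,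 $\bar b\lambda$ are analytic on the whole Riemann surface $\mathbb K$, the branch points $\pm iq_0$ being removable singularities. -/

import Mathlib

open Filter MeasureTheory
open scoped Topology Matrix

noncomputable section

namespace RST

/-! ### The Riemann surface of `λ = √(k² + q₀²)` -/

/-- The two-sheeted Riemann surface of `λ = √(k² + q₀²)`, as the curve of all pairs `(k, λ)` with
`λ² = k² + q₀²`, with the topology induced from `ℂ × ℂ`. The points over the interior of the cut
`[-iq₀, iq₀]` with the two opposite values of `λ` are the two edges of the cut. -/
abbrev Surface (q₀ : ℝ) : Type := {p : ℂ × ℂ // p.2 ^ 2 = p.1 ^ 2 + (q₀ : ℂ) ^ 2}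

variable {q₀ : ℝ}

/-- The spectral parameter `k` of a point of the surface. -/
def Surface.k (p : Surface q₀) : ℂ := p.1.1

/-- The value of `λ` at a point of the surface. -/
def Surface.lam (p : Surface q₀) : ℂ := p.1.2

/-- A function on the surface is analytic at the points of `U`: near each of them it is the
restriction of an analytic function of the ambient variables `(k, λ)`. -/
def AnalyticOnSurface (F : Surface q₀ → ℂ) (U : Set (Surface q₀)) : Prop :=
  ∀ p ∈ U, ∃ G : ℂ × ℂ → ℂ, AnalyticAt ℂ G p.1 ∧ ∀ᶠ p' in 𝓝 p, F p' = G p'.1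

/-- The polar angle of `w` in `[-π/2, 3π/2)`. -/
def polarAngle (w : ℂ) : ℝ := toIcoMod Real.two_pi_pos (-(Real.pi / 2)) (Complex.arg w)

/-- The branch of `λ` on sheet I: `(r₁ r₂)^(1/2) exp(i (θ₁ + θ₂) / 2)`, where
`k - iq₀ = r₁ exp(i θ₁)`, `k + iq₀ = r₂ exp(i θ₂)` and `θ₁, θ₂ ∈ [-π/2, 3π/2)`. -/
def lamI (q₀ : ℝ) (k : ℂ) : ℂ :=
  (Real.sqrt (‖k - Complex.I * q₀‖ * ‖k + Complex.I * q₀‖) : ℂ) *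
    Complex.exp (Complex.I *
      ((polarAngle (k - Complex.I * q₀) + polarAngle (k + Complex.I * q₀)) / 2 : ℝ))

theorem norm_mul_exp_polarAngle (w : ℂ) :
    (‖w‖ : ℂ) * Complex.exp (Complex.I * (polarAngle w : ℝ)) = w := by
  have h : polarAngle w = Complex.arg w -
      (toIcoDiv Real.two_pi_pos (-(Real.pi / 2)) (Complex.arg w) : ℤ) * (2 * Real.pi) := by
    unfold polarAngle toIcoMod
    rw [zsmul_eq_mul]
  have e : Complex.I * ((polarAngle w : ℝ) : ℂ) = Complex.arg w * Complex.I -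
      (toIcoDiv Real.two_pi_pos (-(Real.pi / 2)) (Complex.arg w) : ℤ) *
        (2 * Real.pi * Complex.I) := by
    rw [h]; push_cast; ring
  rw [e, Complex.exp_sub, Complex.exp_int_mul_two_pi_mul_I, div_one,
    Complex.norm_mul_exp_arg_mul_I]

/-- Sheet I is part of the surface. -/
theorem lamI_sq (q₀ : ℝ) (k : ℂ) : lamI q₀ k ^ 2 = k ^ 2 + (q₀ : ℂ) ^ 2 := by
  have h1 := norm_mul_exp_polarAngle (k - Complex.I * q₀)
  have h2 := norm_mul_exp_polarAngle (k + Complex.I * q₀)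
  have hs : ((Real.sqrt (‖k - Complex.I * q₀‖ * ‖k + Complex.I * q₀‖) : ℝ) : ℂ) ^ 2 =
      (‖k - Complex.I * q₀‖ : ℂ) * (‖k + Complex.I * q₀‖ : ℂ) := by
    rw [← Complex.ofReal_pow, Real.sq_sqrt (by positivity)]; push_cast; rfl
  have he : Complex.exp (Complex.I *
      ((polarAngle (k - Complex.I * q₀) + polarAngle (k + Complex.I * q₀)) / 2 : ℝ)) ^ 2 =
      Complex.exp (Complex.I * (polarAngle (k - Complex.I * q₀) : ℝ)) *
      Complex.exp (Complex.I * (polarAngle (k + Complex.I * q₀) : ℝ)) := by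
    rw [← Complex.exp_nat_mul, ← Complex.exp_add]; congr 1; push_cast; ring
  have hp : (k - Complex.I * q₀) * (k + Complex.I * q₀) = k ^ 2 + (q₀ : ℂ) ^ 2 := by
    linear_combination (-(q₀ : ℂ) ^ 2) * Complex.I_sq
  rw [lamI, mul_pow, hs, he, ← hp]
  conv_rhs => rw [← h1, ← h2]
  ring

/-- `K⁺`: the part of sheet I over the upper half plane cut along `(0, iq₀]`. -/
def Kplus (q₀ : ℝ) : Set (Surface q₀) :=
  {p | p.lam = lamI q₀ p.k ∧ 0 < p.k.im ∧ ¬ (p.k.re = 0 ∧ p.k.im ≤ q₀)}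

/-- `K⁻`: the part of sheet I over the lower half plane cut along `[-iq₀, 0)`. -/
def Kminus (q₀ : ℝ) : Set (Surface q₀) :=
  {p | p.lam = lamI q₀ p.k ∧ p.k.im < 0 ∧ ¬ (p.k.re = 0 ∧ -q₀ ≤ p.k.im)}

/-- The branch points `±iq₀`. -/
def branchPoints (q₀ : ℝ) : Set (Surface q₀) :=
  {p | p.k = Complex.I * q₀ ∨ p.k = -(Complex.I * q₀)}

/-- All points of the surface over `ℝ ∪ (-iq₀, iq₀)`; over the open segment these are the points
of both edges of the cut. -/
def continuousSpectrum (q₀ : ℝ) : Set (Surface q₀) :=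
  {p | p.k.im = 0 ∨ (p.k.re = 0 ∧ -q₀ < p.k.im ∧ p.k.im < q₀)}

/-! ### The scattering problem -/

/-- The potential `q(x,t)` and the parameters of its background
`q±(t) = q₀ exp(i (α t + θ±))`. -/
structure Potential where
  q : ℝ → ℝ → ℂ
  q₀ : ℝ
  α : ℝ
  θp : ℝ
  θm : ℝ

namespace Potential

variable (D : Potential)

/-- The limit value `q₊(t)`. -/
def qp (t : ℝ) : ℂ := D.q₀ * Complex.exp (Complex.I * ((D.α * t + D.θp : ℝ) : ℂ))

/-- The limit value `q₋(t)`. -/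
def qm (t : ℝ) : ℂ := D.q₀ * Complex.exp (Complex.I * ((D.α * t + D.θm : ℝ) : ℂ))

/-- `Q(x,t)`, with the nonlocal reduction `r(x,t) = q(-x,-t)`. -/
def Q (t x : ℝ) : Matrix (Fin 2) (Fin 2) ℂ := !![0, D.q x t; D.q (-x) (-t), 0]

/-- `Q₊(t)`, the limit of `Q` as `x → +∞`. -/
def Qp (t : ℝ) : Matrix (Fin 2) (Fin 2) ℂ := !![0, D.qp t; D.qm (-t), 0]

/-- `Q₋(t)`, the limit of `Q` as `x → -∞`. -/
def Qm (t : ℝ) : Matrix (Fin 2) (Fin 2) ℂ := !![0, D.qm t; D.qp (-t), 0]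

end Potential

/-- `J = diag(-1, 1)`. -/
def J : Matrix (Fin 2) (Fin 2) ℂ := !![-1, 0; 0, 1]

/-- `f ∈ L^{1,1}(s)`: `∫_s |f(x)| (1 + |x|) dx < ∞`. -/
def MemL11 (f : ℝ → ℂ) (s : Set ℝ) : Prop :=
  IntegrableOn (fun x => f x * ((1 + |x| : ℝ) : ℂ)) s volume

/-- The entries of `Q - Q₋` are in `L^{1,1}` of the left half line, and those of `Q - Q₊` in
`L^{1,1}` of the right half line. -/
def Potential.DecayL11 (D : Potential) (t : ℝ) : Prop :=
  ∀ i j : Fin 2, MemL11 (fun x => (D.Q t x - D.Qm t) i j) (Set.Iic 0) ∧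
    MemL11 (fun x => (D.Q t x - D.Qp t) i j) (Set.Ici 0)

/-- The entries of `Q - Q±` are `O(exp(-a x²))` as `x → ±∞`, for some `a > 0`. -/
def Potential.DecayGaussian (D : Potential) (t : ℝ) : Prop :=
  ∃ a : ℝ, 0 < a ∧ ∀ i j : Fin 2,
    (fun x => (D.Q t x - D.Qm t) i j) =O[atBot] (fun x : ℝ => Real.exp (-a * x ^ 2)) ∧
    (fun x => (D.Q t x - D.Qp t) i j) =O[atTop] (fun x : ℝ => Real.exp (-a * x ^ 2))

/-- The Heaviside function. -/
def heaviside (x : ℝ) : ℂ := if 0 < x then 1 else 0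

section Eigenfunctions

variable (D : Potential) (t : ℝ) (p : Surface D.q₀)

/-- The Green function `G₋(x,k)`. -/
def greenM (x : ℝ) : Matrix (Fin 2) (Fin 2) ℂ :=
  (heaviside x / (2 * p.lam)) •
    (((1 + Complex.exp (2 * Complex.I * p.lam * x)) * p.lam) • (1 : Matrix (Fin 2) (Fin 2) ℂ)
      - (Complex.I * (Complex.exp (2 * Complex.I * p.lam * x) - 1)) •
        ((Complex.I * p.k) • J + D.Qm t))

/-- The Green function `Ḡ₋(x,k)`. -/
def greenMBar (x : ℝ) : Matrix (Fin 2) (Fin 2) ℂ :=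
  (heaviside x / (2 * p.lam)) •
    (((1 + Complex.exp (-(2 * Complex.I * p.lam * x))) * p.lam) • (1 : Matrix (Fin 2) (Fin 2) ℂ)
      + (Complex.I * (Complex.exp (-(2 * Complex.I * p.lam * x)) - 1)) •
        ((Complex.I * p.k) • J + D.Qm t))

/-- The Green function `G₊(x,k)`. -/
def greenP (x : ℝ) : Matrix (Fin 2) (Fin 2) ℂ :=
  (-(heaviside (-x) / (2 * p.lam))) •
    (((1 + Complex.exp (-(2 * Complex.I * p.lam * x))) * p.lam) • (1 : Matrix (Fin 2) (Fin 2) ℂ)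
      + (Complex.I * (Complex.exp (-(2 * Complex.I * p.lam * x)) - 1)) •
        ((Complex.I * p.k) • J + D.Qp t))

/-- The Green function `Ḡ₊(x,k)`. -/
def greenPBar (x : ℝ) : Matrix (Fin 2) (Fin 2) ℂ :=
  (-(heaviside (-x) / (2 * p.lam))) •
    (((1 + Complex.exp (2 * Complex.I * p.lam * x)) * p.lam) • (1 : Matrix (Fin 2) (Fin 2) ℂ)
      - (Complex.I * (Complex.exp (2 * Complex.I * p.lam * x) - 1)) •
        ((Complex.I * p.k) • J + D.Qp t))

/-- `u` is a (continuous) solution of `v_x = (ikJ + Q) v`, in integrated form since `Q` is only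
locally integrable. -/
def SolvesScattering (u : ℝ → Fin 2 → ℂ) : Prop :=
  Continuous u ∧ ∀ x y : ℝ,
    u y - u x = ∫ s in x..y, ((Complex.I * p.k) • J + D.Q t s) *ᵥ u s

/-- The bounded function `m` satisfies
`m(x) = c + ∫ G(x - x') (Q(x') - Q_∞) m(x') dx'` with an absolutely convergent integral. -/
def SolvesIntegralEq (G : ℝ → Matrix (Fin 2) (Fin 2) ℂ) (Qinf : Matrix (Fin 2) (Fin 2) ℂ)
    (c : Fin 2 → ℂ) (m : ℝ → Fin 2 → ℂ) : Prop :=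
  ∀ x : ℝ, Integrable (fun x' => G (x - x') *ᵥ ((D.Q t x' - Qinf) *ᵥ m x')) ∧
    m x = c + ∫ x', G (x - x') *ᵥ ((D.Q t x' - Qinf) *ᵥ m x')

/-- `u = φ(·,k)`: it solves the scattering problem, `M = exp(iλx) u` tends to
`w = (λ + k, iq₊)` as `x → -∞`, and `M` satisfies its integral equation. In `w` the value of `q₊`
is the one in the lower left entry of `Q₋(t)`, so that `w` is an eigenvector of `ikJ + Q₋(t)`. -/
def IsPhi (u : ℝ → Fin 2 → ℂ) : Prop :=
  SolvesScattering D t p u ∧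
  Tendsto (fun x : ℝ => Complex.exp (Complex.I * p.lam * x) • u x) atBot
    (𝓝 ![p.lam + p.k, Complex.I * D.qp (-t)]) ∧
  SolvesIntegralEq D t (greenM D t p) (D.Qm t) ![p.lam + p.k, Complex.I * D.qp (-t)]
    (fun x : ℝ => Complex.exp (Complex.I * p.lam * x) • u x)

/-- `u = φ̄(·,k)`, with `M̄ = exp(-iλx) u` and `w̄ = (-iq₋, λ + k)`. -/
def IsPhiBar (u : ℝ → Fin 2 → ℂ) : Prop :=
  SolvesScattering D t p u ∧
  Tendsto (fun x : ℝ => Complex.exp (-(Complex.I * p.lam * x)) • u x) atBot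
    (𝓝 ![-(Complex.I * D.qm t), p.lam + p.k]) ∧
  SolvesIntegralEq D t (greenMBar D t p) (D.Qm t) ![-(Complex.I * D.qm t), p.lam + p.k]
    (fun x : ℝ => Complex.exp (-(Complex.I * p.lam * x)) • u x)

/-- `u = ψ(·,k)`, with `N = exp(-iλx) u` and `v = (-iq₊, λ + k)`. -/
def IsPsi (u : ℝ → Fin 2 → ℂ) : Prop :=
  SolvesScattering D t p u ∧
  Tendsto (fun x : ℝ => Complex.exp (-(Complex.I * p.lam * x)) • u x) atTop
    (𝓝 ![-(Complex.I * D.qp t), p.lam + p.k]) ∧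
  SolvesIntegralEq D t (greenP D t p) (D.Qp t) ![-(Complex.I * D.qp t), p.lam + p.k]
    (fun x : ℝ => Complex.exp (-(Complex.I * p.lam * x)) • u x)

/-- `u = ψ̄(·,k)`, with `N̄ = exp(iλx) u` and `v̄ = (λ + k, iq₋)`. -/
def IsPsiBar (u : ℝ → Fin 2 → ℂ) : Prop :=
  SolvesScattering D t p u ∧
  Tendsto (fun x : ℝ => Complex.exp (Complex.I * p.lam * x) • u x) atTop
    (𝓝 ![p.lam + p.k, Complex.I * D.qm (-t)]) ∧
  SolvesIntegralEq D t (greenPBar D t p) (D.Qp t) ![p.lam + p.k, Complex.I * D.qm (-t)]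
    (fun x : ℝ => Complex.exp (Complex.I * p.lam * x) • u x)

/-- The eigenfunction `φ(·,k)`; meaningful where it exists and is unique. -/
def phi : ℝ → Fin 2 → ℂ := Classical.epsilon (IsPhi D t p)

/-- The eigenfunction `φ̄(·,k)`; meaningful where it exists and is unique. -/
def phiBar : ℝ → Fin 2 → ℂ := Classical.epsilon (IsPhiBar D t p)

/-- The eigenfunction `ψ(·,k)`; meaningful where it exists and is unique. -/
def psi : ℝ → Fin 2 → ℂ := Classical.epsilon (IsPsi D t p)

/-- The eigenfunction `ψ̄(·,k)`; meaningful where it exists and is unique. -/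
def psiBar : ℝ → Fin 2 → ℂ := Classical.epsilon (IsPsiBar D t p)

/-- The Wronskian `W(u,v) = u₁ v₂ - u₂ v₁` of two vectors. -/
def wronskian (u v : Fin 2 → ℂ) : ℂ := u 0 * v 1 - u 1 * v 0

/-- `a(k) = W(φ,ψ) / (2λ(λ+k))`; the Wronskian does not depend on `x` and is taken at `x = 0`. -/
def scatA : ℂ :=
  wronskian (phi D t p 0) (psi D t p 0) / (2 * p.lam * (p.lam + p.k))

/-- `ā(k) = -W(φ̄,ψ̄) / (2λ(λ+k))`. -/
def scatABar : ℂ :=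
  -(wronskian (phiBar D t p 0) (psiBar D t p 0) / (2 * p.lam * (p.lam + p.k)))

/-- `b(k) = -W(φ,ψ̄) / (2λ(λ+k))`. -/
def scatB : ℂ :=
  -(wronskian (phi D t p 0) (psiBar D t p 0) / (2 * p.lam * (p.lam + p.k)))

/-- `b̄(k) = W(φ̄,ψ) / (2λ(λ+k))`. -/
def scatBBar : ℂ :=
  wronskian (phiBar D t p 0) (psi D t p 0) / (2 * p.lam * (p.lam + p.k))

/-- The four scattering coefficients are the ones of the relations `φ = b ψ + a ψ̄` and
`φ̄ = ā ψ + b̄ ψ̄` between the eigenfunctions. -/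
def ScatteringRelations : Prop :=
  ∀ x : ℝ, phi D t p x = scatB D t p • psi D t p x + scatA D t p • psiBar D t p x ∧
    phiBar D t p x = scatABar D t p • psi D t p x + scatBBar D t p • psiBar D t p x

end Eigenfunctions

end RST

end

open RST

/-! The background operator A = ikJ + Q₋ satisfies A² = -λ², because q₋(t)q₊(-t) = -q₀² when θ₊ + θ₋
= π. Hence L = A + iλ satisfies L² = 2iλL, it annihilates the asymptotic vector of φ, and exp(yL) =
1 + (∫₀^y exp(2iλs) ds) L. For λ ≠ 0 this is the Green function G₋ without its Heaviside factor, so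
the integral equation for M = exp(iλx)φ is a Volterra equation on (-∞, x]. Replacing λ by -λ and
reflecting x ↦ -x bring all four eigenfunctions to this one form (`IsJost`, `isPhi_iff`, `isPsi_iff`
and their companions).

If Im λ ≥ -ν, the kernel is at most a constant times (1 + y)exp(2νy) for y ≥ 0, uniformly near λ = 0
(`norm_evol_sub_le`). A perturbation integrable against (1 + |s|)exp(2ν|s|) at -∞ therefore makes
the n-th Picard iterate at most a constant times Rⁿ/n!. This yields existence, uniqueness,
continuity in the parameters and, term by term, holomorphy (`VolterraData.isJost_jost`,
`VolterraData.eq_jost`, `continuousOn_jost_zero`, `differentiableOn_jost_zero`). L^{1,1} decay is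
the case ν = 0; Gaussian decay allows every ν.

On the surface (λ + k)(λ - k) = q₀², so z = λ + k is a global coordinate with values in ℂ \ {0}, and
k, λ are rational in z. The sets K± are those where Im k and Im λ are both positive, respectively
both negative (`Kplus_eq`, `Kminus_eq`). Consequently Im λ ≥ 0 on the domain claimed for a, Im λ ≤ 0
on that for ā, and λ is real on that for b and b̄.

Wronskians of solutions are constant because ikJ + Q has trace zero, and W(ψ, ψ̄) = -2λ(λ + k) does
not vanish off the branch points, so Cramer's rule gives the linear relations. Multiplying a
coefficient by λ leaves only 2(λ + k) in the denominator. Since the Volterra equation stays regular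
at λ = 0, the branch points are removable under Gaussian decay. -/

noncomputable section

namespace RST

/-! ### Product rule for primitives of locally integrable functions -/

section ProductRule

variable {E F G : Type*} [NormedAddCommGroup E] [NormedSpace ℝ E] [CompleteSpace E]
  [NormedAddCommGroup F] [NormedSpace ℝ F] [CompleteSpace F]
  [NormedAddCommGroup G] [NormedSpace ℝ G] [CompleteSpace G]

/-- Product rule for primitives vanishing at the left end point. -/
theorem bilin_primitive_primitive (β : E →L[ℝ] F →L[ℝ] G) {f : ℝ → E} {g : ℝ → F} {a b : ℝ}
    (hab : a ≤ b) (hf : IntegrableOn f (Set.Ioc a b)) (hg : IntegrableOn g (Set.Ioc a b)) :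
    β (∫ s in a..b, f s) (∫ s in a..b, g s) =
      ∫ r in a..b, (β (f r) (∫ s in a..r, g s) + β (∫ s in a..r, f s) (g r)) := by
  set μ : Measure ℝ := volume.restrict (Set.Ioc a b) with hμ
  have hf' : Integrable f μ := hf
  have hg' : Integrable g μ := hg
  have hprod : Integrable (fun z : ℝ × ℝ => β (f z.1) (g z.2)) (μ.prod μ) := by
    refine hf'.op_fst_snd (op := fun x y => β x y) (by fun_prop) ?_ hg'
    exact ⟨‖β‖, fun x y => β.le_opNorm₂ x y⟩
  have hT : MeasurableSet {z : ℝ × ℝ | z.2 ≤ z.1} := measurableSet_le measurable_snd measurable_fst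
  have hT' : MeasurableSet {z : ℝ × ℝ | z.1 < z.2} := measurableSet_lt measurable_fst measurable_snd
  have h1 : ∫ z, β (f z.1) (g z.2) ∂(μ.prod μ) =
      β (∫ s in a..b, f s) (∫ s in a..b, g s) := by
    rw [intervalIntegral.integral_of_le hab, intervalIntegral.integral_of_le hab, ← hμ]
    exact integral_prod_bilin β hf' hg'
  -- Cut the square along its diagonal. Fubini on the part below it gives the term with f(r)
  -- outside, on the part above it the term with g(r) outside.
  have hsum : (fun z : ℝ × ℝ => β (f z.1) (g z.2)) =
      fun z => {z : ℝ × ℝ | z.2 ≤ z.1}.indicator (fun z => β (f z.1) (g z.2)) z +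
        {z : ℝ × ℝ | z.1 < z.2}.indicator (fun z => β (f z.1) (g z.2)) z := by
    funext z
    by_cases h : z.2 ≤ z.1
    · have h' : ¬ z.1 < z.2 := not_lt.2 h
      simp [h, h']
    · have h' : z.1 < z.2 := not_le.1 h
      simp [h, h']
  have hA : ∀ r ∈ Set.Ioc a b,
      ∫ s, {z : ℝ × ℝ | z.2 ≤ z.1}.indicator (fun z => β (f z.1) (g z.2)) (r, s) ∂μ =
        β (f r) (∫ s in a..r, g s) := by
    intro r hr
    have e : (fun s => {z : ℝ × ℝ | z.2 ≤ z.1}.indicator (fun z => β (f z.1) (g z.2)) (r, s)) =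
        (Set.Iic r).indicator (fun s => β (f r) (g s)) := by
      funext s; simp [Set.indicator]
    rw [e, integral_indicator measurableSet_Iic, hμ, Measure.restrict_restrict measurableSet_Iic,
      intervalIntegral.integral_of_le hr.1.le]
    have e2 : Set.Iic r ∩ Set.Ioc a b = Set.Ioc a r := by
      ext s; simp only [Set.mem_inter_iff, Set.mem_Iic, Set.mem_Ioc] at *; constructor
      · rintro ⟨h, h'⟩; exact ⟨h'.1, h⟩
      · rintro ⟨h, h'⟩; exact ⟨h', h, h'.trans hr.2⟩
    rw [e2]
    exact (β (f r)).integral_comp_comm (hg.mono_set (Set.Ioc_subset_Ioc_right hr.2))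
  have hB : ∀ s ∈ Set.Ioc a b,
      ∫ r, {z : ℝ × ℝ | z.1 < z.2}.indicator (fun z => β (f z.1) (g z.2)) (r, s) ∂μ =
        β (∫ r in a..s, f r) (g s) := by
    intro s hs
    have e : (fun r => {z : ℝ × ℝ | z.1 < z.2}.indicator (fun z => β (f z.1) (g z.2)) (r, s)) =
        (Set.Iio s).indicator (fun r => β (f r) (g s)) := by
      funext r; simp [Set.indicator]
    rw [e, integral_indicator measurableSet_Iio, hμ, Measure.restrict_restrict measurableSet_Iio,
      intervalIntegral.integral_of_le hs.1.le]
    have e2 : Set.Iio s ∩ Set.Ioc a b = Set.Ioo a s := by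
      ext r; simp only [Set.mem_inter_iff, Set.mem_Iio, Set.mem_Ioc, Set.mem_Ioo] at *; constructor
      · rintro ⟨h, h'⟩; exact ⟨h'.1, h⟩
      · rintro ⟨h, h'⟩; exact ⟨h', h, h'.le.trans hs.2⟩
    rw [e2, ← integral_Ioc_eq_integral_Ioo]
    exact (β.flip (g s)).integral_comp_comm (hf.mono_set (Set.Ioc_subset_Ioc_right hs.2))
  have i1 := hprod.indicator hT
  have i2 := hprod.indicator hT'
  have j1 : Integrable (fun r => β (f r) (∫ s in a..r, g s)) μ := by
    refine i1.integral_prod_left.congr ?_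
    rw [hμ]
    filter_upwards [ae_restrict_mem measurableSet_Ioc] with r hr using hA r hr
  have j2 : Integrable (fun s => β (∫ r in a..s, f r) (g s)) μ := by
    refine i2.integral_prod_right.congr ?_
    rw [hμ]
    filter_upwards [ae_restrict_mem measurableSet_Ioc] with r hr using hB r hr
  rw [← h1, hsum, integral_add i1 i2, integral_prod _ i1, integral_prod_symm _ i2,
    intervalIntegral.integral_of_le hab, ← hμ, integral_add j1 j2]
  congr 1
  · rw [hμ]; exact setIntegral_congr_fun measurableSet_Ioc hA
  · rw [hμ]; exact setIntegral_congr_fun measurableSet_Ioc hB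

theorem intervalIntegrable_bilin {E F G : Type*} [NormedAddCommGroup E] [NormedSpace ℝ E]
    [NormedAddCommGroup F] [NormedSpace ℝ F] [NormedAddCommGroup G] [NormedSpace ℝ G]
    (β : E →L[ℝ] F →L[ℝ] G) {f : ℝ → E} {g : ℝ → F} {a b : ℝ}
    (hf : IntervalIntegrable f volume a b) (hg : Continuous g) :
    IntervalIntegrable (fun r => β (f r) (g r)) volume a b := by
  have hβ : Continuous (Function.uncurry fun x y => β x y) := by fun_prop
  rw [intervalIntegrable_iff] at hf ⊢
  obtain ⟨C, hC⟩ := isCompact_uIcc.exists_bound_of_continuousOn (hg.continuousOn (s := Set.uIcc a b))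
  refine (hf.norm.mul_const (‖β‖ * C)).mono'
    (hβ.comp_aestronglyMeasurable₂ hf.1 hg.aestronglyMeasurable) ?_
  filter_upwards [ae_restrict_mem measurableSet_uIoc] with r hr
  refine (β.le_opNorm₂ _ _).trans ?_
  have := hC r (Set.uIoc_subset_uIcc hr)
  calc _ = ‖f r‖ * (‖β‖ * ‖g r‖) := by ring
    _ ≤ _ := by gcongr

/-- Product rule for functions that are primitives of locally integrable functions. -/
theorem bilin_sub_bilin_eq_integral (β : E →L[ℝ] F →L[ℝ] G) {f f' : ℝ → E} {g g' : ℝ → F}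
    (hf' : ∀ x y, IntervalIntegrable f' volume x y) (hg' : ∀ x y, IntervalIntegrable g' volume x y)
    (hf : ∀ x y, f y - f x = ∫ s in x..y, f' s) (hg : ∀ x y, g y - g x = ∫ s in x..y, g' s)
    (a b : ℝ) :
    β (f b) (g b) - β (f a) (g a) = ∫ r in a..b, (β (f' r) (g r) + β (f r) (g' r)) := by
  wlog hab : a ≤ b generalizing a b
  · rw [intervalIntegral.integral_symm, ← this b a (le_of_not_ge hab)]; abel
  have ef : ∀ r, f r = f a + ∫ s in a..r, f' s := fun r => by rw [← hf]; abel
  have eg : ∀ r, g r = g a + ∫ s in a..r, g' s := fun r => by rw [← hg]; abel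
  have cf : Continuous fun r => ∫ s in a..r, f' s := intervalIntegral.continuous_primitive hf' a
  have cg : Continuous fun r => ∫ s in a..r, g' s := intervalIntegral.continuous_primitive hg' a
  have k1 : ∀ v : F, IntervalIntegrable (fun r => β (f' r) v) volume a b := fun v => by
    have := hf' a b
    rw [intervalIntegrable_iff] at this ⊢
    exact (β.flip v).integrable_comp this
  have k2 : ∀ v : E, IntervalIntegrable (fun r => β v (g' r)) volume a b := fun v => by
    have := hg' a b
    rw [intervalIntegrable_iff] at this ⊢
    exact (β v).integrable_comp this
  have k3 : IntervalIntegrable (fun r => β (f' r) (∫ s in a..r, g' s)) volume a b :=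
    intervalIntegrable_bilin β (hf' a b) cg
  have k4 : IntervalIntegrable (fun r => β (∫ s in a..r, f' s) (g' r)) volume a b :=
    intervalIntegrable_bilin β.flip (hg' a b) cf
  have main := bilin_primitive_primitive β hab
    ((intervalIntegrable_iff_integrableOn_Ioc_of_le hab).1 (hf' a b))
    ((intervalIntegrable_iff_integrableOn_Ioc_of_le hab).1 (hg' a b))
  have i1 : ∫ r in a..b, β (f' r) (g a) = β (∫ s in a..b, f' s) (g a) := by
    have := (β.flip (g a)).intervalIntegral_comp_comm (hf' a b)
    simpa using this
  have i2 : ∫ r in a..b, β (f a) (g' r) = β (f a) (∫ s in a..b, g' s) :=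
    (β (f a)).intervalIntegral_comp_comm (hg' a b)
  -- Subtracting the values at a reduces to primitives vanishing at a, which is `main`; the
  -- remaining terms have one constant factor and integrate by linearity.
  have e : (fun r => β (f' r) (g r) + β (f r) (g' r)) = fun r =>
      (β (f' r) (g a) + β (f a) (g' r)) +
        (β (f' r) (∫ s in a..r, g' s) + β (∫ s in a..r, f' s) (g' r)) := by
    funext r
    rw [ef r, eg r]
    simp only [map_add, add_apply]
    abel
  rw [e, intervalIntegral.integral_add ((k1 _).add (k2 _)) (k3.add k4),
    intervalIntegral.integral_add (k1 _) (k2 _), ← main, i1, i2, ef b, eg b]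
  simp only [map_add, add_apply]
  abel

end ProductRule

/-! ### Powers of the primitive of an integrable function -/

theorem tendsto_integral_Iic_atBot {ρ : ℝ → ℝ} (hρ : Integrable ρ) :
    Tendsto (fun x => ∫ s in Set.Iic x, ρ s) atBot (𝓝 0) := by
  have h := (intervalIntegral_tendsto_integral_Iic 0 hρ.integrableOn tendsto_id).const_sub
    (∫ s in Set.Iic 0, ρ s)
  rw [sub_self] at h
  refine h.congr fun a => ?_
  rw [id, ← intervalIntegral.integral_Iic_sub_Iic hρ.integrableOn hρ.integrableOn, sub_sub_cancel]

/-- `∫_{-∞}^x ρ Rⁿ = R(x)ⁿ⁺¹ / (n + 1)` for the primitive `R` of an integrable function `ρ`. -/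
theorem integral_Iic_mul_primitive_pow {ρ : ℝ → ℝ} (hρ : Integrable ρ) (n : ℕ) (x : ℝ) :
    IntegrableOn (fun s => ρ s * (∫ r in Set.Iic s, ρ r) ^ n) (Set.Iic x) ∧
    ∫ s in Set.Iic x, ρ s * (∫ r in Set.Iic s, ρ r) ^ n =
      (∫ s in Set.Iic x, ρ s) ^ (n + 1) / (n + 1) := by
  set R : ℝ → ℝ := fun s => ∫ r in Set.Iic s, ρ r with hR
  have hsub : ∀ x y, R y - R x = ∫ s in x..y, ρ s := fun x y =>
    intervalIntegral.integral_Iic_sub_Iic hρ.integrableOn hρ.integrableOn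
  have hint : ∀ x y, IntervalIntegrable ρ volume x y := fun x y => hρ.intervalIntegrable
  have hRc : Continuous R := by
    have : R = fun y => R 0 + ∫ s in (0:ℝ)..y, ρ s := by
      funext y; rw [← hsub 0 y]; ring
    rw [this]
    exact continuous_const.add (intervalIntegral.continuous_primitive hint 0)
  have hRb : ∀ y, ‖R y‖ ≤ ∫ s, ‖ρ s‖ := fun y =>
    (norm_integral_le_integral_norm _).trans
      (setIntegral_le_integral hρ.norm (Eventually.of_forall fun _ => norm_nonneg _))
  have hi : ∀ n : ℕ, Integrable fun s => ρ s * R s ^ n := fun n => by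
    refine (hρ.norm.mul_const ((∫ s, ‖ρ s‖) ^ n)).mono'
      (hρ.1.mul (hRc.pow n).aestronglyMeasurable) (Eventually.of_forall fun s => ?_)
    rw [norm_mul, norm_pow]
    have := hRb s
    gcongr
  -- R need not be differentiable everywhere, so the power rule is obtained by induction from the
  -- integrated product rule for R^(n+1) · R.
  have hpow : ∀ n : ℕ, ∀ x y, R y ^ (n + 1) - R x ^ (n + 1) =
      ∫ s in x..y, (n + 1) * (ρ s * R s ^ n) := by
    intro n
    induction n with
    | zero => intro x y; simpa using hsub x y
    | succ n ih =>
      intro x y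
      have := bilin_sub_bilin_eq_integral (ContinuousLinearMap.mul ℝ ℝ)
        (fun x y => ((hi n).const_mul ((n:ℝ) + 1)).intervalIntegrable) hint ih hsub x y
      simp only [ContinuousLinearMap.mul_apply'] at this
      rw [pow_succ, pow_succ _ (n + 1), this]
      congr 1; funext s; push_cast; ring
  refine ⟨(hi n).integrableOn, ?_⟩
  have t1 : Tendsto (fun a => ∫ s in a..x, ((n:ℝ) + 1) * (ρ s * R s ^ n)) atBot
      (𝓝 (∫ s in Set.Iic x, ((n:ℝ) + 1) * (ρ s * R s ^ n))) :=
    intervalIntegral_tendsto_integral_Iic x ((hi n).const_mul _).integrableOn tendsto_id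
  have t0 : Tendsto R atBot (𝓝 0) := tendsto_integral_Iic_atBot hρ
  have t2 : Tendsto (fun a => R x ^ (n + 1) - R a ^ (n + 1)) atBot (𝓝 (R x ^ (n + 1))) := by
    simpa using (t0.pow (n + 1)).const_sub (R x ^ (n + 1))
  have := tendsto_nhds_unique (t1.congr fun a => (hpow n a x).symm) t2
  rw [integral_const_mul] at this
  have hn : (n:ℝ) + 1 ≠ 0 := by positivity
  field_simp
  linarith

/-! ### The evolution operator of the background problem -/

/-- `∫₀^y exp(2iμs) ds`. -/
def expPrim (μ : ℂ) (y : ℝ) : ℂ := ∫ s in (0 : ℝ)..y, Complex.exp (2 * Complex.I * μ * s)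

theorem continuous_expPrim_integrand (μ : ℂ) :
    Continuous fun s : ℝ => Complex.exp (2 * Complex.I * μ * s) := by fun_prop

theorem expPrim_of_ne_zero {μ : ℂ} (hμ : μ ≠ 0) (y : ℝ) :
    expPrim μ y = (Complex.exp (2 * Complex.I * μ * y) - 1) / (2 * Complex.I * μ) := by
  rw [expPrim, integral_exp_mul_complex (by simp [hμ])]
  simp

/-- Free of division, hence valid at μ = 0 too. The group law of `evol` rests on this form. -/
theorem two_I_mul_expPrim (μ : ℂ) (y : ℝ) :
    2 * Complex.I * μ * expPrim μ y = Complex.exp (2 * Complex.I * μ * y) - 1 := by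
  rcases eq_or_ne μ 0 with rfl | hμ
  · simp
  · rw [expPrim_of_ne_zero hμ, mul_div_cancel₀]
    simp [hμ]

theorem expPrim_zero_right (μ : ℂ) : expPrim μ 0 = 0 := by simp [expPrim]

theorem hasDerivAt_expPrim (μ : ℂ) (y : ℝ) :
    HasDerivAt (expPrim μ) (Complex.exp (2 * Complex.I * μ * y)) y :=
  ((continuous_expPrim_integrand μ).integral_hasStrictDerivAt 0 y).hasDerivAt

theorem continuous_expPrim (μ : ℂ) : Continuous (expPrim μ) :=
  continuous_iff_continuousAt.2 fun y => (hasDerivAt_expPrim μ y).continuousAt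

theorem expPrim_add (μ : ℂ) (x y : ℝ) :
    expPrim μ (x + y) = expPrim μ x + Complex.exp (2 * Complex.I * μ * x) * expPrim μ y := by
  have hi := fun a b => (continuous_expPrim_integrand μ).intervalIntegrable (μ := volume) a b
  have h := intervalIntegral.integral_comp_add_left (a := (0 : ℝ)) (b := y)
    (fun s : ℝ => Complex.exp (2 * Complex.I * μ * s)) x
  rw [add_zero] at h
  rw [expPrim, expPrim, expPrim, ← intervalIntegral.integral_add_adjacent_intervals
    (hi 0 x) (hi x (x + y)), ← h, ← intervalIntegral.integral_const_mul]
  congr 2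
  funext s
  rw [← Complex.exp_add]
  congr 1
  push_cast
  ring

/-- The integrand has modulus exp(-2s Im μ) ≤ exp(2νy). The factor y replaces the 1/|μ| of the
closed formula, so the bound survives at μ = 0; its price is the factor 1 + |s| in the weight. -/
theorem norm_expPrim_le {μ : ℂ} {ν y : ℝ} (hν : 0 ≤ ν) (hμ : -ν ≤ μ.im) (hy : 0 ≤ y) :
    ‖expPrim μ y‖ ≤ y * Real.exp (2 * ν * y) := by
  have := intervalIntegral.norm_integral_le_of_norm_le_const (a := 0) (b := y)
    (f := fun s : ℝ => Complex.exp (2 * Complex.I * μ * s)) (C := Real.exp (2 * ν * y)) ?_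
  · rw [expPrim]
    refine this.trans_eq ?_
    rw [sub_zero, abs_of_nonneg hy, mul_comm]
  · intro s hs
    rw [Set.uIoc_of_le hy] at hs
    rw [Complex.norm_exp]
    apply Real.exp_le_exp.2
    have e : (2 * Complex.I * μ * s).re = -(2 * μ.im * s) := by simp
    rw [e]
    have h1 : -μ.im * s ≤ ν * s := mul_le_mul_of_nonneg_right (by linarith) hs.1.le
    have h2 : ν * s ≤ ν * y := mul_le_mul_of_nonneg_left hs.2 hν
    linarith

/-- As a function of w = 2iμy this is y(exp w - 1)/w, whose singularity at w = 0 is removable;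
`dslope` fills it in. -/
theorem differentiable_expPrim (y : ℝ) : Differentiable ℂ fun μ => expPrim μ y := by
  have e : (fun μ => expPrim μ y) = fun μ => y * dslope Complex.exp 0 (2 * Complex.I * μ * y) := by
    funext μ
    rcases eq_or_ne (2 * Complex.I * μ * y) 0 with h | h
    · rw [h, dslope_same, Complex.deriv_exp, Complex.exp_zero]
      rcases mul_eq_zero.1 h with h | h
      · have : μ = 0 := by simpa using h
        simp [this, expPrim]
      · have : y = 0 := by simpa using h
        simp [this, expPrim]
    · have hμ : μ ≠ 0 := by rintro rfl; simp at h
      have hy : (y : ℂ) ≠ 0 := by rintro h'; simp [h'] at h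
      rw [dslope_of_ne _ h, slope_def_field, expPrim_of_ne_zero hμ]
      simp only [Complex.exp_zero, sub_zero]
      field_simp
  have hd : Differentiable ℂ (dslope Complex.exp 0) := by
    rw [← differentiableOn_univ]
    exact (Complex.differentiableOn_dslope univ_mem).2 Complex.differentiable_exp.differentiableOn
  rw [e]
  exact (hd.comp (by fun_prop)).const_mul _

section Evol

variable {E : Type*} [NormedAddCommGroup E] [NormedSpace ℂ E]

/-- `exp(yL)` for an operator with `L² = 2iμL`. -/
def evol (L : E →L[ℂ] E) (μ : ℂ) (y : ℝ) : E →L[ℂ] E := 1 + expPrim μ y • L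

theorem evol_zero (L : E →L[ℂ] E) (μ : ℂ) : evol L μ 0 = 1 := by simp [evol, expPrim_zero_right]

/-- Since exp(2iμx) = 1 + 2iμ `expPrim μ x`, the relation L² = 2iμL turns the cocycle identity of
`expPrim` into multiplicativity. -/
theorem evol_add {L : E →L[ℂ] E} {μ : ℂ} (h : L * L = (2 * Complex.I * μ) • L) (x y : ℝ) :
    evol L μ (x + y) = evol L μ x * evol L μ y := by
  have e := two_I_mul_expPrim μ x
  have e' : Complex.exp (2 * Complex.I * μ * x) = 1 + 2 * Complex.I * μ * expPrim μ x := by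
    rw [e]; ring
  simp only [evol, expPrim_add, e', add_mul, mul_add, one_mul, mul_one, smul_mul_assoc,
    mul_smul_comm, h]
  module

theorem evol_apply_of_ker {L : E →L[ℂ] E} {c : E} (h : L c = 0) (μ : ℂ) (y : ℝ) :
    evol L μ y c = c := by simp [evol, h]

theorem continuous_evol (L : E →L[ℂ] E) (μ : ℂ) : Continuous (evol L μ) :=
  continuous_const.add ((continuous_expPrim μ).smul continuous_const)

theorem mul_evol {L : E →L[ℂ] E} {μ : ℂ} (h : L * L = (2 * Complex.I * μ) • L) (y : ℝ) :
    L * evol L μ y = Complex.exp (2 * Complex.I * μ * y) • L := by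
  have e := two_I_mul_expPrim μ y
  have e' : Complex.exp (2 * Complex.I * μ * y) = 1 + 2 * Complex.I * μ * expPrim μ y := by
    rw [e]; ring
  rw [evol, mul_add, mul_one, mul_smul_comm, h, e', add_smul, one_smul, smul_smul, mul_comm]

/-- The weight `(1 + |s|) exp(2ν|s|)`. -/
def weight (ν s : ℝ) : ℝ := (1 + |s|) * Real.exp (2 * ν * |s|)

theorem continuous_weight (ν : ℝ) : Continuous (weight ν) := by unfold weight; fun_prop

theorem one_le_weight {ν : ℝ} (hν : 0 ≤ ν) (s : ℝ) : 1 ≤ weight ν s := by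
  have h1 : 1 ≤ 1 + |s| := by linarith [abs_nonneg s]
  exact one_le_mul_of_one_le_of_one_le h1 (Real.one_le_exp (by positivity))

theorem weight_nonneg {ν : ℝ} (hν : 0 ≤ ν) (s : ℝ) : 0 ≤ weight ν s :=
  zero_le_one.trans (one_le_weight hν s)

/-- From x - s ≤ X + |s| and 1 + X + |s| ≤ (1 + X)(1 + |s|), the bound factors into a part depending
on X and a part depending on s. It involves L only through C and μ only through ν, which makes it
uniform in the spectral parameter. -/
theorem norm_evol_sub_le {L : E →L[ℂ] E} {μ : ℂ} {ν x s X C : ℝ} (hν : 0 ≤ ν) (hμ : -ν ≤ μ.im)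
    (hC : 1 + ‖L‖ ≤ C) (hs : s ≤ x) (hx : x ≤ X) (hX : 0 ≤ X) :
    ‖evol L μ (x - s)‖ ≤ C * weight ν X * weight ν s := by
  have hy : 0 ≤ x - s := by linarith
  have hy' : x - s ≤ X + |s| := by linarith [neg_abs_le s]
  have hL := norm_nonneg L
  have ha := abs_nonneg s
  have he : 1 ≤ Real.exp (2 * ν * (x - s)) := Real.one_le_exp (by positivity)
  have h1 : ‖(1 : E →L[ℂ] E)‖ ≤ 1 := ContinuousLinearMap.norm_id_le
  have hexp : Real.exp (2 * ν * (x - s)) ≤ Real.exp (2 * ν * X) * Real.exp (2 * ν * |s|) := by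
    rw [← Real.exp_add]
    apply Real.exp_le_exp.2
    nlinarith
  calc ‖evol L μ (x - s)‖ ≤ ‖(1 : E →L[ℂ] E)‖ + ‖expPrim μ (x - s) • L‖ := norm_add_le _ _
    _ ≤ 1 + (x - s) * Real.exp (2 * ν * (x - s)) * ‖L‖ := by
        rw [norm_smul]
        have := norm_expPrim_le hν hμ hy
        gcongr
    _ ≤ (1 + ‖L‖) * ((1 + (x - s)) * Real.exp (2 * ν * (x - s))) := by
        have := mul_nonneg hy hL
        nlinarith [mul_nonneg hy (zero_le_one.trans he), mul_nonneg hL (zero_le_one.trans he)]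
    _ ≤ C * (((1 + X) * (1 + |s|)) * (Real.exp (2 * ν * X) * Real.exp (2 * ν * |s|))) := by
        have : 1 + (x - s) ≤ (1 + X) * (1 + |s|) := by nlinarith
        gcongr
        linarith
    _ = _ := by rw [weight, weight, abs_of_nonneg hX]; ring

end Evol

/-! ### The Volterra equation -/

section Volterra

variable {E : Type*} [NormedAddCommGroup E] [NormedSpace ℂ E]

/-- The weight `(1 + |s|) exp(2ν|s|)` makes the operator function `B` integrable at `-∞`. -/
def WeightIntegrable (ν : ℝ) (B : ℝ → E →L[ℂ] E) : Prop :=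
  ∀ X : ℝ, IntegrableOn (fun s => weight ν s • B s) (Set.Iic X)

/-- The hypotheses on the Volterra equation `m(x) = c + ∫_{-∞}^x exp((x-s)L) B(s) m(s) ds`. -/
structure VolterraData (ν : ℝ) (L : E →L[ℂ] E) (μ : ℂ) (B : ℝ → E →L[ℂ] E) (c : E) : Prop where
  nonneg : 0 ≤ ν
  le_im : -ν ≤ μ.im
  sq : L * L = (2 * Complex.I * μ) • L
  ker : L c = 0
  int : WeightIntegrable ν B

/-- The function dominating the kernel of the Volterra equation on `(-∞, X]`. -/
def majorant (ν : ℝ) (B : ℝ → E →L[ℂ] E) (C X : ℝ) : ℝ → ℝ :=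
  (Set.Iic X).indicator fun s => C * weight ν X * ‖weight ν s • B s‖

/-- The kernel of the Volterra equation applied to `f`. -/
def kernelApply (L : E →L[ℂ] E) (μ : ℂ) (B : ℝ → E →L[ℂ] E) (f : ℝ → E) (x s : ℝ) : E :=
  evol L μ (x - s) (B s (f s))

theorem WeightIntegrable.aestronglyMeasurable {ν : ℝ} (hν : 0 ≤ ν) {B : ℝ → E →L[ℂ] E}
    (hB : WeightIntegrable ν B) (X : ℝ) :
    AEStronglyMeasurable B (volume.restrict (Set.Iic X)) := by
  have h : B = fun s => (weight ν s)⁻¹ • (weight ν s • B s) := by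
    funext s
    rw [smul_smul, inv_mul_cancel₀ (zero_lt_one.trans_le (one_le_weight hν s)).ne', one_smul]
  rw [h]
  exact ((continuous_weight ν).measurable.inv.aestronglyMeasurable).smul (hB X).1

theorem WeightIntegrable.integrableOn {ν : ℝ} (hν : 0 ≤ ν) {B : ℝ → E →L[ℂ] E}
    (hB : WeightIntegrable ν B) (X : ℝ) : IntegrableOn B (Set.Iic X) := by
  refine (hB X).norm.mono' (hB.aestronglyMeasurable hν X) (Eventually.of_forall fun s => ?_)
  rw [norm_smul, Real.norm_of_nonneg (weight_nonneg hν s)]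
  exact le_mul_of_one_le_left (norm_nonneg _) (one_le_weight hν s)

theorem WeightIntegrable.intervalIntegrable {ν : ℝ} (hν : 0 ≤ ν) {B : ℝ → E →L[ℂ] E}
    (hB : WeightIntegrable ν B) (x y : ℝ) : IntervalIntegrable B volume x y := by
  rw [intervalIntegrable_iff]
  exact (hB.integrableOn hν (max x y)).mono_set fun s hs => hs.2

theorem integrable_majorant {ν : ℝ} {B : ℝ → E →L[ℂ] E} (hB : WeightIntegrable ν B) (C X : ℝ) :
    Integrable (majorant ν B C X) :=
  IntegrableOn.integrable_indicator ((hB X).norm.const_mul _) measurableSet_Iic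

theorem majorant_nonneg {ν : ℝ} (hν : 0 ≤ ν) (B : ℝ → E →L[ℂ] E) {C : ℝ} (hC : 0 ≤ C) (X s : ℝ) :
    0 ≤ majorant ν B C X s :=
  Set.indicator_nonneg (fun _ _ => mul_nonneg (mul_nonneg hC (weight_nonneg hν X))
    (norm_nonneg _)) s

theorem norm_kernelApply_le {L : E →L[ℂ] E} {μ : ℂ} {B : ℝ → E →L[ℂ] E} {ν x s X C : ℝ}
    (hν : 0 ≤ ν) (hμ : -ν ≤ μ.im) (hC : 1 + ‖L‖ ≤ C) (hs : s ≤ x) (hx : x ≤ X) (hX : 0 ≤ X)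
    (f : ℝ → E) :
    ‖kernelApply L μ B f x s‖ ≤ majorant ν B C X s * ‖f s‖ := by
  have h := norm_evol_sub_le hν hμ hC hs hx hX
  have hs' : s ∈ Set.Iic X := hs.trans hx
  rw [majorant, Set.indicator_of_mem hs', norm_smul, Real.norm_of_nonneg (weight_nonneg hν s)]
  calc _ ≤ ‖evol L μ (x - s)‖ * (‖B s‖ * ‖f s‖) :=
        ((evol L μ (x - s)).le_opNorm _).trans (by gcongr; exact (B s).le_opNorm _)
    _ ≤ (C * weight ν X * weight ν s) * (‖B s‖ * ‖f s‖) := by gcongr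
    _ = _ := by ring

theorem aestronglyMeasurable_kernelApply {L : E →L[ℂ] E} {μ : ℂ} {B : ℝ → E →L[ℂ] E} {ν : ℝ}
    (hν : 0 ≤ ν) (hB : WeightIntegrable ν B) {f : ℝ → E} (hf : Continuous f) (x X : ℝ) :
    AEStronglyMeasurable (kernelApply L μ B f x) (volume.restrict (Set.Iic X)) := by
  have h1 : Continuous (Function.uncurry fun (T : E →L[ℂ] E) (v : E) => T v) := by fun_prop
  exact h1.comp_aestronglyMeasurable₂
    ((continuous_evol L μ).comp (continuous_const.sub continuous_id)).aestronglyMeasurable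
    (h1.comp_aestronglyMeasurable₂ (hB.aestronglyMeasurable hν X) hf.aestronglyMeasurable)

/-- `f` is bounded on every half line `(-∞, X]`. -/
def LeftBounded {F : Type*} [NormedAddCommGroup F] (f : ℝ → F) : Prop := ∀ X : ℝ, ∃ D : ℝ, ∀ s ≤ X, ‖f s‖ ≤ D

theorem leftBounded_of_tendsto {F : Type*} [NormedAddCommGroup F] {f : ℝ → F} {c : F} (hf : Continuous f)
    (h : Tendsto f atBot (𝓝 c)) : LeftBounded f := by
  intro X
  have h1 := h.norm.eventually (eventually_le_nhds (lt_add_one ‖c‖))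
  obtain ⟨a, ha⟩ := eventually_atBot.1 h1
  obtain ⟨D, hD⟩ := isCompact_Icc.exists_bound_of_continuousOn (hf.continuousOn (s := Set.Icc a X))
  refine ⟨max (‖c‖ + 1) D, fun s hs => ?_⟩
  rcases le_total s a with h | h
  · exact (ha s h).trans (le_max_left _ _)
  · exact (hD s ⟨h, hs⟩).trans (le_max_right _ _)

theorem integrableOn_kernelApply {L : E →L[ℂ] E} {μ : ℂ} {B : ℝ → E →L[ℂ] E} {ν : ℝ}
    (hν : 0 ≤ ν) (hμ : -ν ≤ μ.im) (hB : WeightIntegrable ν B) {f : ℝ → E} (hf : Continuous f)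
    (hfb : LeftBounded f) (x : ℝ) : IntegrableOn (kernelApply L μ B f x) (Set.Iic x) := by
  obtain ⟨D, hD⟩ := hfb x
  -- The kernel bound needs a nonnegative right end, hence `max x 0`.
  refine Integrable.mono' (g := fun s => majorant ν B (1 + ‖L‖) (max x 0) s * D)
    ((integrable_majorant hB _ _).mul_const D).integrableOn
    (aestronglyMeasurable_kernelApply hν hB hf x x) ?_
  filter_upwards [ae_restrict_mem measurableSet_Iic] with s hs
  refine (norm_kernelApply_le hν hμ le_rfl hs (le_max_left _ _) (le_max_right _ _) f).trans ?_
  have := majorant_nonneg hν B (C := 1 + ‖L‖) (by positivity) (max x 0) s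
  have := hD s hs
  gcongr

/-- The group law moves the dependence on x out of the kernel: integrals over s at different x then
differ only by an operator in front and by their range. -/
theorem kernelApply_eq {L : E →L[ℂ] E} {μ : ℂ} (hL : L * L = (2 * Complex.I * μ) • L)
    (B : ℝ → E →L[ℂ] E) (f : ℝ → E) (x y s : ℝ) :
    kernelApply L μ B f (x + y) s = evol L μ x (kernelApply L μ B f y s) := by
  rw [kernelApply, add_sub_assoc, evol_add hL]
  rfl

/-- For s > x the kernel bound does not apply directly; the kernel based at X is integrable on (-∞,
X], and the group law carries it to base point x. -/
theorem integrableOn_kernelApply' {L : E →L[ℂ] E} {μ : ℂ} {B : ℝ → E →L[ℂ] E} {ν : ℝ}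
    (hν : 0 ≤ ν) (hμ : -ν ≤ μ.im) (hL : L * L = (2 * Complex.I * μ) • L)
    (hB : WeightIntegrable ν B) {f : ℝ → E} (hf : Continuous f)
    (hfb : LeftBounded f) (x X : ℝ) : IntegrableOn (kernelApply L μ B f x) (Set.Iic X) := by
  have h := (evol L μ (x - X)).integrable_comp
    (integrableOn_kernelApply (L := L) hν hμ hB hf hfb X)
  simp only [← kernelApply_eq hL, sub_add_cancel] at h
  exact h

theorem intervalIntegrable_kernelApply {L : E →L[ℂ] E} {μ : ℂ} {B : ℝ → E →L[ℂ] E} {ν : ℝ}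
    (hν : 0 ≤ ν) (hμ : -ν ≤ μ.im) (hL : L * L = (2 * Complex.I * μ) • L)
    (hB : WeightIntegrable ν B) {f : ℝ → E} (hf : Continuous f)
    (hfb : LeftBounded f) (r x y : ℝ) :
    IntervalIntegrable (kernelApply L μ B f r) volume x y := by
  rw [intervalIntegrable_iff]
  exact (integrableOn_kernelApply' hν hμ hL hB hf hfb r (max x y)).mono_set fun s hs => hs.2

/-- One step of the Picard iteration gains a factor `R / (n + 1)`. -/
theorem norm_integral_kernelApply_le {L : E →L[ℂ] E} {μ : ℂ} {B : ℝ → E →L[ℂ] E} {ν X C D : ℝ}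
    (hν : 0 ≤ ν) (hμ : -ν ≤ μ.im) (hB : WeightIntegrable ν B) (hC : 1 + ‖L‖ ≤ C) (hX : 0 ≤ X)
    {f : ℝ → E} {n : ℕ}
    (hf : ∀ s ≤ X, ‖f s‖ ≤ D * ((∫ r in Set.Iic s, majorant ν B C X r) ^ n / n.factorial))
    {x : ℝ} (hx : x ≤ X) :
    ‖∫ s in Set.Iic x, kernelApply L μ B f x s‖ ≤
      D * ((∫ r in Set.Iic x, majorant ν B C X r) ^ (n + 1) / (n + 1).factorial) := by
  obtain ⟨hi, he⟩ := integral_Iic_mul_primitive_pow (integrable_majorant hB C X) n x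
  have hC0 : 0 ≤ C := by linarith [norm_nonneg L]
  refine (norm_integral_le_of_norm_le (hi.const_mul (D / n.factorial)) ?_).trans_eq ?_
  · filter_upwards [ae_restrict_mem measurableSet_Iic] with s hs
    refine (norm_kernelApply_le hν hμ hC hs hx hX f).trans ?_
    refine (mul_le_mul_of_nonneg_left (hf s (le_trans hs hx))
      (majorant_nonneg hν B hC0 X s)).trans_eq ?_
    ring
  · rw [integral_const_mul, he, Nat.factorial_succ]
    push_cast
    field_simp

theorem integral_majorant_le {ν : ℝ} (hν : 0 ≤ ν) {B : ℝ → E →L[ℂ] E} (hB : WeightIntegrable ν B)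
    {C : ℝ} (hC : 0 ≤ C) (X x : ℝ) :
    0 ≤ ∫ r in Set.Iic x, majorant ν B C X r ∧
    ∫ r in Set.Iic x, majorant ν B C X r ≤ ∫ r, majorant ν B C X r :=
  ⟨integral_nonneg (majorant_nonneg hν B hC X), setIntegral_le_integral (integrable_majorant hB C X)
    (Eventually.of_forall (majorant_nonneg hν B hC X))⟩

/-- The Picard iterates. -/
def picard (L : E →L[ℂ] E) (μ : ℂ) (B : ℝ → E →L[ℂ] E) (c : E) : ℕ → ℝ → E
  | 0, _ => c
  | n + 1, x => ∫ s in Set.Iic x, kernelApply L μ B (picard L μ B c n) x s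

/-- The Picard series. -/
def volterra (L : E →L[ℂ] E) (μ : ℂ) (B : ℝ → E →L[ℂ] E) (c : E) (x : ℝ) : E :=
  ∑' n, picard L μ B c n x

/-- The solution of `u' = (L - iμ + B) u` with `exp(iμx) u(x) → c` at `-∞`, characterised by the
Volterra equation for `exp(iμx) u(x)`. -/
def IsJost (L : E →L[ℂ] E) (μ : ℂ) (B : ℝ → E →L[ℂ] E) (c : E) (u : ℝ → E) : Prop :=
  (Continuous u ∧ ∀ x y : ℝ,
    u y - u x = ∫ s in x..y, (L (u s) - (Complex.I * μ) • u s + B s (u s))) ∧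
  Tendsto (fun x : ℝ => Complex.exp (Complex.I * μ * x) • u x) atBot (𝓝 c) ∧
  ∀ x : ℝ,
    IntegrableOn (kernelApply L μ B (fun s : ℝ => Complex.exp (Complex.I * μ * s) • u s) x)
      (Set.Iic x) ∧
    Complex.exp (Complex.I * μ * x) • u x = c + ∫ s in Set.Iic x,
      kernelApply L μ B (fun s : ℝ => Complex.exp (Complex.I * μ * s) • u s) x s

/-- The Jost solution. -/
def jost (L : E →L[ℂ] E) (μ : ℂ) (B : ℝ → E →L[ℂ] E) (c : E) (x : ℝ) : E :=
  Complex.exp (-(Complex.I * μ * x)) • volterra L μ B c x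

theorem exp_smul_jost (L : E →L[ℂ] E) (μ : ℂ) (B : ℝ → E →L[ℂ] E) (c : E) (x : ℝ) :
    Complex.exp (Complex.I * μ * x) • jost L μ B c x = volterra L μ B c x := by
  rw [jost, smul_smul, ← Complex.exp_add, add_neg_cancel, Complex.exp_zero, one_smul]

theorem norm_picard_le {L : E →L[ℂ] E} {μ : ℂ} {B : ℝ → E →L[ℂ] E} {ν X C D : ℝ} {c : E}
    (hν : 0 ≤ ν) (hμ : -ν ≤ μ.im) (hB : WeightIntegrable ν B) (hC : 1 + ‖L‖ ≤ C) (hX : 0 ≤ X)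
    (hD : ‖c‖ ≤ D) (n : ℕ) :
    ∀ x ≤ X, ‖picard L μ B c n x‖ ≤
      D * ((∫ r in Set.Iic x, majorant ν B C X r) ^ n / n.factorial) := by
  induction n with
  | zero => intro x _; simpa [picard] using hD
  | succ n ih => intro x hx; exact norm_integral_kernelApply_le hν hμ hB hC hX ih hx

theorem norm_picard_le' {L : E →L[ℂ] E} {μ : ℂ} {B : ℝ → E →L[ℂ] E} {ν X C D : ℝ} {c : E}
    (hν : 0 ≤ ν) (hμ : -ν ≤ μ.im) (hB : WeightIntegrable ν B) (hC : 1 + ‖L‖ ≤ C) (hX : 0 ≤ X)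
    (hD : ‖c‖ ≤ D) (n : ℕ) (x : ℝ) (hx : x ≤ X) :
    ‖picard L μ B c n x‖ ≤ D * ((∫ r, majorant ν B C X r) ^ n / n.factorial) := by
  refine (norm_picard_le hν hμ hB hC hX hD n x hx).trans ?_
  obtain ⟨h0, h1⟩ := integral_majorant_le hν hB (C := C) (by linarith [norm_nonneg L]) X x
  have := (norm_nonneg c).trans hD
  gcongr

theorem summable_picard_bound (D R : ℝ) : Summable fun n : ℕ => D * (R ^ n / n.factorial) :=
  (Real.summable_pow_div_factorial R).mul_left D

variable {ν : ℝ} {L : E →L[ℂ] E} {μ : ℂ} {B : ℝ → E →L[ℂ] E} {c : E}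

/-- The difference of two solutions solves the homogeneous equation. Applying the Picard step to it
n times bounds it by a constant times Rⁿ/n!, which tends to 0. -/
theorem VolterraData.eq_of_integralEq (h : VolterraData ν L μ B c) {m m' : ℝ → E}
    (hm : Continuous m) (hmb : LeftBounded m) (hm' : Continuous m') (hmb' : LeftBounded m')
    (he : ∀ x, m x = c + ∫ s in Set.Iic x, kernelApply L μ B m x s)
    (he' : ∀ x, m' x = c + ∫ s in Set.Iic x, kernelApply L μ B m' x s) : m = m' := by
  have hd : ∀ x, m x - m' x = ∫ s in Set.Iic x, kernelApply L μ B (m - m') x s := fun x => by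
    have e : kernelApply L μ B (m - m') x =
        fun s => kernelApply L μ B m x s - kernelApply L μ B m' x s := by
      funext s; simp [kernelApply]
    rw [e, integral_sub (integrableOn_kernelApply h.nonneg h.le_im h.int hm hmb x)
      (integrableOn_kernelApply h.nonneg h.le_im h.int hm' hmb' x), he x, he' x]
    abel
  funext x
  obtain ⟨D, hD⟩ := hmb (max x 0)
  obtain ⟨D', hD'⟩ := hmb' (max x 0)
  have hb : ∀ n : ℕ, ∀ s ≤ max x 0, ‖(m - m') s‖ ≤ (D + D') *
      ((∫ r in Set.Iic s, majorant ν B (1 + ‖L‖) (max x 0) r) ^ n / n.factorial) := by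
    intro n
    induction n with
    | zero =>
      intro s hs
      simpa using (norm_sub_le _ _).trans (add_le_add (hD s hs) (hD' s hs))
    | succ n ih =>
      intro s hs
      rw [Pi.sub_apply, hd s]
      exact norm_integral_kernelApply_le h.nonneg h.le_im h.int le_rfl (le_max_right x 0) ih hs
  have t := (summable_picard_bound (D + D')
    (∫ r in Set.Iic x, majorant ν B (1 + ‖L‖) (max x 0) r)).tendsto_atTop_zero
  have := ge_of_tendsto' t fun n => hb n x (le_max_left _ _)
  exact sub_eq_zero.1 (norm_le_zero_iff.1 this)

theorem VolterraData.leftBounded_picard (h : VolterraData ν L μ B c) (n : ℕ) :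
    LeftBounded (picard L μ B c n) := fun X =>
  ⟨_, fun s hs => norm_picard_le' h.nonneg h.le_im h.int le_rfl (le_max_right X 0) le_rfl n s
    (hs.trans (le_max_left _ _))⟩

theorem VolterraData.summable_norm_picard (h : VolterraData ν L μ B c) (x : ℝ) :
    Summable fun n => ‖picard L μ B c n x‖ :=
  (summable_picard_bound _ _).of_nonneg_of_le (fun _ => norm_nonneg _) fun n =>
    norm_picard_le' h.nonneg h.le_im h.int le_rfl (le_max_right x 0) le_rfl n x (le_max_left _ _)

theorem VolterraData.leftBounded_volterra (h : VolterraData ν L μ B c) :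
    LeftBounded (volterra L μ B c) := fun X =>
  ⟨_, fun s hs => tsum_of_norm_bounded (summable_picard_bound _ _).hasSum fun n =>
    norm_picard_le' h.nonneg h.le_im h.int le_rfl (le_max_right X 0) le_rfl n s
      (hs.trans (le_max_left _ _))⟩

variable [CompleteSpace E]

theorem integral_kernelApply_eq {L : E →L[ℂ] E} {μ : ℂ} {B : ℝ → E →L[ℂ] E} {ν : ℝ}
    (hν : 0 ≤ ν) (hμ : -ν ≤ μ.im) (hL : L * L = (2 * Complex.I * μ) • L)
    (hB : WeightIntegrable ν B) {f : ℝ → E} (hf : Continuous f)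
    (hfb : LeftBounded f) (x : ℝ) :
    ∫ s in Set.Iic x, kernelApply L μ B f x s =
      evol L μ x (∫ s in Set.Iic x, kernelApply L μ B f 0 s) := by
  rw [← (evol L μ x).integral_comp_comm (integrableOn_kernelApply' hν hμ hL hB hf hfb 0 x)]
  simp only [← kernelApply_eq hL, add_zero]


/-- By the group law the integral is exp(xL) applied to a primitive in x of an integrable function
that does not involve x. -/
theorem continuous_integral_kernelApply {L : E →L[ℂ] E} {μ : ℂ} {B : ℝ → E →L[ℂ] E} {ν : ℝ}
    (hν : 0 ≤ ν) (hμ : -ν ≤ μ.im) (hL : L * L = (2 * Complex.I * μ) • L)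
    (hB : WeightIntegrable ν B) {f : ℝ → E} (hf : Continuous f) (hfb : LeftBounded f) :
    Continuous fun x => ∫ s in Set.Iic x, kernelApply L μ B f x s := by
  have hi := integrableOn_kernelApply' hν hμ hL hB hf hfb 0
  have h1 : ∀ x, ∫ s in Set.Iic x, kernelApply L μ B f x s =
      evol L μ x ((∫ s in Set.Iic 0, kernelApply L μ B f 0 s) +
        ∫ s in (0 : ℝ)..x, kernelApply L μ B f 0 s) := fun x => by
    rw [integral_kernelApply_eq hν hμ hL hB hf hfb,
      ← intervalIntegral.integral_Iic_sub_Iic (hi 0) (hi x), add_sub_cancel]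
  rw [funext h1]
  exact (continuous_evol L μ).clm_apply (continuous_const.add
    (intervalIntegral.continuous_primitive
      (intervalIntegrable_kernelApply hν hμ hL hB hf hfb 0) 0))

theorem VolterraData.continuous_picard (h : VolterraData ν L μ B c) (n : ℕ) :
    Continuous (picard L μ B c n) := by
  induction n with
  | zero => exact continuous_const
  | succ n ih =>
    exact continuous_integral_kernelApply h.nonneg h.le_im h.sq h.int ih (h.leftBounded_picard n)

theorem VolterraData.continuous_volterra (h : VolterraData ν L μ B c) :
    Continuous (volterra L μ B c) := by
  refine continuous_iff_continuousAt.2 fun x => ?_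
  -- The Picard series converges uniformly on half lines with nonnegative end; adding 1 makes this
  -- half line a neighbourhood of x.
  have hc : ContinuousOn (volterra L μ B c) (Set.Iic (max x 0 + 1)) :=
    continuousOn_tsum (fun n => (h.continuous_picard n).continuousOn)
      (summable_picard_bound _ _) fun n y hy =>
        norm_picard_le' h.nonneg h.le_im h.int le_rfl (by positivity) le_rfl n y hy
  exact hc.continuousAt (Iic_mem_nhds (by linarith [le_max_left x 0]))

/-- Each Picard term is the integral of its predecessor; the series Rⁿ/n! times the majorant
dominates, so sum and integral may be interchanged. -/
theorem VolterraData.volterra_eq (h : VolterraData ν L μ B c) (x : ℝ) :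
    volterra L μ B c x = c + ∫ s in Set.Iic x, kernelApply L μ B (volterra L μ B c) x s := by
  have hs := (h.summable_norm_picard x).of_norm
  rw [volterra, hs.tsum_eq_zero_add]
  congr 1
  have key : HasSum (fun n => ∫ s in Set.Iic x, kernelApply L μ B (picard L μ B c n) x s)
      (∫ s in Set.Iic x, kernelApply L μ B (volterra L μ B c) x s) := by
    set R := ∫ r, majorant ν B (1 + ‖L‖) (max x 0) r
    refine hasSum_integral_of_dominated_convergence
      (fun n s => majorant ν B (1 + ‖L‖) (max x 0) s * (‖c‖ * (R ^ n / n.factorial)))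
      (fun n => aestronglyMeasurable_kernelApply h.nonneg h.int (h.continuous_picard n) x x)
      (fun n => ?_) (Eventually.of_forall fun s => (summable_picard_bound _ _).mul_left _) ?_
      (Eventually.of_forall fun s => ?_)
    · filter_upwards [ae_restrict_mem measurableSet_Iic] with s hs
      refine (norm_kernelApply_le h.nonneg h.le_im le_rfl hs (le_max_left _ _) (le_max_right _ _)
        _).trans (mul_le_mul_of_nonneg_left ?_ (majorant_nonneg h.nonneg B (by positivity) _ s))
      exact norm_picard_le' h.nonneg h.le_im h.int le_rfl (le_max_right x 0) le_rfl n s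
        (le_trans hs (le_max_left _ _))
    · simp only [tsum_mul_left]
      exact ((integrable_majorant h.int _ _).mul_const _).integrableOn
    · exact ((evol L μ (x - s)).comp (B s)).hasSum (h.summable_norm_picard s).of_norm.hasSum
  exact key.tsum_eq

theorem VolterraData.tendsto_volterra (h : VolterraData ν L μ B c) :
    Tendsto (volterra L μ B c) atBot (𝓝 c) := by
  obtain ⟨D, hD⟩ := h.leftBounded_volterra 0
  have t0 := (tendsto_integral_Iic_atBot (integrable_majorant h.int (1 + ‖L‖) 0)).const_mul D
  rw [mul_zero] at t0
  rw [tendsto_iff_norm_sub_tendsto_zero]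
  refine squeeze_zero' (Eventually.of_forall fun _ => norm_nonneg _) ?_ t0
  filter_upwards [eventually_le_atBot 0] with x hx
  rw [h.volterra_eq x, add_sub_cancel_left]
  -- One Picard step applied to a bounded function costs a single factor R(x), the integral of the
  -- majorant over (-∞, x], which tends to 0 at -∞.
  simpa using norm_integral_kernelApply_le (n := 0) h.nonneg h.le_im h.int le_rfl le_rfl
    (by simpa using hD) hx

theorem VolterraData.continuous_jost (h : VolterraData ν L μ B c) :
    Continuous (jost L μ B c) := by
  have := h.continuous_volterra
  unfold jost
  fun_prop

/-- Variation of constants. B is only locally integrable, so the differential equation is reached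
through the integrated product rule and not by pointwise differentiation. -/
theorem VolterraData.jost_sub_jost (h : VolterraData ν L μ B c) (x y : ℝ) :
    jost L μ B c y - jost L μ B c x = ∫ s in x..y,
      (L (jost L μ B c s) - (Complex.I * μ) • jost L μ B c s + B s (jost L μ B c s)) := by
  have hc := h.continuous_volterra
  have hb := h.leftBounded_volterra
  set m := volterra L μ B c with hm
  -- Since exp(xL)c = c, the solution is m(x) = exp(xL)g(x), where g is c plus the integral of
  -- exp(-sL)B(s)m(s) up to x.
  set g : ℝ → E := fun x => c + ∫ s in Set.Iic x, kernelApply L μ B m 0 s with hg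
  have hmg : ∀ x, m x = evol L μ x (g x) := fun x => by
    rw [hm, h.volterra_eq, integral_kernelApply_eq h.nonneg h.le_im h.sq h.int hc hb, hg, map_add,
      evol_apply_of_ker h.ker]
  -- F is the fundamental solution of the background problem, F' = (L - iμ)F, and the Jost solution
  -- is F g.
  set F : ℝ → E →L[ℂ] E := fun x => Complex.exp (-(Complex.I * μ * x)) • evol L μ x with hF
  set F' : ℝ → E →L[ℂ] E := fun x => L * F x - (Complex.I * μ) • F x with hF'
  have hFc : Continuous F := by have := continuous_evol L μ; fun_prop
  have hF'c : Continuous F' := by fun_prop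
  have hder : ∀ x, HasDerivAt F (F' x) x := fun x => by
    have d1 : HasDerivAt (fun x : ℝ => Complex.exp (-(Complex.I * μ * x)))
        (Complex.exp (-(Complex.I * μ * x)) * (-(Complex.I * μ * 1))) x :=
      (((hasDerivAt_id x).ofReal_comp.const_mul (Complex.I * μ)).neg).cexp
    have d2 : HasDerivAt (evol L μ) (Complex.exp (2 * Complex.I * μ * x) • L) x :=
      ((hasDerivAt_expPrim μ x).smul_const L).const_add 1
    refine (d1.smul d2).congr_deriv ?_
    simp only [hF', hF]
    simp only [mul_smul_comm, mul_evol h.sq]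
    module
  have hFs : ∀ x y, F y - F x = ∫ s in x..y, F' s := fun x y =>
    (intervalIntegral.integral_eq_sub_of_hasDerivAt (fun s _ => hder s)
      (hF'c.intervalIntegrable _ _)).symm
  have hgs : ∀ x y, g y - g x = ∫ s in x..y, kernelApply L μ B m 0 s := fun x y => by
    have hi := integrableOn_kernelApply' h.nonneg h.le_im h.sq h.int hc hb 0
    rw [hg, ← intervalIntegral.integral_Iic_sub_Iic (hi x) (hi y)]
    exact add_sub_add_left_eq_sub _ _ _
  have := bilin_sub_bilin_eq_integral
    ((ContinuousLinearMap.id ℂ (E →L[ℂ] E)).bilinearRestrictScalars ℝ)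
    (fun x y => hF'c.intervalIntegrable x y)
    (intervalIntegrable_kernelApply h.nonneg h.le_im h.sq h.int hc hb 0) hFs hgs x y
  simp only [ContinuousLinearMap.bilinearRestrictScalars_apply_apply,
    ContinuousLinearMap.id_apply] at this
  have hu : ∀ x, jost L μ B c x = F x (g x) := fun x => by
    rw [jost, ← hm, hmg]; rfl
  rw [hu, hu, this]
  congr 1
  funext s
  have e1 : F s (kernelApply L μ B m 0 s) = B s (jost L μ B c s) := by
    have e := kernelApply_eq h.sq B m s 0 s
    have e' : F s (kernelApply L μ B m 0 s) =
        Complex.exp (-(Complex.I * μ * s)) • evol L μ s (kernelApply L μ B m 0 s) := rfl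
    rw [e', ← e, kernelApply, add_zero, sub_self, evol_zero, jost, map_smul, ← hm]
    rfl
  have e2 : F' s (g s) = L (jost L μ B c s) - (Complex.I * μ) • jost L μ B c s := by
    rw [hu]; rfl
  rw [e1, e2]

theorem VolterraData.isJost_jost (h : VolterraData ν L μ B c) :
    IsJost L μ B c (jost L μ B c) := by
  refine ⟨⟨h.continuous_jost, h.jost_sub_jost⟩, ?_⟩
  simp only [exp_smul_jost]
  exact ⟨h.tendsto_volterra, fun x => ⟨integrableOn_kernelApply h.nonneg h.le_im h.int
    h.continuous_volterra h.leftBounded_volterra x, h.volterra_eq x⟩⟩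

theorem VolterraData.eq_jost (h : VolterraData ν L μ B c) {u : ℝ → E} (hu : IsJost L μ B c u) :
    u = jost L μ B c := by
  obtain ⟨⟨hc, -⟩, ht, he⟩ := hu
  have hc' : Continuous fun x : ℝ => Complex.exp (Complex.I * μ * x) • u x := by fun_prop
  have := h.eq_of_integralEq hc' (leftBounded_of_tendsto hc' ht) h.continuous_volterra
    h.leftBounded_volterra (fun x => (he x).2) h.volterra_eq
  funext x
  rw [jost, ← this, smul_smul, ← Complex.exp_add, neg_add_cancel, Complex.exp_zero, one_smul]

end Volterra

/-! ### Dependence on parameters -/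

/-- Integrals of dominated families of holomorphic functions are holomorphic. -/
theorem differentiableOn_integral_of_dominated {α G : Type*} [MeasurableSpace α] {κ : Measure α}
    [NormedAddCommGroup G] [NormedSpace ℂ G] {F : ℂ → α → G} {U : Set ℂ} {bound : α → ℝ}
    (hU : IsOpen U) (hF : ∀ z ∈ U, AEStronglyMeasurable (F z) κ)
    (hb : ∀ᵐ a ∂κ, ∀ z ∈ U, ‖F z a‖ ≤ bound a) (hbi : Integrable bound κ)
    (hd : ∀ᵐ a ∂κ, DifferentiableOn ℂ (fun z => F z a) U) :
    DifferentiableOn ℂ (fun z => ∫ a, F z a ∂κ) U := by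
  intro z₀ hz₀
  -- The radius 2r leaves room for discs of radius r around all points of the ball of radius r/2.
  -- Cauchy's estimate on such discs bounds the derivative by `bound a / r`.
  obtain ⟨r, hr, hrU⟩ : ∃ r > 0, Metric.ball z₀ (2 * r) ⊆ U := by
    obtain ⟨ε, hε, h⟩ := Metric.isOpen_iff.1 hU z₀ hz₀
    exact ⟨ε / 2, by positivity, by rwa [mul_div_cancel₀ _ two_ne_zero]⟩
  have hcb : ∀ z ∈ Metric.ball z₀ (r / 2), Metric.closedBall z r ⊆ U := fun z hz w hw => by
    apply hrU
    rw [Metric.mem_ball] at *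
    have := dist_triangle w z z₀
    rw [Metric.mem_closedBall] at hw
    linarith
  -- The derivative is an almost everywhere limit of measurable difference quotients along z₀ + r/(n
  -- + 1); the shift by N keeps these points inside U.
  have hmeas : AEStronglyMeasurable (fun a => deriv (fun z => F z a) z₀) κ := by
    have ht : Tendsto (fun n : ℕ => z₀ + (r : ℂ) * (1 / ((n : ℂ) + 1))) atTop (𝓝 z₀) := by
      simpa using ((tendsto_one_div_add_atTop_nhds_zero_nat (𝕜 := ℂ)).const_mul (r : ℂ)).const_add z₀
    have hne : ∀ n : ℕ, z₀ + (r : ℂ) * (1 / ((n : ℂ) + 1)) ≠ z₀ := fun n => by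
      have : (n : ℂ) + 1 ≠ 0 := Nat.cast_add_one_ne_zero n
      simp [hr.ne', this]
    have ht' := tendsto_nhdsWithin_iff (s := {z₀}ᶜ).2 ⟨ht, Eventually.of_forall hne⟩
    obtain ⟨N, hN⟩ := eventually_atTop.1 (ht.eventually (hU.mem_nhds hz₀))
    refine aestronglyMeasurable_of_tendsto_ae atTop
      (f := fun n a => slope (fun z => F z a) z₀ (z₀ + (r : ℂ) * (1 / (((n + N : ℕ) : ℂ) + 1))))
      (fun n => ?_) ?_
    · simp only [slope_def_module]
      exact ((hF _ (hN _ (Nat.le_add_left N n))).sub (hF _ hz₀)).const_smul _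
    · filter_upwards [hd] with a ha
      have := (ha.differentiableAt (hU.mem_nhds hz₀)).hasDerivAt.tendsto_slope
      exact (this.comp ht').comp (tendsto_add_atTop_nat N)
  have h := hasDerivAt_integral_of_dominated_loc_of_deriv_le (𝕜 := ℂ) (μ := κ) (F := F) (x₀ := z₀)
    (s := Metric.ball z₀ (r / 2)) (F' := fun z a => deriv (fun z => F z a) z)
    (bound := fun a => bound a / r)
    (Metric.ball_mem_nhds z₀ (by positivity)) ?_ ?_ hmeas ?_ (hbi.div_const r) ?_
  · exact h.2.differentiableAt.differentiableWithinAt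
  · filter_upwards [hU.mem_nhds hz₀] with z hz using hF z hz
  · exact hbi.mono' (hF z₀ hz₀) (hb.mono fun a ha => ha z₀ hz₀)
  · filter_upwards [hb, hd] with a ha hda z hz
    refine Complex.norm_deriv_le_of_forall_mem_sphere_norm_le hr ?_ fun w hw =>
      ha w (hcb z hz (Metric.sphere_subset_closedBall hw))
    have := hda.mono (hcb z hz)
    exact DifferentiableOn.diffContOnCl (by rwa [closure_ball z hr.ne'])
  · filter_upwards [hd] with a hda z hz
    exact (hda.differentiableAt (hU.mem_nhds
      (hcb z hz (Metric.mem_closedBall_self hr.le)))).hasDerivAt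

section Parameters

variable {E : Type*} [NormedAddCommGroup E] [NormedSpace ℂ E] [CompleteSpace E]
  {ν : ℝ} {L : ℂ → E →L[ℂ] E} {μ : ℂ → ℂ} {B : ℝ → E →L[ℂ] E} {c : ℂ → E} {Z : Set ℂ}

theorem continuousOn_picard {C D : ℝ} (h : ∀ z ∈ Z, VolterraData ν (L z) (μ z) B (c z))
    (hC : ∀ z ∈ Z, 1 + ‖L z‖ ≤ C) (hD : ∀ z ∈ Z, ‖c z‖ ≤ D) (hL : ContinuousOn L Z)
    (hμ : ContinuousOn μ Z) (hc : ContinuousOn c Z) (n : ℕ) :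
    ∀ x, ContinuousOn (fun z => picard (L z) (μ z) B (c z) n x) Z := by
  induction n with
  | zero => exact fun x => hc
  | succ n ih =>
    intro x
    -- Integrability of B is available only through the hypothesis at some point of Z.
    rcases Z.eq_empty_or_nonempty with rfl | ⟨z₁, hz₁⟩
    · exact continuousOn_empty _
    refine continuousOn_of_dominated (bound := fun s => majorant ν B C (max x 0) s *
      (D * ((∫ r, majorant ν B C (max x 0) r) ^ n / n.factorial)))
      (fun z hz => aestronglyMeasurable_kernelApply (h z hz).nonneg (h z hz).int
        ((h z hz).continuous_picard n) x x) (fun z hz => ?_) ?_ (Eventually.of_forall fun s => ?_)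
    · filter_upwards [ae_restrict_mem measurableSet_Iic] with s hs
      refine (norm_kernelApply_le (h z hz).nonneg (h z hz).le_im (hC z hz) hs (le_max_left _ _)
        (le_max_right _ _) _).trans (mul_le_mul_of_nonneg_left ?_ (majorant_nonneg (h z hz).nonneg B
          (by linarith [hC z hz, norm_nonneg (L z)]) _ s))
      exact norm_picard_le' (h z hz).nonneg (h z hz).le_im (h z hz).int (hC z hz)
        (le_max_right x 0) (hD z hz) n s (le_trans hs (le_max_left _ _))
    · exact ((integrable_majorant (h z₁ hz₁).int _ _).mul_const _).integrableOn
    · have h1 : ContinuousOn (fun z => evol (L z) (μ z) (x - s)) Z :=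
        continuousOn_const.add
          (((differentiable_expPrim (x - s)).continuous.comp_continuousOn hμ).smul hL)
      exact h1.clm_apply ((B s).continuous.comp_continuousOn (ih s))

theorem differentiableOn_picard {C D : ℝ} (h : ∀ z ∈ Z, VolterraData ν (L z) (μ z) B (c z))
    (hC : ∀ z ∈ Z, 1 + ‖L z‖ ≤ C) (hD : ∀ z ∈ Z, ‖c z‖ ≤ D) (hZ : IsOpen Z)
    (hL : DifferentiableOn ℂ L Z) (hμ : DifferentiableOn ℂ μ Z) (hc : DifferentiableOn ℂ c Z)
    (n : ℕ) : ∀ x, DifferentiableOn ℂ (fun z => picard (L z) (μ z) B (c z) n x) Z := by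
  induction n with
  | zero => exact fun x => hc
  | succ n ih =>
    intro x
    rcases Z.eq_empty_or_nonempty with rfl | ⟨z₁, hz₁⟩
    · exact differentiableOn_empty
    refine differentiableOn_integral_of_dominated (bound := fun s => majorant ν B C (max x 0) s *
      (D * ((∫ r, majorant ν B C (max x 0) r) ^ n / n.factorial))) hZ
      (fun z hz => aestronglyMeasurable_kernelApply (h z hz).nonneg (h z hz).int
        ((h z hz).continuous_picard n) x x) ?_ ?_ (Eventually.of_forall fun s => ?_)
    · filter_upwards [ae_restrict_mem measurableSet_Iic] with s hs z hz
      refine (norm_kernelApply_le (h z hz).nonneg (h z hz).le_im (hC z hz) hs (le_max_left _ _)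
        (le_max_right _ _) _).trans (mul_le_mul_of_nonneg_left ?_ (majorant_nonneg (h z hz).nonneg B
          (by linarith [hC z hz, norm_nonneg (L z)]) _ s))
      exact norm_picard_le' (h z hz).nonneg (h z hz).le_im (h z hz).int (hC z hz)
        (le_max_right x 0) (hD z hz) n s (le_trans hs (le_max_left _ _))
    · exact ((integrable_majorant (h z₁ hz₁).int _ _).mul_const _).integrableOn
    · have h1 : DifferentiableOn ℂ (fun z => evol (L z) (μ z) (x - s)) Z :=
        (differentiableOn_const _).add
          (((differentiable_expPrim (x - s)).comp_differentiableOn hμ).smul hL)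
      exact h1.clm_apply ((B s).differentiable.comp_differentiableOn (ih s))

/-- The Jost solution depends continuously on parameters. -/
theorem continuousOn_jost_zero (h : ∀ z ∈ Z, VolterraData ν (L z) (μ z) B (c z))
    (hL : ContinuousOn L Z) (hμ : ContinuousOn μ Z) (hc : ContinuousOn c Z) :
    ContinuousOn (fun z => jost (L z) (μ z) B (c z) 0) Z := by
  have e : (fun z => jost (L z) (μ z) B (c z) 0) = fun z => volterra (L z) (μ z) B (c z) 0 := by
    funext z; simp [jost]
  rw [e]
  intro z₀ hz₀
  -- On Y the norms of L and c have common bounds, so one summable sequence dominates all Picard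
  -- terms and the series converges uniformly there.
  set Y : Set ℂ := Z ∩ {z | 1 + ‖L z‖ ≤ 2 + ‖L z₀‖ ∧ ‖c z‖ ≤ ‖c z₀‖ + 1} with hY
  have hsub : Y ⊆ Z := Set.inter_subset_left
  have hmem : Y ∈ 𝓝[Z] z₀ := by
    have h1 := (hL z₀ hz₀).norm.eventually (eventually_le_nhds (lt_add_one ‖L z₀‖))
    have h2 := (hc z₀ hz₀).norm.eventually (eventually_le_nhds (lt_add_one ‖c z₀‖))
    filter_upwards [h1, h2, self_mem_nhdsWithin] with z h1 h2 hz
    exact ⟨hz, by linarith, h2⟩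
  have key : ContinuousOn (fun z => volterra (L z) (μ z) B (c z) 0) Y := by
    have hY1 : ∀ z ∈ Y, VolterraData ν (L z) (μ z) B (c z) := fun z hz => h z hz.1
    have hY2 : ∀ z ∈ Y, 1 + ‖L z‖ ≤ 2 + ‖L z₀‖ := fun z hz => hz.2.1
    have hY3 : ∀ z ∈ Y, ‖c z‖ ≤ ‖c z₀‖ + 1 := fun z hz => hz.2.2
    exact continuousOn_tsum (fun n => continuousOn_picard hY1 hY2 hY3 (hL.mono hsub)
      (hμ.mono hsub) (hc.mono hsub) n 0) (summable_picard_bound _ _) fun n z hz =>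
        norm_picard_le' (hY1 z hz).nonneg (hY1 z hz).le_im (hY1 z hz).int (hY2 z hz) le_rfl
          (hY3 z hz) n 0 le_rfl
  exact (key z₀ (mem_of_mem_nhdsWithin hz₀ hmem)).mono_of_mem_nhdsWithin hmem

/-- The Jost solution depends holomorphically on parameters. -/
theorem differentiableOn_jost_zero (h : ∀ z ∈ Z, VolterraData ν (L z) (μ z) B (c z))
    (hZ : IsOpen Z) (hL : DifferentiableOn ℂ L Z) (hμ : DifferentiableOn ℂ μ Z)
    (hc : DifferentiableOn ℂ c Z) :
    DifferentiableOn ℂ (fun z => jost (L z) (μ z) B (c z) 0) Z := by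
  have e : (fun z => jost (L z) (μ z) B (c z) 0) = fun z => volterra (L z) (μ z) B (c z) 0 := by
    funext z; simp [jost]
  rw [e]
  intro z₀ hz₀
  have hN : {z | 1 + ‖L z‖ ≤ 2 + ‖L z₀‖ ∧ ‖c z‖ ≤ ‖c z₀‖ + 1} ∈ 𝓝 z₀ := by
    have h1 := (hL.continuousOn.continuousAt (hZ.mem_nhds hz₀)).norm.eventually
      (eventually_le_nhds (lt_add_one ‖L z₀‖))
    have h2 := (hc.continuousOn.continuousAt (hZ.mem_nhds hz₀)).norm.eventually
      (eventually_le_nhds (lt_add_one ‖c z₀‖))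
    filter_upwards [h1, h2] with z h1 h2
    exact ⟨by linarith, h2⟩
  obtain ⟨Y, hYs, hYo, hYm⟩ := mem_nhds_iff.1 (inter_mem (hZ.mem_nhds hz₀) hN)
  have hsub : Y ⊆ Z := fun z hz => (hYs hz).1
  have key : DifferentiableOn ℂ (fun z => volterra (L z) (μ z) B (c z) 0) Y := by
    have hY1 : ∀ z ∈ Y, VolterraData ν (L z) (μ z) B (c z) := fun z hz => h z (hsub hz)
    have hY2 : ∀ z ∈ Y, 1 + ‖L z‖ ≤ 2 + ‖L z₀‖ := fun z hz => (hYs hz).2.1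
    have hY3 : ∀ z ∈ Y, ‖c z‖ ≤ ‖c z₀‖ + 1 := fun z hz => (hYs hz).2.2
    exact Complex.differentiableOn_tsum_of_summable_norm (summable_picard_bound _ _)
      (fun n => differentiableOn_picard hY1 hY2 hY3 hYo (hL.mono hsub)
        (hμ.mono hsub) (hc.mono hsub) n 0) hYo fun n z hz =>
        norm_picard_le' (hY1 z hz).nonneg (hY1 z hz).le_im (hY1 z hz).int (hY2 z hz) le_rfl
          (hY3 z hz) n 0 le_rfl
  exact (key.differentiableAt (hYo.mem_nhds hYm)).differentiableWithinAt

end Parameters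

/-! ### The uniformising variable of the surface -/

section SurfaceGeometry

variable {q₀ : ℝ}

/-- The uniformising variable `λ + k` of the surface. -/
def Surface.unif (p : Surface q₀) : ℂ := p.lam + p.k

/-- `k` as a function of `λ + k`. -/
def kOf (q₀ : ℝ) (z : ℂ) : ℂ := (z - (q₀ : ℂ) ^ 2 / z) / 2

/-- `λ` as a function of `λ + k`. -/
def lamOf (q₀ : ℝ) (z : ℂ) : ℂ := (z + (q₀ : ℂ) ^ 2 / z) / 2

theorem Surface.lam_sq (p : Surface q₀) : p.lam ^ 2 = p.k ^ 2 + (q₀ : ℂ) ^ 2 := p.2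

/-- This is the factored equation of the curve. It shows that λ + k has no zeros and recovers λ - k,
hence both k and λ, from it. -/
theorem Surface.unif_mul (p : Surface q₀) : p.unif * (p.lam - p.k) = (q₀ : ℂ) ^ 2 := by
  rw [Surface.unif]; linear_combination p.lam_sq

theorem Surface.unif_ne_zero (hq : 0 < q₀) (p : Surface q₀) : p.unif ≠ 0 := by
  intro h
  have := p.unif_mul
  rw [h, zero_mul] at this
  exact hq.ne' (by simpa using this.symm)

theorem Surface.sq_div_unif (hq : 0 < q₀) (p : Surface q₀) :
    (q₀ : ℂ) ^ 2 / p.unif = p.lam - p.k := by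
  rw [← p.unif_mul, mul_div_cancel_left₀ _ (p.unif_ne_zero hq)]

theorem Surface.kOf_unif (hq : 0 < q₀) (p : Surface q₀) : kOf q₀ p.unif = p.k := by
  rw [kOf, p.sq_div_unif hq, Surface.unif]; ring

theorem Surface.lamOf_unif (hq : 0 < q₀) (p : Surface q₀) : lamOf q₀ p.unif = p.lam := by
  rw [lamOf, p.sq_div_unif hq, Surface.unif]; ring

theorem lamOf_sq {z : ℂ} (hz : z ≠ 0) : lamOf q₀ z ^ 2 = kOf q₀ z ^ 2 + (q₀ : ℂ) ^ 2 := by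
  rw [lamOf, kOf]; field_simp; ring

theorem lamOf_add_kOf (z : ℂ) : lamOf q₀ z + kOf q₀ z = z := by rw [lamOf, kOf]; ring

theorem differentiableOn_kOf : DifferentiableOn ℂ (kOf q₀) {0}ᶜ := fun _ hz =>
  (((differentiableAt_id).sub ((differentiableAt_const _).div differentiableAt_id (Set.mem_compl_singleton_iff.1 hz))).div_const
    2).differentiableWithinAt

theorem differentiableOn_lamOf : DifferentiableOn ℂ (lamOf q₀) {0}ᶜ := fun _ hz =>
  (((differentiableAt_id).add ((differentiableAt_const _).div differentiableAt_id (Set.mem_compl_singleton_iff.1 hz))).div_const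
    2).differentiableWithinAt

theorem Surface.continuous_k : Continuous (Surface.k : Surface q₀ → ℂ) :=
  continuous_fst.comp continuous_subtype_val

theorem Surface.continuous_lam : Continuous (Surface.lam : Surface q₀ → ℂ) :=
  continuous_snd.comp continuous_subtype_val

theorem Surface.continuous_unif : Continuous (Surface.unif : Surface q₀ → ℂ) :=
  Surface.continuous_lam.add Surface.continuous_k

/-- Holomorphic functions of the uniformising variable are analytic on the surface. -/
theorem analyticOnSurface_of_differentiableOn {g : ℂ → ℂ} {U : Set ℂ} (hU : IsOpen U)
    (hg : DifferentiableOn ℂ g U) {F : Surface q₀ → ℂ} {V : Set (Surface q₀)}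
    (hV : ∀ p ∈ V, p.unif ∈ U) (hF : ∀ p : Surface q₀, p.unif ∈ U → F p = g p.unif) :
    AnalyticOnSurface F V := by
  intro p hp
  refine ⟨fun w => g (w.2 + w.1), ?_, ?_⟩
  · have h1 : AnalyticAt ℂ (fun w : ℂ × ℂ => w.2 + w.1) p.1 := analyticAt_snd.add analyticAt_fst
    exact AnalyticAt.comp (g := g) (f := fun w : ℂ × ℂ => w.2 + w.1) (x := p.1)
      (hg.analyticAt (hU.mem_nhds (hV p hp))) h1
  · filter_upwards [Surface.continuous_unif.continuousAt.eventually (hU.mem_nhds (hV p hp))]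
      with p' hp' using hF p' hp'

theorem Surface.lam_ne_zero {p : Surface q₀} (hp : p ∉ branchPoints q₀) : p.lam ≠ 0 := by
  intro h
  have h1 := p.lam_sq
  rw [h] at h1
  have h2 : (p.k - Complex.I * q₀) * (p.k + Complex.I * q₀) = 0 := by
    linear_combination -h1 - (q₀ : ℂ) ^ 2 * Complex.I_sq
  rcases mul_eq_zero.1 h2 with h3 | h3
  · exact hp (Or.inl (sub_eq_zero.1 h3))
  · exact hp (Or.inr (eq_neg_of_add_eq_zero_left h3))

theorem Surface.re_sq (p : Surface q₀) :
    p.lam.re ^ 2 - p.lam.im ^ 2 = p.k.re ^ 2 - p.k.im ^ 2 + q₀ ^ 2 := by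
  have := congrArg Complex.re p.lam_sq
  simpa [sq] using this

theorem Surface.re_mul_im (p : Surface q₀) : p.lam.re * p.lam.im = p.k.re * p.k.im := by
  have := congrArg Complex.im p.lam_sq
  simp [sq] at this
  linarith

/-! ### The half sheets -/

theorem polarAngle_mem (w : ℂ) :
    -(Real.pi / 2) ≤ polarAngle w ∧ polarAngle w < 3 * Real.pi / 2 := by
  have := toIcoMod_mem_Ico Real.two_pi_pos (-(Real.pi / 2)) (Complex.arg w)
  refine ⟨this.1, this.2.trans_eq (by ring)⟩

theorem exp_I_mul_ofReal_re (x : ℝ) : (Complex.exp (Complex.I * x)).re = Real.cos x := by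
  rw [mul_comm, Complex.exp_ofReal_mul_I_re]

theorem exp_I_mul_ofReal_im (x : ℝ) : (Complex.exp (Complex.I * x)).im = Real.sin x := by
  rw [mul_comm, Complex.exp_ofReal_mul_I_im]

theorem norm_mul_cos_polarAngle (w : ℂ) : ‖w‖ * Real.cos (polarAngle w) = w.re := by
  have := congrArg Complex.re (norm_mul_exp_polarAngle w)
  rwa [Complex.re_ofReal_mul, exp_I_mul_ofReal_re] at this

theorem norm_mul_sin_polarAngle (w : ℂ) : ‖w‖ * Real.sin (polarAngle w) = w.im := by
  have := congrArg Complex.im (norm_mul_exp_polarAngle w)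
  rwa [Complex.im_ofReal_mul, exp_I_mul_ofReal_im] at this

theorem polarAngle_lt_of_re_pos {w : ℂ} (h : 0 < w.re) : polarAngle w < Real.pi / 2 ∧
    -(Real.pi / 2) < polarAngle w := by
  obtain ⟨h1, h2⟩ := polarAngle_mem w
  rw [← norm_mul_cos_polarAngle] at h
  have hc : 0 < Real.cos (polarAngle w) := pos_of_mul_pos_right h (norm_nonneg w)
  constructor
  · by_contra! h3
    exact absurd hc (not_lt.2 (Real.cos_nonpos_of_pi_div_two_le_of_le h3 (by linarith)))
  · refine lt_of_le_of_ne h1 fun h3 => ?_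
    rw [← h3, Real.cos_neg, Real.cos_pi_div_two] at hc
    exact lt_irrefl _ hc

theorem pi_div_two_lt_polarAngle_of_re_neg {w : ℂ} (h : w.re < 0) :
    Real.pi / 2 < polarAngle w := by
  obtain ⟨h1, h2⟩ := polarAngle_mem w
  by_contra! h3
  rw [← norm_mul_cos_polarAngle] at h
  exact absurd h (not_lt.2 (mul_nonneg (norm_nonneg w) (Real.cos_nonneg_of_mem_Icc ⟨h1, h3⟩)))

theorem polarAngle_of_re_eq_zero {w : ℂ} (h : w.re = 0) (hw : w ≠ 0) :
    polarAngle w = -(Real.pi / 2) ∨ polarAngle w = Real.pi / 2 := by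
  obtain ⟨h1, h2⟩ := polarAngle_mem w
  rw [← norm_mul_cos_polarAngle] at h
  have hc : Real.cos (polarAngle w) = 0 := (mul_eq_zero.1 h).resolve_left (norm_ne_zero_iff.2 hw)
  rcases h1.eq_or_lt with h3 | h3
  · exact Or.inl h3.symm
  rcases lt_trichotomy (polarAngle w) (Real.pi / 2) with h4 | h4 | h4
  · exact absurd hc (Real.cos_pos_of_mem_Ioo ⟨h3, h4⟩).ne'
  · exact Or.inr h4
  · exact absurd hc (Real.cos_neg_of_pi_div_two_lt_of_lt h4 (by linarith)).ne

theorem polarAngle_of_im_pos {w : ℂ} (h : w.re = 0) (h' : 0 < w.im) :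
    polarAngle w = Real.pi / 2 := by
  refine (polarAngle_of_re_eq_zero h (by rintro rfl; simp at h')).resolve_left fun h1 => ?_
  rw [← norm_mul_sin_polarAngle, h1, Real.sin_neg, Real.sin_pi_div_two] at h'
  linarith [norm_nonneg w]

theorem polarAngle_of_im_neg {w : ℂ} (h : w.re = 0) (h' : w.im < 0) :
    polarAngle w = -(Real.pi / 2) := by
  refine (polarAngle_of_re_eq_zero h (by rintro rfl; simp at h')).resolve_right fun h1 => ?_
  rw [← norm_mul_sin_polarAngle, h1, Real.sin_pi_div_two] at h'
  linarith [norm_nonneg w]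

theorem lamI_re (k : ℂ) : (lamI q₀ k).re =
    Real.sqrt (‖k - Complex.I * q₀‖ * ‖k + Complex.I * q₀‖) *
      Real.cos ((polarAngle (k - Complex.I * q₀) + polarAngle (k + Complex.I * q₀)) / 2) := by
  rw [lamI, Complex.re_ofReal_mul, exp_I_mul_ofReal_re]

theorem lamI_im (k : ℂ) : (lamI q₀ k).im =
    Real.sqrt (‖k - Complex.I * q₀‖ * ‖k + Complex.I * q₀‖) *
      Real.sin ((polarAngle (k - Complex.I * q₀) + polarAngle (k + Complex.I * q₀)) / 2) := by
  rw [lamI, Complex.im_ofReal_mul, exp_I_mul_ofReal_im]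

theorem lamI_re_mul_im (k : ℂ) : (lamI q₀ k).re * (lamI q₀ k).im = k.re * k.im :=
  Surface.re_mul_im (⟨(k, lamI q₀ k), lamI_sq q₀ k⟩ : Surface q₀)

theorem sqrt_norm_mul_norm_pos {k : ℂ} (h1 : k - Complex.I * q₀ ≠ 0) (h2 : k + Complex.I * q₀ ≠ 0) :
    0 < Real.sqrt (‖k - Complex.I * q₀‖ * ‖k + Complex.I * q₀‖) :=
  Real.sqrt_pos.2 (mul_pos (norm_pos_iff.2 h1) (norm_pos_iff.2 h2))

theorem sub_I_mul_re (k : ℂ) : (k - Complex.I * q₀).re = k.re := by simp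

theorem add_I_mul_re (k : ℂ) : (k + Complex.I * q₀).re = k.re := by simp

theorem sub_I_mul_im (k : ℂ) : (k - Complex.I * q₀).im = k.im - q₀ := by simp

theorem add_I_mul_im (k : ℂ) : (k + Complex.I * q₀).im = k.im + q₀ := by simp

/-- Both polar angles lie in (-π/2, π/2), hence so does their mean. For Re k < 0 the interval is
(π/2, 3π/2); the chosen range of angles thus makes Re λ follow the sign of Re k. -/
theorem lamI_re_pos {k : ℂ} (hk : 0 < k.re) : 0 < (lamI q₀ k).re := by
  have h1 : 0 < (k - Complex.I * q₀).re := by rwa [sub_I_mul_re]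
  have h2 : 0 < (k + Complex.I * q₀).re := by rwa [add_I_mul_re]
  obtain ⟨a1, a2⟩ := polarAngle_lt_of_re_pos h1
  obtain ⟨b1, b2⟩ := polarAngle_lt_of_re_pos h2
  rw [lamI_re]
  exact mul_pos (sqrt_norm_mul_norm_pos (fun h => by simp [h] at h1) (fun h => by simp [h] at h2))
    (Real.cos_pos_of_mem_Ioo ⟨by linarith, by linarith⟩)

theorem lamI_re_neg {k : ℂ} (hk : k.re < 0) : (lamI q₀ k).re < 0 := by
  have h1 : (k - Complex.I * q₀).re < 0 := by rwa [sub_I_mul_re]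
  have h2 : (k + Complex.I * q₀).re < 0 := by rwa [add_I_mul_re]
  have a1 := pi_div_two_lt_polarAngle_of_re_neg h1
  have b1 := pi_div_two_lt_polarAngle_of_re_neg h2
  have a2 := (polarAngle_mem (k - Complex.I * q₀)).2
  have b2 := (polarAngle_mem (k + Complex.I * q₀)).2
  rw [lamI_re]
  exact mul_neg_of_pos_of_neg
    (sqrt_norm_mul_norm_pos (fun h => by simp [h] at h1) (fun h => by simp [h] at h2))
    (Real.cos_neg_of_pi_div_two_lt_of_lt (by linarith) (by linarith))

/-- Off the imaginary axis this follows from Re λ · Im λ = Re k · Im k, since Re λ and Re k have the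
same sign. On the axis above iq₀ both angles equal π/2. -/
theorem lamI_im_pos (hq : 0 < q₀) {k : ℂ} (hk : 0 < k.im) (hk' : ¬ (k.re = 0 ∧ k.im ≤ q₀)) :
    0 < (lamI q₀ k).im := by
  have hm := lamI_re_mul_im (q₀ := q₀) k
  rcases lt_trichotomy k.re 0 with h | h | h
  · have h1 := lamI_re_neg (q₀ := q₀) h
    by_contra! h2
    nlinarith [mul_nonneg_of_nonpos_of_nonpos h1.le h2]
  · have h3 : q₀ < k.im := by by_contra! h3; exact hk' ⟨h, h3⟩
    have i1 : 0 < (k - Complex.I * q₀).im := by rw [sub_I_mul_im]; linarith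
    have i2 : 0 < (k + Complex.I * q₀).im := by rw [add_I_mul_im]; linarith
    rw [lamI_im, polarAngle_of_im_pos (by rw [sub_I_mul_re, h]) i1,
      polarAngle_of_im_pos (by rw [add_I_mul_re, h]) i2, add_halves, Real.sin_pi_div_two, mul_one]
    exact sqrt_norm_mul_norm_pos (fun h => by simp [h] at i1) (fun h => by simp [h] at i2)
  · have h1 := lamI_re_pos (q₀ := q₀) h
    by_contra! h2
    nlinarith [mul_nonpos_of_nonneg_of_nonpos h1.le h2]

theorem lamI_im_neg (hq : 0 < q₀) {k : ℂ} (hk : k.im < 0) (hk' : ¬ (k.re = 0 ∧ -q₀ ≤ k.im)) :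
    (lamI q₀ k).im < 0 := by
  have hm := lamI_re_mul_im (q₀ := q₀) k
  rcases lt_trichotomy k.re 0 with h | h | h
  · have h1 := lamI_re_neg (q₀ := q₀) h
    by_contra! h2
    nlinarith [mul_nonpos_of_nonpos_of_nonneg h1.le h2]
  · have h3 : k.im < -q₀ := by by_contra! h3; exact hk' ⟨h, h3⟩
    have i1 : (k - Complex.I * q₀).im < 0 := by rw [sub_I_mul_im]; linarith
    have i2 : (k + Complex.I * q₀).im < 0 := by rw [add_I_mul_im]; linarith
    rw [lamI_im, polarAngle_of_im_neg (by rw [sub_I_mul_re, h]) i1,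
      polarAngle_of_im_neg (by rw [add_I_mul_re, h]) i2, ← neg_add, neg_div,
      add_halves, Real.sin_neg,
      Real.sin_pi_div_two, mul_neg_one]
    exact neg_lt_zero.2
      (sqrt_norm_mul_norm_pos (fun h => by simp [h] at i1) (fun h => by simp [h] at i2))
  · have h1 := lamI_re_pos (q₀ := q₀) h
    by_contra! h2
    nlinarith [mul_nonneg h1.le h2]

/-- Over the cut λ² = q₀² - (Im k)² ≥ 0, so λ is real there. -/
theorem Surface.not_on_cut {p : Surface q₀} (h : p.lam.im ≠ 0) :
    ¬ (p.k.re = 0 ∧ p.k.im ^ 2 ≤ q₀ ^ 2) := by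
  rintro ⟨h1, h2⟩
  have e1 := p.re_sq
  have e2 := p.re_mul_im
  rw [h1, zero_mul] at e2
  have e3 := (mul_eq_zero.1 e2).resolve_right h
  rw [e3, h1] at e1
  have := sq_pos_of_ne_zero h
  nlinarith

theorem Surface.lam_eq_or (p : Surface q₀) : p.lam = lamI q₀ p.k ∨ p.lam = -lamI q₀ p.k :=
  sq_eq_sq_iff_eq_or_eq_neg.1 (p.lam_sq.trans (lamI_sq q₀ p.k).symm)

/-- This trades the branch of the square root for two open sign conditions. Conversely, positive
imaginary parts exclude the cut, and a point on the other sheet would have λ = -`lamI`, with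
negative imaginary part. -/
theorem Kplus_eq (hq : 0 < q₀) : Kplus q₀ = {p | 0 < p.k.im ∧ 0 < p.lam.im} := by
  ext p
  constructor
  · rintro ⟨h1, h2, h3⟩
    exact ⟨h2, h1 ▸ lamI_im_pos hq h2 h3⟩
  · rintro ⟨h1, h2⟩
    have hc : ¬ (p.k.re = 0 ∧ p.k.im ≤ q₀) := fun h =>
      Surface.not_on_cut h2.ne' ⟨h.1, pow_le_pow_left₀ h1.le h.2 2⟩
    refine ⟨p.lam_eq_or.resolve_right fun h => ?_, h1, hc⟩
    have := lamI_im_pos hq h1 hc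
    rw [h, Complex.neg_im] at h2
    linarith

theorem Kminus_eq (hq : 0 < q₀) : Kminus q₀ = {p | p.k.im < 0 ∧ p.lam.im < 0} := by
  ext p
  constructor
  · rintro ⟨h1, h2, h3⟩
    exact ⟨h2, h1 ▸ lamI_im_neg hq h2 h3⟩
  · rintro ⟨h1, h2⟩
    have hc : ¬ (p.k.re = 0 ∧ -q₀ ≤ p.k.im) := fun h =>
      Surface.not_on_cut h2.ne ⟨h.1, by nlinarith [h.2]⟩
    refine ⟨p.lam_eq_or.resolve_right fun h => ?_, h1, hc⟩
    have := lamI_im_neg hq h1 hc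
    rw [h, Complex.neg_im] at h2
    linarith

theorem Surface.lam_im_eq_zero_of_k_im_eq_zero (hq : 0 < q₀) {p : Surface q₀} (h : p.k.im = 0) :
    p.lam.im = 0 := by
  have e1 := p.re_sq
  have e2 := p.re_mul_im
  rw [h, mul_zero] at e2
  rcases mul_eq_zero.1 e2 with h1 | h1
  · rw [h, h1] at e1
    nlinarith [sq_nonneg p.lam.im, sq_nonneg p.k.re, sq_pos_of_pos hq]
  · exact h1

theorem Surface.continuous_k_im : Continuous fun p : Surface q₀ => p.k.im :=
  Complex.continuous_im.comp Surface.continuous_k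

theorem Surface.continuous_lam_im : Continuous fun p : Surface q₀ => p.lam.im :=
  Complex.continuous_im.comp Surface.continuous_lam

theorem closure_Kplus_subset (hq : 0 < q₀) :
    closure (Kplus q₀) ⊆ {p | 0 ≤ p.k.im ∧ 0 ≤ p.lam.im} := by
  rw [Kplus_eq hq]
  exact closure_minimal (fun p hp => ⟨hp.1.le, hp.2.le⟩)
    ((isClosed_le continuous_const Surface.continuous_k_im).inter
      (isClosed_le continuous_const Surface.continuous_lam_im))

theorem closure_Kminus_subset (hq : 0 < q₀) :
    closure (Kminus q₀) ⊆ {p | p.k.im ≤ 0 ∧ p.lam.im ≤ 0} := by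
  rw [Kminus_eq hq]
  exact closure_minimal (fun p hp => ⟨hp.1.le, hp.2.le⟩)
    ((isClosed_le Surface.continuous_k_im continuous_const).inter
      (isClosed_le Surface.continuous_lam_im continuous_const))

/-- A frontier point has Im k ≥ 0 and Im λ ≥ 0. If Im λ were not 0, then Im k would not be 0 either,
because λ is real over real k; the point would then lie in the open set K⁺ itself. -/
theorem frontier_Kplus_subset (hq : 0 < q₀) : frontier (Kplus q₀) ⊆ {p | p.lam.im = 0} := by
  have ho : IsOpen (Kplus q₀) := by
    rw [Kplus_eq hq]
    exact (isOpen_lt continuous_const Surface.continuous_k_im).inter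
      (isOpen_lt continuous_const Surface.continuous_lam_im)
  intro p hp
  rw [ho.frontier_eq] at hp
  obtain ⟨h1, h2⟩ := closure_Kplus_subset hq hp.1
  by_contra h3
  have h4 : p.k.im ≠ 0 := fun h => h3 (Surface.lam_im_eq_zero_of_k_im_eq_zero hq h)
  exact hp.2 ((Kplus_eq hq).symm ▸ ⟨lt_of_le_of_ne h1 h4.symm, lt_of_le_of_ne h2 (Ne.symm h3)⟩)

theorem frontier_Kminus_subset (hq : 0 < q₀) : frontier (Kminus q₀) ⊆ {p | p.lam.im = 0} := by
  have ho : IsOpen (Kminus q₀) := by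
    rw [Kminus_eq hq]
    exact (isOpen_lt Surface.continuous_k_im continuous_const).inter
      (isOpen_lt Surface.continuous_lam_im continuous_const)
  intro p hp
  rw [ho.frontier_eq] at hp
  obtain ⟨h1, h2⟩ := closure_Kminus_subset hq hp.1
  by_contra h3
  have h4 : p.k.im ≠ 0 := fun h => h3 (Surface.lam_im_eq_zero_of_k_im_eq_zero hq h)
  exact hp.2 ((Kminus_eq hq).symm ▸ ⟨lt_of_le_of_ne h1 h4, lt_of_le_of_ne h2 h3⟩)

theorem continuousSpectrum_subset (hq : 0 < q₀) :
    continuousSpectrum q₀ ⊆ {p | p.lam.im = 0} \ branchPoints q₀ := by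
  rintro p (h | ⟨h1, h2, h3⟩)
  · refine ⟨Surface.lam_im_eq_zero_of_k_im_eq_zero hq h, ?_⟩
    rintro (h' | h') <;> simp [h', hq.ne'] at h
  · refine ⟨?_, ?_⟩
    · by_contra h4
      exact Surface.not_on_cut h4 ⟨h1, by nlinarith⟩
    · rintro (h' | h') <;> simp [h'] at h2 h3

end SurfaceGeometry

/-! ### The four eigenfunctions as Jost solutions -/

/-- The operator of multiplication by a matrix. -/
def matOp : Matrix (Fin 2) (Fin 2) ℂ →ₗ[ℂ] ((Fin 2 → ℂ) →L[ℂ] (Fin 2 → ℂ)) :=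
  (LinearMap.toContinuousLinearMap (𝕜 := ℂ) (E := Fin 2 → ℂ) (F' := Fin 2 → ℂ)).toLinearMap ∘ₗ
    (Matrix.toLin' (R := ℂ) (m := Fin 2) (n := Fin 2)).toLinearMap

theorem matOp_apply (M : Matrix (Fin 2) (Fin 2) ℂ) (v : Fin 2 → ℂ) : matOp M v = M *ᵥ v := rfl

theorem matOp_mul (M N : Matrix (Fin 2) (Fin 2) ℂ) : matOp (M * N) = matOp M * matOp N := by
  refine ContinuousLinearMap.ext fun v => ?_
  exact (Matrix.mulVec_mulVec v M N).symm

theorem matOp_one : matOp 1 = 1 := by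
  exact ContinuousLinearMap.ext fun v => Matrix.one_mulVec v

section Generator

variable {E : Type*} [NormedAddCommGroup E] [NormedSpace ℂ E]

/-- The generator `M + iμ` of the evolution of `exp(iμx) u(x)` for `u' = M u`. -/
def gen (M : E →L[ℂ] E) (μ : ℂ) : E →L[ℂ] E := M + (Complex.I * μ) • 1

theorem gen_apply (M : E →L[ℂ] E) (μ : ℂ) (v : E) : gen M μ v = M v + (Complex.I * μ) • v := rfl

/-- Expand (M + iμ)² = -μ² + 2iμM - μ² and use 2iμ · iμ = -2μ². -/
theorem gen_mul_gen {M : E →L[ℂ] E} {μ : ℂ} (h : M * M = (-μ ^ 2) • 1) :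
    gen M μ * gen M μ = (2 * Complex.I * μ) • gen M μ := by
  simp only [gen, add_mul, mul_add, h, smul_mul_assoc, mul_smul_comm, one_mul, mul_one]
  have e : (Complex.I * μ) • (Complex.I * μ) • (1 : E →L[ℂ] E) = (-μ ^ 2) • 1 := by
    rw [smul_smul]; congr 1; linear_combination μ ^ 2 * Complex.I_sq
  have e' : (2 * Complex.I * μ) • (Complex.I * μ) • (1 : E →L[ℂ] E) = (2 * (-μ ^ 2)) • 1 := by
    rw [smul_smul]; congr 1; linear_combination 2 * μ ^ 2 * Complex.I_sq
  simp only [smul_add, e, e']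
  module

theorem evol_apply (L : E →L[ℂ] E) (μ : ℂ) (y : ℝ) (v : E) :
    evol L μ y v = v + expPrim μ y • L v := rfl

end Generator

/-- The closed formula of the Green functions. It needs μ ≠ 0, whereas `evol` itself is regular at μ
= 0. -/
theorem evol_gen_apply (M : Matrix (Fin 2) (Fin 2) ℂ) {μ : ℂ} (hμ : μ ≠ 0) (y : ℝ)
    (v : Fin 2 → ℂ) :
    evol (gen (matOp M) μ) μ y v =
      (1 / (2 * μ)) • ((((1 + Complex.exp (2 * Complex.I * μ * y)) * μ) •
          (1 : Matrix (Fin 2) (Fin 2) ℂ) -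
        (Complex.I * (Complex.exp (2 * Complex.I * μ * y) - 1)) • M) *ᵥ v) := by
  have hI := Complex.I_ne_zero
  have e1 : (1 : ℂ) + expPrim μ y * (Complex.I * μ) =
      1 / (2 * μ) * ((1 + Complex.exp (2 * Complex.I * μ * y)) * μ) := by
    rw [expPrim_of_ne_zero hμ]; field_simp; ring
  have e2 : expPrim μ y =
      -(1 / (2 * μ) * (Complex.I * (Complex.exp (2 * Complex.I * μ * y) - 1))) := by
    rw [expPrim_of_ne_zero hμ]; field_simp
    linear_combination (Complex.exp (2 * Complex.I * μ * y) - 1) * Complex.I_sq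
  have h : evol (gen (matOp M) μ) μ y v = (1 + expPrim μ y * (Complex.I * μ)) • v +
      expPrim μ y • (M *ᵥ v) := by
    rw [evol_apply, gen_apply, matOp_apply]
    module
  rw [h, e1, Matrix.sub_mulVec, Matrix.smul_mulVec, Matrix.smul_mulVec, Matrix.one_mulVec]
  rw [e2]
  module

variable {D : Potential} {t : ℝ} {p : Surface D.q₀}

/-- `Q - Q_∞` as an operator function. -/
def pertOp (D : Potential) (t : ℝ) (Qinf : Matrix (Fin 2) (Fin 2) ℂ) (x : ℝ) :
    (Fin 2 → ℂ) →L[ℂ] (Fin 2 → ℂ) := matOp (D.Q t x - Qinf)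

theorem integrable_heaviside_smul_iff {f : ℝ → Fin 2 → ℂ} {x : ℝ} :
    Integrable (fun s => heaviside (x - s) • f s) ↔ IntegrableOn f (Set.Iic x) := by
  have e : (fun s => heaviside (x - s) • f s) = (Set.Iio x).indicator f := by
    funext s
    by_cases h : s < x <;> simp [heaviside, Set.indicator, h]
  rw [e, integrable_indicator_iff measurableSet_Iio, integrableOn_Iic_iff_integrableOn_Iio]

theorem integral_heaviside_smul (f : ℝ → Fin 2 → ℂ) (x : ℝ) :
    ∫ s, heaviside (x - s) • f s = ∫ s in Set.Iic x, f s := by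
  have e : (fun s => heaviside (x - s) • f s) = (Set.Iio x).indicator f := by
    funext s
    by_cases h : s < x <;> simp [heaviside, Set.indicator, h]
  rw [e, integral_indicator measurableSet_Iio, integral_Iic_eq_integral_Iio]

/-- The Heaviside factor restricts the integral to s < x, and the endpoint is a null set; what
remains is a Volterra equation. -/
theorem solvesIntegralEq_left_iff {G : ℝ → Matrix (Fin 2) (Fin 2) ℂ}
    {Qinf : Matrix (Fin 2) (Fin 2) ℂ} {c : Fin 2 → ℂ} {m : ℝ → Fin 2 → ℂ}
    {L : (Fin 2 → ℂ) →L[ℂ] (Fin 2 → ℂ)} {μ : ℂ}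
    (hG : ∀ y v, G y *ᵥ v = heaviside y • evol L μ y v) :
    SolvesIntegralEq D t G Qinf c m ↔
      ∀ x, IntegrableOn (kernelApply L μ (pertOp D t Qinf) m x) (Set.Iic x) ∧
        m x = c + ∫ s in Set.Iic x, kernelApply L μ (pertOp D t Qinf) m x s := by
  refine forall_congr' fun x => ?_
  have e : (fun s => G (x - s) *ᵥ ((D.Q t s - Qinf) *ᵥ m s)) =
      fun s => heaviside (x - s) • kernelApply L μ (pertOp D t Qinf) m x s := by
    funext s
    rw [hG]; rfl
  rw [e, integrable_heaviside_smul_iff, integral_heaviside_smul]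

/-- Reflection turns integrals over (x, ∞) into integrals over left half lines. The minus sign of
the right Green functions is absorbed into the reflected perturbation. -/
theorem solvesIntegralEq_right_iff {G : ℝ → Matrix (Fin 2) (Fin 2) ℂ}
    {Qinf : Matrix (Fin 2) (Fin 2) ℂ} {c : Fin 2 → ℂ} {m : ℝ → Fin 2 → ℂ}
    {L : (Fin 2 → ℂ) →L[ℂ] (Fin 2 → ℂ)} {μ : ℂ}
    (hG : ∀ y v, G (-y) *ᵥ v = -(heaviside y • evol L μ y v)) :
    SolvesIntegralEq D t G Qinf c m ↔
      ∀ x, IntegrableOn (kernelApply L μ (fun s => -pertOp D t Qinf (-s)) (fun s => m (-s)) x)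
          (Set.Iic x) ∧
        m (-x) = c + ∫ s in Set.Iic x,
          kernelApply L μ (fun s => -pertOp D t Qinf (-s)) (fun s => m (-s)) x s := by
  refine (Equiv.neg ℝ).forall_congr fun x => ?_
  rw [Equiv.neg_apply, neg_neg]
  have e : (fun s => G (x - -s) *ᵥ ((D.Q t (-s) - Qinf) *ᵥ m (-s))) =
      fun s => heaviside (-x - s) •
        kernelApply L μ (fun s => -pertOp D t Qinf (-s)) (fun s => m (-s)) (-x) s := by
    funext s
    have e' : x - -s = -(-x - s) := by ring
    rw [e', hG, kernelApply, neg_apply, map_neg, smul_neg]; rfl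
  rw [← integral_neg_eq_self, e, integral_heaviside_smul, ← integrable_heaviside_smul_iff, ← e]
  refine and_congr_left fun _ => ⟨fun h => h.comp_neg, fun h => ?_⟩
  simpa using h.comp_neg

/-- `Qinf` and μ are arbitrary here: both cancel on the right-hand side. -/
theorem solvesScattering_left_iff {Qinf : Matrix (Fin 2) (Fin 2) ℂ} {μ : ℂ} {u : ℝ → Fin 2 → ℂ} :
    SolvesScattering D t p u ↔ Continuous u ∧ ∀ x y : ℝ, u y - u x = ∫ s in x..y,
      (gen (matOp ((Complex.I * p.k) • J + Qinf)) μ (u s) - (Complex.I * μ) • u s +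
        pertOp D t Qinf s (u s)) := by
  have e : ∀ s, gen (matOp ((Complex.I * p.k) • J + Qinf)) μ (u s) - (Complex.I * μ) • u s +
      pertOp D t Qinf s (u s) = ((Complex.I * p.k) • J + D.Q t s) *ᵥ u s := fun s => by
    rw [gen_apply, pertOp, matOp_apply, matOp_apply, add_sub_cancel_right]
    rw [← Matrix.add_mulVec]
    congr 1
    abel
  simp only [e]
  rfl

theorem solvesScattering_right_iff {Qinf : Matrix (Fin 2) (Fin 2) ℂ} {μ : ℂ}
    {u : ℝ → Fin 2 → ℂ} :
    SolvesScattering D t p u ↔ Continuous (fun x => u (-x)) ∧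
      ∀ x y : ℝ, u (-y) - u (-x) = ∫ s in x..y,
      (gen (matOp (-((Complex.I * p.k) • J + Qinf))) μ (u (-s)) - (Complex.I * μ) • u (-s) +
        (-pertOp D t Qinf (-s)) (u (-s))) := by
  have e : ∀ s, gen (matOp (-((Complex.I * p.k) • J + Qinf))) μ (u (-s)) -
      (Complex.I * μ) • u (-s) + (-pertOp D t Qinf (-s)) (u (-s)) =
        -(((Complex.I * p.k) • J + D.Q t (-s)) *ᵥ u (-s)) := fun s => by
    rw [gen_apply, pertOp, neg_apply, matOp_apply, matOp_apply, add_sub_cancel_right,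
      Matrix.neg_mulVec]
    rw [← neg_add, ← Matrix.add_mulVec]
    congr 2
    abel
  simp only [e]
  refine and_congr ⟨fun h => h.comp continuous_neg, fun h => ?_⟩ ?_
  · simpa [Function.comp_def] using h.comp continuous_neg
  · refine (Equiv.neg ℝ).forall_congr fun x => (Equiv.neg ℝ).forall_congr fun y => ?_
    rw [intervalIntegral.integral_neg, intervalIntegral.integral_comp_neg
      (fun s => ((Complex.I * p.k) • J + D.Q t s) *ᵥ u s), ← intervalIntegral.integral_symm]
    simp

theorem exp_neg_lam (lam : ℂ) (x : ℝ) :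
    Complex.exp (Complex.I * -lam * x) = Complex.exp (-(Complex.I * lam * x)) := by
  congr 1; ring

theorem exp_two_neg_lam (lam : ℂ) (x : ℝ) :
    Complex.exp (2 * Complex.I * -lam * x) = Complex.exp (-(2 * Complex.I * lam * x)) := by
  congr 1; ring

theorem exp_neg_pos (lam : ℂ) (x : ℝ) :
    Complex.exp (-(Complex.I * lam * (-x : ℝ))) = Complex.exp (Complex.I * lam * x) := by
  congr 1; push_cast; ring

theorem exp_two_neg_pos (lam : ℂ) (x : ℝ) :
    Complex.exp (-(2 * Complex.I * lam * (-x : ℝ))) = Complex.exp (2 * Complex.I * lam * x) := by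
  congr 1; push_cast; ring

theorem exp_pos_neg (lam : ℂ) (x : ℝ) :
    Complex.exp (Complex.I * lam * (-x : ℝ)) = Complex.exp (-(Complex.I * lam * x)) := by
  congr 1; push_cast; ring

theorem exp_two_pos_neg (lam : ℂ) (x : ℝ) :
    Complex.exp (2 * Complex.I * lam * (-x : ℝ)) = Complex.exp (-(2 * Complex.I * lam * x)) := by
  congr 1; push_cast; ring

theorem tendsto_atTop_iff_comp_neg {f : ℝ → Fin 2 → ℂ} {c : Fin 2 → ℂ} :
    Tendsto f atTop (𝓝 c) ↔ Tendsto (fun x => f (-x)) atBot (𝓝 c) := by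
  refine ⟨fun h => h.comp tendsto_neg_atBot_atTop, fun h => ?_⟩
  simpa [Function.comp_def] using h.comp tendsto_neg_atTop_atBot

/-- Only here and in the three analogues does λ ≠ 0 enter the passage to Jost solutions, through the
division in the Green function; `IsJost` makes sense at the branch points as well. -/
theorem isPhi_iff (hp : p.lam ≠ 0) {u : ℝ → Fin 2 → ℂ} :
    IsPhi D t p u ↔ IsJost (gen (matOp ((Complex.I * p.k) • J + D.Qm t)) p.lam) p.lam
      (pertOp D t (D.Qm t)) ![p.lam + p.k, Complex.I * D.qp (-t)] u := by
  refine and_congr solvesScattering_left_iff (and_congr_right fun _ =>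
    solvesIntegralEq_left_iff fun y v => ?_)
  rw [evol_gen_apply _ hp, smul_smul, mul_one_div, greenM, Matrix.smul_mulVec]

theorem isPhiBar_iff (hp : p.lam ≠ 0) {u : ℝ → Fin 2 → ℂ} :
    IsPhiBar D t p u ↔ IsJost (gen (matOp ((Complex.I * p.k) • J + D.Qm t)) (-p.lam)) (-p.lam)
      (pertOp D t (D.Qm t)) ![-(Complex.I * D.qm t), p.lam + p.k] u := by
  unfold IsPhiBar IsJost
  simp only [exp_neg_lam]
  refine and_congr solvesScattering_left_iff (and_congr_right fun _ =>
    solvesIntegralEq_left_iff fun y v => ?_)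
  rw [evol_gen_apply _ (neg_ne_zero.2 hp), smul_smul, mul_one_div, greenMBar, Matrix.smul_mulVec,
    exp_two_neg_lam]
  simp only [Matrix.add_mulVec, Matrix.sub_mulVec, Matrix.smul_mulVec, Matrix.one_mulVec, mul_neg,
    div_neg]
  module

/-- The reflection of ψ solves u' = -(ikJ + Q(-x))u and is normalised at -∞ with the same λ. -/
theorem isPsi_iff (hp : p.lam ≠ 0) {u : ℝ → Fin 2 → ℂ} :
    IsPsi D t p u ↔ IsJost (gen (matOp (-((Complex.I * p.k) • J + D.Qp t))) p.lam) p.lam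
      (fun s => -pertOp D t (D.Qp t) (-s)) ![-(Complex.I * D.qp t), p.lam + p.k]
      (fun x => u (-x)) := by
  unfold IsPsi IsJost
  rw [tendsto_atTop_iff_comp_neg, solvesScattering_right_iff (μ := p.lam) (Qinf := D.Qp t),
    solvesIntegralEq_right_iff (L := gen (matOp (-((Complex.I * p.k) • J + D.Qp t))) p.lam)
      (μ := p.lam)]
  · simp only [exp_neg_pos]
  intro y v
  rw [evol_gen_apply _ hp, smul_smul, mul_one_div, greenP, Matrix.smul_mulVec, exp_two_neg_pos,
    neg_neg]
  simp only [Matrix.add_mulVec, Matrix.sub_mulVec, Matrix.smul_mulVec, Matrix.one_mulVec,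
    Matrix.neg_mulVec]
  module

theorem isPsiBar_iff (hp : p.lam ≠ 0) {u : ℝ → Fin 2 → ℂ} :
    IsPsiBar D t p u ↔ IsJost (gen (matOp (-((Complex.I * p.k) • J + D.Qp t))) (-p.lam)) (-p.lam)
      (fun s => -pertOp D t (D.Qp t) (-s)) ![p.lam + p.k, Complex.I * D.qm (-t)]
      (fun x => u (-x)) := by
  unfold IsPsiBar IsJost
  rw [tendsto_atTop_iff_comp_neg, solvesScattering_right_iff (μ := -p.lam) (Qinf := D.Qp t),
    solvesIntegralEq_right_iff (L := gen (matOp (-((Complex.I * p.k) • J + D.Qp t))) (-p.lam))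
      (μ := -p.lam)]
  · simp only [exp_pos_neg, exp_neg_lam]
  intro y v
  rw [evol_gen_apply _ (neg_ne_zero.2 hp), smul_smul, mul_one_div, greenPBar, Matrix.smul_mulVec,
    exp_two_neg_lam, exp_two_pos_neg, neg_neg]
  simp only [Matrix.add_mulVec, Matrix.sub_mulVec, Matrix.smul_mulVec, Matrix.one_mulVec,
    Matrix.neg_mulVec, mul_neg, div_neg]
  module

/-! ### Integrability of the perturbation -/

theorem MemL11.integrableOn {f : ℝ → ℂ} {S : Set ℝ} (hf : MemL11 f S) : IntegrableOn f S := by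
  have hpos : ∀ x : ℝ, 1 ≤ 1 + |x| := fun x => by linarith [abs_nonneg x]
  have e : f = fun x => (f x * ((1 + |x| : ℝ) : ℂ)) * (((1 + |x|)⁻¹ : ℝ) : ℂ) := by
    funext x
    have : ((1 + |x| : ℝ) : ℂ) ≠ 0 := Complex.ofReal_ne_zero.2 (by linarith [hpos x])
    rw [Complex.ofReal_inv, mul_assoc, mul_inv_cancel₀ this, mul_one]
  have hm : AEStronglyMeasurable f (volume.restrict S) := by
    rw [e]
    refine hf.1.mul (Continuous.aestronglyMeasurable ?_)
    refine Complex.continuous_ofReal.comp (Continuous.inv₀ (by fun_prop) fun x => ?_)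
    linarith [hpos x]
  refine hf.norm.mono' hm (Eventually.of_forall fun x => ?_)
  rw [norm_mul, Complex.norm_real, Real.norm_of_nonneg (by linarith [hpos x])]
  exact le_mul_of_one_le_right (norm_nonneg _) (hpos x)

theorem MemL11.comp_neg {f : ℝ → ℂ} (hf : MemL11 f (Set.Ici 0)) :
    MemL11 (fun x => f (-x)) (Set.Iic 0) := by
  have h := ((Measure.measurePreserving_neg (volume : Measure ℝ)).integrableOn_comp_preimage
    (Homeomorph.neg ℝ).measurableEmbedding).2 hf
  have e : (fun x : ℝ => -x) ⁻¹' Set.Ici 0 = Set.Iic 0 := by ext; simp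
  rw [MemL11, ← e]
  simpa [Function.comp_def] using h

/-- A function in `L¹(-∞, 0]` with a weight, and in `L¹[0, ∞)` up to a constant, is locally
integrable with the weight. -/
theorem integrableOn_Iic_weight_mul {f : ℝ → ℂ} {ν : ℝ} {d : ℂ}
    (hf : IntegrableOn (fun s => (weight ν s : ℂ) * f s) (Set.Iic 0))
    (hf' : IntegrableOn (fun s => f s + d) (Set.Ici 0)) (X : ℝ) :
    IntegrableOn (fun s => (weight ν s : ℂ) * f s) (Set.Iic X) := by
  have h1 : IntegrableOn f (Set.Icc 0 X) := by
    have h2 : IntegrableOn (fun _ : ℝ => d) (Set.Icc 0 X) := by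
      exact continuous_const.integrableOn_Icc
    have h3 := (hf'.mono_set Set.Icc_subset_Ici_self).sub h2
    refine h3.congr (Eventually.of_forall fun s => ?_)
    simp
  have h2 : IntegrableOn (fun s => (weight ν s : ℂ) * f s) (Set.Icc 0 X) :=
    h1.continuousOn_mul (Complex.continuous_ofReal.comp (continuous_weight ν)).continuousOn
      isCompact_Icc
  refine (hf.union h2).mono_set fun s hs => ?_
  rcases le_total s 0 with h | h
  · exact Or.inl h
  · exact Or.inr ⟨h, hs⟩

theorem MemL11.weight_zero {f : ℝ → ℂ} {S : Set ℝ} (hf : MemL11 f S) :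
    IntegrableOn (fun s => (weight 0 s : ℂ) * f s) S := by
  have e : (fun s => (weight 0 s : ℂ) * f s) = fun s => f s * ((1 + |s| : ℝ) : ℂ) := by
    funext s; simp [weight, mul_comm]
  rw [e]; exact hf

/-- Bound 1 + |s| by exp|s| and complete the square. Only half of the exponent a is spent, so the
product with exp(-as²) is still integrable. -/
theorem weight_le {ν a : ℝ} (ha : 0 < a) (s : ℝ) :
    weight ν s ≤ Real.exp ((2 * ν + 1) ^ 2 / (2 * a)) * Real.exp (a / 2 * s ^ 2) := by
  have h1 : 1 + |s| ≤ Real.exp |s| := by linarith [Real.add_one_le_exp |s|]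
  calc weight ν s ≤ Real.exp |s| * Real.exp (2 * ν * |s|) := by unfold weight; gcongr
    _ = Real.exp ((2 * ν + 1) * |s|) := by rw [← Real.exp_add]; congr 1; ring
    _ ≤ _ := by
      rw [← Real.exp_add]
      apply Real.exp_le_exp.2
      rw [← sq_abs s]
      have h2 : (2 * ν + 1) ^ 2 / (2 * a) + a / 2 * |s| ^ 2 - (2 * ν + 1) * |s| =
          (2 * ν + 1 - a * |s|) ^ 2 / (2 * a) := by field_simp; ring
      have h3 : 0 ≤ (2 * ν + 1 - a * |s|) ^ 2 / (2 * a) := by positivity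
      linarith

/-- Gaussian decay gives integrability with every exponential weight. -/
theorem integrableOn_weight_of_gaussian {f : ℝ → ℂ} {a : ℝ} (ha : 0 < a)
    (hf : IntegrableOn f (Set.Iic 0))
    (hO : f =O[atBot] fun x : ℝ => Real.exp (-a * x ^ 2)) {ν : ℝ} (hν : 0 ≤ ν) :
    IntegrableOn (fun s => (weight ν s : ℂ) * f s) (Set.Iic 0) := by
  obtain ⟨C, hC, hb⟩ := hO.exists_pos
  obtain ⟨Y, hY⟩ := eventually_atBot.1 hb.bound
  have hw : Continuous fun s : ℝ => (weight ν s : ℂ) :=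
    Complex.continuous_ofReal.comp (continuous_weight ν)
  have h2 : IntegrableOn (fun s => (weight ν s : ℂ) * f s) (Set.Icc Y 0) :=
    (hf.mono_set Set.Icc_subset_Iic_self).continuousOn_mul hw.continuousOn isCompact_Icc
  have h1 : IntegrableOn (fun s => (weight ν s : ℂ) * f s) (Set.Iic (min Y 0)) := by
    have hg := (integrable_exp_neg_mul_sq (half_pos ha)).const_mul
      (C * Real.exp ((2 * ν + 1) ^ 2 / (2 * a)))
    refine hg.integrableOn.mono' (hw.aestronglyMeasurable.mul
      (hf.mono_set (Set.Iic_subset_Iic.2 (min_le_right _ _))).1) ?_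
    filter_upwards [ae_restrict_mem measurableSet_Iic] with s hs
    have b1 := hY s (le_trans hs (min_le_left _ _))
    have b2 := weight_le (ν := ν) ha s
    rw [Real.norm_of_nonneg (Real.exp_pos _).le] at b1
    rw [norm_mul, Complex.norm_real, Real.norm_of_nonneg (weight_nonneg hν s)]
    calc weight ν s * ‖f s‖ ≤ (Real.exp ((2 * ν + 1) ^ 2 / (2 * a)) * Real.exp (a / 2 * s ^ 2)) *
          (C * Real.exp (-a * s ^ 2)) := by gcongr
      _ = C * Real.exp ((2 * ν + 1) ^ 2 / (2 * a)) *
          (Real.exp (a / 2 * s ^ 2) * Real.exp (-a * s ^ 2)) := by ring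
      _ = _ := by rw [← Real.exp_add]; congr 2; ring
  refine (h1.union h2).mono_set fun s hs => ?_
  rcases le_total s Y with h | h
  · exact Or.inl (le_min h hs)
  · exact Or.inr ⟨h, hs⟩

theorem matOp_eq_sum (M : Matrix (Fin 2) (Fin 2) ℂ) :
    matOp M = ∑ i, ∑ j, M i j • matOp (Matrix.single i j 1) := by
  conv_lhs => rw [Matrix.matrix_eq_sum_single M]
  simp only [map_sum, ← map_smul, Matrix.smul_single, smul_eq_mul, mul_one]

theorem integrable_sum_sum_smul {ι κ α F : Type*} [Fintype ι] [Fintype κ] [MeasurableSpace α]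
    [NormedAddCommGroup F] [NormedSpace ℂ F] {m : Measure α} {f : ι → κ → α → ℂ}
    (hf : ∀ i j, Integrable (f i j) m) (T : ι → κ → F) :
    Integrable (fun s => ∑ i, ∑ j, f i j s • T i j) m :=
  integrable_finsetSum _ fun i _ => integrable_finsetSum _ fun j _ => (hf i j).smul_const (T i j)

theorem real_smul_eq_complex_smul {E : Type*} [NormedAddCommGroup E] [NormedSpace ℂ E]
    (w : ℝ) (T : E →L[ℂ] E) : w • T = (w : ℂ) • T := by
  ext1 v; simp

theorem weightIntegrable_matOp {ν : ℝ} {N : ℝ → Matrix (Fin 2) (Fin 2) ℂ}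
    (h : ∀ i j X, IntegrableOn (fun s => (weight ν s : ℂ) * N s i j) (Set.Iic X)) :
    WeightIntegrable ν fun s => matOp (N s) := by
  intro X
  have e : (fun s => weight ν s • matOp (N s)) = fun s => ∑ i, ∑ j,
      ((weight ν s : ℂ) * N s i j) • matOp (Matrix.single i j 1) := by
    funext s
    refine (real_smul_eq_complex_smul _ _).trans ?_
    rw [matOp_eq_sum (N s), Finset.smul_sum]
    refine Finset.sum_congr rfl fun i _ => ?_
    rw [Finset.smul_sum]
    refine Finset.sum_congr rfl fun j _ => ?_
    rw [smul_smul]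
  rw [e]
  exact integrable_sum_sum_smul (fun i j => h i j X) _

variable {D : Potential} {t : ℝ}

/-- The weight matters only at -∞. On the right half line Q - Q₋ differs from the integrable Q - Q₊
by the constant Q₊ - Q₋, so it is locally integrable. -/
theorem Potential.DecayL11.weightIntegrable_left_of (hL : D.DecayL11 t) {ν : ℝ}
    (h : ∀ i j, IntegrableOn (fun s => (weight ν s : ℂ) * (D.Q t s - D.Qm t) i j) (Set.Iic 0)) :
    WeightIntegrable ν (pertOp D t (D.Qm t)) := by
  refine weightIntegrable_matOp fun i j X =>
    integrableOn_Iic_weight_mul (d := (D.Qm t - D.Qp t) i j) (h i j) ?_ X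
  refine (hL i j).2.integrableOn.congr (Eventually.of_forall fun s => ?_)
  simp

theorem Potential.DecayL11.weightIntegrable_right_of (hL : D.DecayL11 t) {ν : ℝ}
    (h : ∀ i j, IntegrableOn (fun s => (weight ν s : ℂ) * (D.Q t (-s) - D.Qp t) i j)
      (Set.Iic 0)) :
    WeightIntegrable ν fun s => -pertOp D t (D.Qp t) (-s) := by
  have e : (fun s => -pertOp D t (D.Qp t) (-s)) = fun s => matOp (-(D.Q t (-s) - D.Qp t)) := by
    funext s; rw [map_neg]; rfl
  rw [e]
  refine weightIntegrable_matOp fun i j X =>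
    integrableOn_Iic_weight_mul (d := (D.Qm t - D.Qp t) i j) ?_ ?_ X
  · refine (h i j).neg.congr (Eventually.of_forall fun s => ?_)
    simp only [Pi.neg_apply, Matrix.neg_apply]
    ring
  · have h1 := (hL i j).1.integrableOn
    have h2 := ((Measure.measurePreserving_neg (volume : Measure ℝ)).integrableOn_comp_preimage
      (Homeomorph.neg ℝ).measurableEmbedding).2 h1
    have e : (fun x : ℝ => -x) ⁻¹' Set.Iic 0 = Set.Ici 0 := by ext; simp
    rw [← e]
    refine h2.neg.congr (Eventually.of_forall fun s => ?_)
    simp only [Pi.neg_apply, Function.comp_apply, Matrix.neg_apply, Matrix.sub_apply]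
    ring

theorem Potential.DecayL11.weightIntegrable_left (hL : D.DecayL11 t) :
    WeightIntegrable 0 (pertOp D t (D.Qm t)) :=
  hL.weightIntegrable_left_of fun i j => (hL i j).1.weight_zero

theorem Potential.DecayL11.weightIntegrable_right (hL : D.DecayL11 t) :
    WeightIntegrable 0 fun s => -pertOp D t (D.Qp t) (-s) :=
  hL.weightIntegrable_right_of fun i j => (hL i j).2.comp_neg.weight_zero

theorem Potential.DecayGaussian.weightIntegrable_left (hL : D.DecayL11 t) (hG : D.DecayGaussian t)
    {ν : ℝ} (hν : 0 ≤ ν) : WeightIntegrable ν (pertOp D t (D.Qm t)) := by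
  obtain ⟨a, ha, hO⟩ := hG
  exact hL.weightIntegrable_left_of fun i j =>
    integrableOn_weight_of_gaussian ha (hL i j).1.integrableOn (hO i j).1 hν

theorem Potential.DecayGaussian.weightIntegrable_right (hL : D.DecayL11 t)
    (hG : D.DecayGaussian t) {ν : ℝ} (hν : 0 ≤ ν) :
    WeightIntegrable ν fun s => -pertOp D t (D.Qp t) (-s) := by
  obtain ⟨a, ha, hO⟩ := hG
  refine hL.weightIntegrable_right_of fun i j =>
    integrableOn_weight_of_gaussian (f := fun s => (D.Q t (-s) - D.Qp t) i j) ha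
      (hL i j).2.comp_neg.integrableOn ?_ hν
  have := (hO i j).2.comp_tendsto tendsto_neg_atBot_atTop
  simpa [Function.comp_def] using this

/-! ### Wronskians -/

/-- The Wronskian as a real bilinear map. -/
def wronskianBilin : (Fin 2 → ℂ) →L[ℝ] (Fin 2 → ℂ) →L[ℝ] ℂ :=
  (ContinuousLinearMap.mul ℝ ℂ).bilinearComp (ContinuousLinearMap.proj 0)
      (ContinuousLinearMap.proj 1) -
    (ContinuousLinearMap.mul ℝ ℂ).bilinearComp (ContinuousLinearMap.proj 1)
      (ContinuousLinearMap.proj 0)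

theorem wronskianBilin_apply (u v : Fin 2 → ℂ) : wronskianBilin u v = wronskian u v := rfl

/-- The left side is the trace of ikJ + Q times W(u, v), and that trace is zero. -/
theorem wronskian_mulVec_add (k : ℂ) (D : Potential) (t s : ℝ) (u v : Fin 2 → ℂ) :
    wronskian (((Complex.I * k) • J + D.Q t s) *ᵥ u) v +
      wronskian u (((Complex.I * k) • J + D.Q t s) *ᵥ v) = 0 := by
  simp [wronskian, J, Potential.Q, Matrix.mulVec, dotProduct, Fin.sum_univ_two]
  ring

variable {D : Potential} {t : ℝ} {p : Surface D.q₀}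

theorem SolvesScattering.intervalIntegrable (hL : D.DecayL11 t) {u : ℝ → Fin 2 → ℂ}
    (hu : SolvesScattering D t p u) (x y : ℝ) :
    IntervalIntegrable (fun s => ((Complex.I * p.k) • J + D.Q t s) *ᵥ u s) volume x y := by
  have h1 : IntervalIntegrable (fun s => matOp ((Complex.I * p.k) • J + D.Qm t) (u s))
      volume x y := by
    have := hu.1
    exact Continuous.intervalIntegrable (by fun_prop) _ _
  have h2 := intervalIntegrable_bilin ((ContinuousLinearMap.id ℂ
    ((Fin 2 → ℂ) →L[ℂ] (Fin 2 → ℂ))).bilinearRestrictScalars ℝ)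
    (hL.weightIntegrable_left.intervalIntegrable le_rfl x y) hu.1
  refine (h1.add h2).congr_ae (Eventually.of_forall fun s => ?_)
  have : D.Q t s = D.Qm t + (D.Q t s - D.Qm t) := by abel
  change ((Complex.I * p.k) • J + D.Qm t) *ᵥ u s + (D.Q t s - D.Qm t) *ᵥ u s = _
  rw [← Matrix.add_mulVec, add_assoc, ← this]

theorem SolvesScattering.wronskian_eq (hL : D.DecayL11 t) {u v : ℝ → Fin 2 → ℂ}
    (hu : SolvesScattering D t p u) (hv : SolvesScattering D t p v) (x y : ℝ) :
    wronskian (u y) (v y) = wronskian (u x) (v x) := by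
  have := bilin_sub_bilin_eq_integral wronskianBilin (hu.intervalIntegrable hL)
    (hv.intervalIntegrable hL) hu.2 hv.2 x y
  simp only [wronskianBilin_apply, wronskian_mulVec_add, intervalIntegral.integral_zero] at this
  exact sub_eq_zero.1 this

/-- The time phases cancel between t and -t, and the constant phases add up to π. The resulting
minus sign is what produces λ² = k² + q₀². -/
theorem qp_mul_qm (hθ : D.θp + D.θm = Real.pi) (t : ℝ) :
    D.qp t * D.qm (-t) = -(D.q₀ : ℂ) ^ 2 := by
  have h : Complex.exp (Complex.I * ((D.α * t + D.θp : ℝ) : ℂ)) *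
      Complex.exp (Complex.I * ((D.α * -t + D.θm : ℝ) : ℂ)) = -1 := by
    rw [← Complex.exp_add, ← mul_add, ← Complex.ofReal_add]
    have : D.α * t + D.θp + (D.α * -t + D.θm) = Real.pi := by rw [← hθ]; ring
    rw [this, mul_comm, Complex.exp_pi_mul_I]
  rw [Potential.qp, Potential.qm]
  linear_combination (D.q₀ : ℂ) ^ 2 * h

theorem qm_mul_qp (hθ : D.θp + D.θm = Real.pi) (t : ℝ) :
    D.qm t * D.qp (-t) = -(D.q₀ : ℂ) ^ 2 := by
  have := qp_mul_qm hθ (-t)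
  rwa [neg_neg, mul_comm] at this

/-- The exponentials cancel in the Wronskian, which is constant, so it equals the Wronskian of the
two asymptotic vectors: -q₀² - (λ + k)² = -2λ(λ + k). -/
theorem wronskian_psi_psiBar (hL : D.DecayL11 t) (hθ : D.θp + D.θm = Real.pi)
    {u v : ℝ → Fin 2 → ℂ} (hu : IsPsi D t p u) (hv : IsPsiBar D t p v) (x : ℝ) :
    wronskian (u x) (v x) = -(2 * p.lam * (p.lam + p.k)) := by
  have hlim : Tendsto (fun y : ℝ => wronskian (Complex.exp (-(Complex.I * p.lam * y)) • u y)
      (Complex.exp (Complex.I * p.lam * y) • v y)) atTop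
      (𝓝 (wronskian ![-(Complex.I * D.qp t), p.lam + p.k]
        ![p.lam + p.k, Complex.I * D.qm (-t)])) := by
    have h1 := tendsto_pi_nhds.1 hu.2.1
    have h2 := tendsto_pi_nhds.1 hv.2.1
    exact ((h1 0).mul (h2 1)).sub ((h1 1).mul (h2 0))
  have hc : ∀ y : ℝ, wronskian (Complex.exp (-(Complex.I * p.lam * y)) • u y)
      (Complex.exp (Complex.I * p.lam * y) • v y) = wronskian (u x) (v x) := fun y => by
    rw [← hu.1.wronskian_eq hL hv.1 x y]
    have e : Complex.exp (-(Complex.I * p.lam * y)) * Complex.exp (Complex.I * p.lam * y) = 1 := by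
      rw [← Complex.exp_add, neg_add_cancel, Complex.exp_zero]
    simp only [wronskian, Pi.smul_apply, smul_eq_mul]
    linear_combination (u y 0 * v y 1 - u y 1 * v y 0) * e
  simp only [hc] at hlim
  rw [tendsto_nhds_unique tendsto_const_nhds hlim]
  simp only [wronskian, Matrix.cons_val_zero, Matrix.cons_val_one]
  have h1 := qp_mul_qm hθ t
  have h2 := p.lam_sq
  linear_combination h1 + h2 - D.qp t * D.qm (-t) * Complex.I_sq

/-- Cramer's rule. -/
theorem eq_of_wronskian (w a b : Fin 2 → ℂ) (n : ℂ) (h : wronskian a b = -n) (hn : n ≠ 0) :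
    w = (-(wronskian w b / n)) • a + (wronskian w a / n) • b := by
  have e : ∀ i, n * w i = -(wronskian w b) * a i + wronskian w a * b i := by
    intro i
    have hn' : n = -wronskian a b := by rw [h, neg_neg]
    rw [hn']
    fin_cases i <;> simp [wronskian] <;> ring
  funext i
  simp only [Pi.add_apply, Pi.smul_apply, smul_eq_mul]
  field_simp
  linear_combination e i

/-! ### Values of the eigenfunctions at the origin as functions of the uniformising variable -/

/-- J anticommutes with off-diagonal matrices, so the mixed terms vanish and the square is the
scalar -k² + uv. -/
theorem bg_sq {q₀ : ℝ} {k lam u v : ℂ} (h : lam ^ 2 = k ^ 2 + (q₀ : ℂ) ^ 2)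
    (huv : u * v = -(q₀ : ℂ) ^ 2) :
    ((Complex.I * k) • J + !![0, u; v, 0]) * ((Complex.I * k) • J + !![0, u; v, 0]) =
      (-lam ^ 2) • 1 := by
  have hI := Complex.I_sq
  ext i j
  fin_cases i <;> fin_cases j <;> simp [J, Matrix.mul_apply, Fin.sum_univ_two]
  · linear_combination huv + h + k ^ 2 * hI
  · ring
  · ring
  · linear_combination huv + h + k ^ 2 * hI

theorem bg_mulVec_minus {q₀ : ℝ} {k lam u v : ℂ} (h : lam ^ 2 = k ^ 2 + (q₀ : ℂ) ^ 2)
    (huv : u * v = -(q₀ : ℂ) ^ 2) :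
    ((Complex.I * k) • J + !![0, u; v, 0]) *ᵥ ![lam + k, Complex.I * v] =
      -((Complex.I * lam) • ![lam + k, Complex.I * v]) := by
  have hI := Complex.I_sq
  ext i
  fin_cases i <;> simp [J, Matrix.mulVec, dotProduct, Fin.sum_univ_two]
  · linear_combination Complex.I * (huv + h)
  · linear_combination (k + lam) * v * hI

theorem bg_mulVec_plus {q₀ : ℝ} {k lam u v : ℂ} (h : lam ^ 2 = k ^ 2 + (q₀ : ℂ) ^ 2)
    (huv : u * v = -(q₀ : ℂ) ^ 2) :
    ((Complex.I * k) • J + !![0, u; v, 0]) *ᵥ ![-(Complex.I * u), lam + k] =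
      (Complex.I * lam) • ![-(Complex.I * u), lam + k] := by
  have hI := Complex.I_sq
  ext i
  fin_cases i <;> simp [J, Matrix.mulVec, dotProduct, Fin.sum_univ_two]
  · linear_combination (k + lam) * u * hI
  · linear_combination -Complex.I * (huv + h)

/-- `ikJ + Q₋` as an operator. -/
def bgM (D : Potential) (t : ℝ) (k : ℂ) : (Fin 2 → ℂ) →L[ℂ] (Fin 2 → ℂ) :=
  matOp ((Complex.I * k) • J + D.Qm t)

/-- `-(ikJ + Q₊)` as an operator. -/
def bgP (D : Potential) (t : ℝ) (k : ℂ) : (Fin 2 → ℂ) →L[ℂ] (Fin 2 → ℂ) :=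
  matOp (-((Complex.I * k) • J + D.Qp t))

/-- `φ` as a function of `k` and `λ`. -/
def jostPhi (D : Potential) (t : ℝ) (k lam : ℂ) : ℝ → Fin 2 → ℂ :=
  jost (gen (bgM D t k) lam) lam (pertOp D t (D.Qm t)) ![lam + k, Complex.I * D.qp (-t)]

/-- `φ̄` as a function of `k` and `λ`. -/
def jostPhiBar (D : Potential) (t : ℝ) (k lam : ℂ) : ℝ → Fin 2 → ℂ :=
  jost (gen (bgM D t k) (-lam)) (-lam) (pertOp D t (D.Qm t)) ![-(Complex.I * D.qm t), lam + k]

/-- The reflection of `ψ` as a function of `k` and `λ`. -/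
def jostPsi (D : Potential) (t : ℝ) (k lam : ℂ) : ℝ → Fin 2 → ℂ :=
  jost (gen (bgP D t k) lam) lam (fun s => -pertOp D t (D.Qp t) (-s))
    ![-(Complex.I * D.qp t), lam + k]

/-- The reflection of `ψ̄` as a function of `k` and `λ`. -/
def jostPsiBar (D : Potential) (t : ℝ) (k lam : ℂ) : ℝ → Fin 2 → ℂ :=
  jost (gen (bgP D t k) (-lam)) (-lam) (fun s => -pertOp D t (D.Qp t) (-s))
    ![lam + k, Complex.I * D.qm (-t)]

variable {D : Potential} {t ν : ℝ} {k lam : ℂ}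

theorem bgM_mul_bgM (hθ : D.θp + D.θm = Real.pi) (h : lam ^ 2 = k ^ 2 + (D.q₀ : ℂ) ^ 2) :
    bgM D t k * bgM D t k = (-lam ^ 2) • 1 := by
  rw [bgM, ← matOp_mul, Potential.Qm, bg_sq h (qm_mul_qp hθ t), map_smul, matOp_one]

theorem bgP_mul_bgP (hθ : D.θp + D.θm = Real.pi) (h : lam ^ 2 = k ^ 2 + (D.q₀ : ℂ) ^ 2) :
    bgP D t k * bgP D t k = (-lam ^ 2) • 1 := by
  rw [bgP, ← matOp_mul, neg_mul_neg, Potential.Qp, bg_sq h (qp_mul_qm hθ t), map_smul, matOp_one]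

theorem volterraData_phi (hθ : D.θp + D.θm = Real.pi) (h : lam ^ 2 = k ^ 2 + (D.q₀ : ℂ) ^ 2)
    (hB : WeightIntegrable ν (pertOp D t (D.Qm t))) (hν : 0 ≤ ν) (him : -ν ≤ lam.im) :
    VolterraData ν (gen (bgM D t k) lam) lam (pertOp D t (D.Qm t))
      ![lam + k, Complex.I * D.qp (-t)] where
  nonneg := hν
  le_im := him
  sq := gen_mul_gen (bgM_mul_bgM hθ h)
  ker := by
    rw [gen_apply, bgM, matOp_apply, Potential.Qm, bg_mulVec_minus h (qm_mul_qp hθ t),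
      neg_add_cancel]
  int := hB

theorem volterraData_phiBar (hθ : D.θp + D.θm = Real.pi) (h : lam ^ 2 = k ^ 2 + (D.q₀ : ℂ) ^ 2)
    (hB : WeightIntegrable ν (pertOp D t (D.Qm t))) (hν : 0 ≤ ν) (him : lam.im ≤ ν) :
    VolterraData ν (gen (bgM D t k) (-lam)) (-lam) (pertOp D t (D.Qm t))
      ![-(Complex.I * D.qm t), lam + k] where
  nonneg := hν
  le_im := by rw [Complex.neg_im]; linarith
  sq := gen_mul_gen (by rw [neg_sq]; exact bgM_mul_bgM hθ h)
  ker := by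
    rw [gen_apply, bgM, matOp_apply, Potential.Qm, bg_mulVec_plus h (qm_mul_qp hθ t), mul_neg,
      neg_smul, add_neg_cancel]
  int := hB

theorem volterraData_psi (hθ : D.θp + D.θm = Real.pi) (h : lam ^ 2 = k ^ 2 + (D.q₀ : ℂ) ^ 2)
    (hB : WeightIntegrable ν fun s => -pertOp D t (D.Qp t) (-s)) (hν : 0 ≤ ν)
    (him : -ν ≤ lam.im) :
    VolterraData ν (gen (bgP D t k) lam) lam (fun s => -pertOp D t (D.Qp t) (-s))
      ![-(Complex.I * D.qp t), lam + k] where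
  nonneg := hν
  le_im := him
  sq := gen_mul_gen (bgP_mul_bgP hθ h)
  ker := by
    rw [gen_apply, bgP, matOp_apply, Matrix.neg_mulVec, Potential.Qp,
      bg_mulVec_plus h (qp_mul_qm hθ t), neg_add_cancel]
  int := hB

theorem volterraData_psiBar (hθ : D.θp + D.θm = Real.pi) (h : lam ^ 2 = k ^ 2 + (D.q₀ : ℂ) ^ 2)
    (hB : WeightIntegrable ν fun s => -pertOp D t (D.Qp t) (-s)) (hν : 0 ≤ ν) (him : lam.im ≤ ν) :
    VolterraData ν (gen (bgP D t k) (-lam)) (-lam) (fun s => -pertOp D t (D.Qp t) (-s))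
      ![lam + k, Complex.I * D.qm (-t)] where
  nonneg := hν
  le_im := by rw [Complex.neg_im]; linarith
  sq := gen_mul_gen (by rw [neg_sq]; exact bgP_mul_bgP hθ h)
  ker := by
    rw [gen_apply, bgP, matOp_apply, Matrix.neg_mulVec, Potential.Qp,
      bg_mulVec_minus h (qp_mul_qm hθ t), neg_neg, mul_neg, neg_smul, add_neg_cancel]
  int := hB

/-! ### Existence and uniqueness of the eigenfunctions -/

section Existence

variable {p : Surface D.q₀}

/-- Besides unique existence, this identifies the chosen `phi` with the explicit Picard solution,
through which its dependence on the parameter is studied. -/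
theorem existsUnique_isPhi (hp : p ∉ branchPoints D.q₀) (hθ : D.θp + D.θm = Real.pi)
    (hB : WeightIntegrable ν (pertOp D t (D.Qm t))) (hν : 0 ≤ ν) (him : -ν ≤ p.lam.im) :
    (∃! u, IsPhi D t p u) ∧ IsPhi D t p (phi D t p) ∧ phi D t p = jostPhi D t p.k p.lam := by
  have hd := volterraData_phi (k := p.k) hθ p.lam_sq hB hν him
  have h1 : IsPhi D t p (jostPhi D t p.k p.lam) :=
    (isPhi_iff (Surface.lam_ne_zero hp)).2 hd.isJost_jost
  have h2 : ∀ u, IsPhi D t p u → u = jostPhi D t p.k p.lam := fun u hu =>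
    hd.eq_jost ((isPhi_iff (Surface.lam_ne_zero hp)).1 hu)
  have h3 : IsPhi D t p (phi D t p) := Classical.epsilon_spec ⟨_, h1⟩
  exact ⟨⟨_, h1, h2⟩, h3, h2 _ h3⟩

theorem existsUnique_isPhiBar (hp : p ∉ branchPoints D.q₀) (hθ : D.θp + D.θm = Real.pi)
    (hB : WeightIntegrable ν (pertOp D t (D.Qm t))) (hν : 0 ≤ ν) (him : p.lam.im ≤ ν) :
    (∃! u, IsPhiBar D t p u) ∧ IsPhiBar D t p (phiBar D t p) ∧
      phiBar D t p = jostPhiBar D t p.k p.lam := by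
  have hd := volterraData_phiBar (k := p.k) hθ p.lam_sq hB hν him
  have h1 : IsPhiBar D t p (jostPhiBar D t p.k p.lam) :=
    (isPhiBar_iff (Surface.lam_ne_zero hp)).2 hd.isJost_jost
  have h2 : ∀ u, IsPhiBar D t p u → u = jostPhiBar D t p.k p.lam := fun u hu =>
    hd.eq_jost ((isPhiBar_iff (Surface.lam_ne_zero hp)).1 hu)
  have h3 : IsPhiBar D t p (phiBar D t p) := Classical.epsilon_spec ⟨_, h1⟩
  exact ⟨⟨_, h1, h2⟩, h3, h2 _ h3⟩

theorem existsUnique_isPsi (hp : p ∉ branchPoints D.q₀) (hθ : D.θp + D.θm = Real.pi)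
    (hB : WeightIntegrable ν fun s => -pertOp D t (D.Qp t) (-s)) (hν : 0 ≤ ν)
    (him : -ν ≤ p.lam.im) :
    (∃! u, IsPsi D t p u) ∧ IsPsi D t p (psi D t p) ∧
      psi D t p = fun x => jostPsi D t p.k p.lam (-x) := by
  have hd := volterraData_psi (k := p.k) hθ p.lam_sq hB hν him
  have h1 : IsPsi D t p (fun x => jostPsi D t p.k p.lam (-x)) := by
    rw [isPsi_iff (Surface.lam_ne_zero hp)]
    simp only [neg_neg]
    exact hd.isJost_jost
  have h2 : ∀ u, IsPsi D t p u → u = fun x => jostPsi D t p.k p.lam (-x) := fun u hu => by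
    have := hd.eq_jost ((isPsi_iff (Surface.lam_ne_zero hp)).1 hu)
    funext x
    rw [← neg_neg x]
    exact (congrFun this (-x)).trans (by rw [neg_neg]; rfl)
  have h3 : IsPsi D t p (psi D t p) := Classical.epsilon_spec ⟨_, h1⟩
  exact ⟨⟨_, h1, h2⟩, h3, h2 _ h3⟩

theorem existsUnique_isPsiBar (hp : p ∉ branchPoints D.q₀) (hθ : D.θp + D.θm = Real.pi)
    (hB : WeightIntegrable ν fun s => -pertOp D t (D.Qp t) (-s)) (hν : 0 ≤ ν)
    (him : p.lam.im ≤ ν) :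
    (∃! u, IsPsiBar D t p u) ∧ IsPsiBar D t p (psiBar D t p) ∧
      psiBar D t p = fun x => jostPsiBar D t p.k p.lam (-x) := by
  have hd := volterraData_psiBar (k := p.k) hθ p.lam_sq hB hν him
  have h1 : IsPsiBar D t p (fun x => jostPsiBar D t p.k p.lam (-x)) := by
    rw [isPsiBar_iff (Surface.lam_ne_zero hp)]
    simp only [neg_neg]
    exact hd.isJost_jost
  have h2 : ∀ u, IsPsiBar D t p u → u = fun x => jostPsiBar D t p.k p.lam (-x) := fun u hu => by
    have := hd.eq_jost ((isPsiBar_iff (Surface.lam_ne_zero hp)).1 hu)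
    funext x
    rw [← neg_neg x]
    exact (congrFun this (-x)).trans (by rw [neg_neg]; rfl)
  have h3 : IsPsiBar D t p (psiBar D t p) := Classical.epsilon_spec ⟨_, h1⟩
  exact ⟨⟨_, h1, h2⟩, h3, h2 _ h3⟩

theorem Surface.two_lam_mul_ne_zero (hq₀ : 0 < D.q₀) (hp : p ∉ branchPoints D.q₀) :
    2 * p.lam * (p.lam + p.k) ≠ 0 :=
  mul_ne_zero (mul_ne_zero two_ne_zero (Surface.lam_ne_zero hp)) (p.unif_ne_zero hq₀)

/-- The coefficients are defined by Wronskians at 0; constancy moves these to x, where Cramer's rule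
applies because W(ψ, ψ̄) ≠ 0. -/
theorem scatteringRelations_of_isJost (hL : D.DecayL11 t) (hq₀ : 0 < D.q₀)
    (hθ : D.θp + D.θm = Real.pi) (hp : p ∉ branchPoints D.q₀) (h1 : IsPhi D t p (phi D t p))
    (h2 : IsPhiBar D t p (phiBar D t p)) (h3 : IsPsi D t p (psi D t p))
    (h4 : IsPsiBar D t p (psiBar D t p)) : ScatteringRelations D t p := by
  have hn := Surface.two_lam_mul_ne_zero hq₀ hp
  intro x
  have hW := wronskian_psi_psiBar hL hθ h3 h4 x
  constructor
  · rw [scatB, scatA, ← h1.1.wronskian_eq hL h4.1 0 x, ← h1.1.wronskian_eq hL h3.1 0 x]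
    exact eq_of_wronskian _ _ _ _ hW hn
  · rw [scatABar, scatBBar, ← h2.1.wronskian_eq hL h4.1 0 x, ← h2.1.wronskian_eq hL h3.1 0 x]
    exact eq_of_wronskian _ _ _ _ hW hn

end Existence

/-! ### Dependence on the uniformising variable -/

section Analytic

variable {q₀ : ℝ}

theorem bgM_eq (D : Potential) (t : ℝ) (k : ℂ) :
    bgM D t k = (Complex.I * k) • matOp J + matOp (D.Qm t) := by
  rw [bgM, map_add, map_smul]

theorem bgP_eq (D : Potential) (t : ℝ) (k : ℂ) :
    bgP D t k = -((Complex.I * k) • matOp J + matOp (D.Qp t)) := by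
  rw [bgP, map_neg, map_add, map_smul]

theorem differentiableOn_gen {f : ℂ → (Fin 2 → ℂ) →L[ℂ] (Fin 2 → ℂ)} {μ : ℂ → ℂ} {Z : Set ℂ}
    (hf : DifferentiableOn ℂ f Z) (hμ : DifferentiableOn ℂ μ Z) :
    DifferentiableOn ℂ (fun z => gen (f z) (μ z)) Z :=
  hf.add ((hμ.const_mul _).smul_const _)

theorem differentiableOn_bgM (D : Potential) (t : ℝ) :
    DifferentiableOn ℂ (fun z => bgM D t (kOf D.q₀ z)) {0}ᶜ := by
  simp only [bgM_eq]
  exact ((differentiableOn_kOf.const_mul _).smul_const _).add_const _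

theorem differentiableOn_bgP (D : Potential) (t : ℝ) :
    DifferentiableOn ℂ (fun z => bgP D t (kOf D.q₀ z)) {0}ᶜ := by
  simp only [bgP_eq]
  exact (((differentiableOn_kOf.const_mul _).smul_const _).add_const _).neg

theorem differentiableOn_vec {f g : ℂ → ℂ} {Z : Set ℂ} (hf : DifferentiableOn ℂ f Z)
    (hg : DifferentiableOn ℂ g Z) : DifferentiableOn ℂ (fun z => ![f z, g z]) Z := by
  rw [differentiableOn_pi]
  intro i
  fin_cases i
  · exact hf
  · exact hg

theorem differentiableOn_lamOf_add_kOf :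
    DifferentiableOn ℂ (fun z => lamOf q₀ z + kOf q₀ z) {0}ᶜ := by
  simp only [lamOf_add_kOf]
  exact differentiableOn_id

/-- The parameters with `-ν ≤ Im λ`. -/
def upperSet (q₀ ν : ℝ) : Set ℂ := {z | z ≠ 0 ∧ -ν ≤ (lamOf q₀ z).im}

/-- The parameters with `Im λ ≤ ν`. -/
def lowerSet (q₀ ν : ℝ) : Set ℂ := {z | z ≠ 0 ∧ (lamOf q₀ z).im ≤ ν}

/-- The value at the origin of a family of solutions is continuous on `Z`, and holomorphic on
open subsets of `Z`. -/
def RegularOn (f : ℂ → Fin 2 → ℂ) (Z : Set ℂ) : Prop :=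
  ContinuousOn f Z ∧ ∀ U ⊆ Z, IsOpen U → DifferentiableOn ℂ f U

theorem regularOn_jost_zero {L : ℂ → (Fin 2 → ℂ) →L[ℂ] (Fin 2 → ℂ)} {μ : ℂ → ℂ}
    {B : ℝ → (Fin 2 → ℂ) →L[ℂ] (Fin 2 → ℂ)} {c : ℂ → Fin 2 → ℂ} {Z : Set ℂ}
    (h : ∀ z ∈ Z, VolterraData ν (L z) (μ z) B (c z)) (hZ : Z ⊆ {0}ᶜ)
    (hL : DifferentiableOn ℂ L {0}ᶜ) (hμ : DifferentiableOn ℂ μ {0}ᶜ)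
    (hc : DifferentiableOn ℂ c {0}ᶜ) :
    RegularOn (fun z => jost (L z) (μ z) B (c z) 0) Z :=
  ⟨continuousOn_jost_zero h (hL.continuousOn.mono hZ) (hμ.continuousOn.mono hZ)
    (hc.continuousOn.mono hZ), fun _ hU hUo => differentiableOn_jost_zero
      (fun z hz => h z (hU hz)) hUo (hL.mono (hU.trans hZ)) (hμ.mono (hU.trans hZ))
      (hc.mono (hU.trans hZ))⟩

theorem regularOn_phi (hθ : D.θp + D.θm = Real.pi)
    (hB : WeightIntegrable ν (pertOp D t (D.Qm t))) (hν : 0 ≤ ν) :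
    RegularOn (fun z => jostPhi D t (kOf D.q₀ z) (lamOf D.q₀ z) 0) (upperSet D.q₀ ν) :=
  regularOn_jost_zero (fun _ hz => volterraData_phi hθ (lamOf_sq hz.1) hB hν hz.2)
    (fun _ hz => hz.1) (differentiableOn_gen (differentiableOn_bgM D t) differentiableOn_lamOf)
    differentiableOn_lamOf
    (differentiableOn_vec differentiableOn_lamOf_add_kOf (differentiableOn_const _))

theorem regularOn_phiBar (hθ : D.θp + D.θm = Real.pi)
    (hB : WeightIntegrable ν (pertOp D t (D.Qm t))) (hν : 0 ≤ ν) :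
    RegularOn (fun z => jostPhiBar D t (kOf D.q₀ z) (lamOf D.q₀ z) 0) (lowerSet D.q₀ ν) :=
  regularOn_jost_zero (fun _ hz => volterraData_phiBar hθ (lamOf_sq hz.1) hB hν hz.2)
    (fun _ hz => hz.1) (differentiableOn_gen (differentiableOn_bgM D t) differentiableOn_lamOf.neg)
    differentiableOn_lamOf.neg
    (differentiableOn_vec (differentiableOn_const _) differentiableOn_lamOf_add_kOf)

theorem regularOn_psi (hθ : D.θp + D.θm = Real.pi)
    (hB : WeightIntegrable ν fun s => -pertOp D t (D.Qp t) (-s)) (hν : 0 ≤ ν) :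
    RegularOn (fun z => jostPsi D t (kOf D.q₀ z) (lamOf D.q₀ z) 0) (upperSet D.q₀ ν) :=
  regularOn_jost_zero (fun _ hz => volterraData_psi hθ (lamOf_sq hz.1) hB hν hz.2)
    (fun _ hz => hz.1) (differentiableOn_gen (differentiableOn_bgP D t) differentiableOn_lamOf)
    differentiableOn_lamOf
    (differentiableOn_vec (differentiableOn_const _) differentiableOn_lamOf_add_kOf)

theorem regularOn_psiBar (hθ : D.θp + D.θm = Real.pi)
    (hB : WeightIntegrable ν fun s => -pertOp D t (D.Qp t) (-s)) (hν : 0 ≤ ν) :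
    RegularOn (fun z => jostPsiBar D t (kOf D.q₀ z) (lamOf D.q₀ z) 0) (lowerSet D.q₀ ν) :=
  regularOn_jost_zero (fun _ hz => volterraData_psiBar hθ (lamOf_sq hz.1) hB hν hz.2)
    (fun _ hz => hz.1) (differentiableOn_gen (differentiableOn_bgP D t) differentiableOn_lamOf.neg)
    differentiableOn_lamOf.neg
    (differentiableOn_vec differentiableOn_lamOf_add_kOf (differentiableOn_const _))

theorem RegularOn.mono {f : ℂ → Fin 2 → ℂ} {Z Y : Set ℂ} (h : RegularOn f Z) (hY : Y ⊆ Z) :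
    RegularOn f Y :=
  ⟨h.1.mono hY, fun U hU => h.2 U (hU.trans hY)⟩

theorem RegularOn.continuousOn_wronskian {f g : ℂ → Fin 2 → ℂ} {Z : Set ℂ} (hf : RegularOn f Z)
    (hg : RegularOn g Z) : ContinuousOn (fun z => wronskian (f z) (g z)) Z := by
  have h1 := continuousOn_pi.1 hf.1
  have h2 := continuousOn_pi.1 hg.1
  exact ((h1 0).mul (h2 1)).sub ((h1 1).mul (h2 0))

theorem RegularOn.differentiableOn_wronskian {f g : ℂ → Fin 2 → ℂ} {Z U : Set ℂ}
    (hf : RegularOn f Z) (hg : RegularOn g Z) (hU : U ⊆ Z) (hUo : IsOpen U) :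
    DifferentiableOn ℂ (fun z => wronskian (f z) (g z)) U := by
  have h1 := differentiableOn_pi.1 (hf.2 U hU hUo)
  have h2 := differentiableOn_pi.1 (hg.2 U hU hUo)
  exact ((h1 0).mul (h2 1)).sub ((h1 1).mul (h2 0))

theorem isOpen_strictUpper (q₀ ν : ℝ) : IsOpen {z : ℂ | z ≠ 0 ∧ -ν < (lamOf q₀ z).im} :=
  (Complex.continuous_im.comp_continuousOn (differentiableOn_lamOf
    (q₀ := q₀)).continuousOn).isOpen_inter_preimage isOpen_compl_singleton isOpen_Ioi

theorem isOpen_strictLower (q₀ ν : ℝ) : IsOpen {z : ℂ | z ≠ 0 ∧ (lamOf q₀ z).im < ν} :=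
  (Complex.continuous_im.comp_continuousOn (differentiableOn_lamOf
    (q₀ := q₀)).continuousOn).isOpen_inter_preimage isOpen_compl_singleton isOpen_Iio

/-- A Wronskian of regular families divided by `2λ(λ + k)` is continuous on the surface. -/
theorem continuousOn_scat (hq : 0 < q₀) {f g : ℂ → Fin 2 → ℂ} {Z : Set ℂ} (hf : RegularOn f Z)
    (hg : RegularOn g Z) {F : Surface q₀ → ℂ} {V : Set (Surface q₀)} (hV : ∀ p ∈ V, p.unif ∈ Z)
    (hb : ∀ p ∈ V, p ∉ branchPoints q₀)
    (hF : ∀ p ∈ V, F p = wronskian (f p.unif) (g p.unif) / (2 * p.lam * (p.lam + p.k))) :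
    ContinuousOn F V := by
  have h1 : ContinuousOn (fun p : Surface q₀ => wronskian (f p.unif) (g p.unif)) V :=
    (hf.continuousOn_wronskian hg).comp Surface.continuous_unif.continuousOn hV
  have h2 : Continuous fun p : Surface q₀ => 2 * p.lam * (p.lam + p.k) :=
    (continuous_const.mul Surface.continuous_lam).mul Surface.continuous_unif
  refine (h1.div h2.continuousOn fun p hp => ?_).congr hF
  exact mul_ne_zero (mul_ne_zero two_ne_zero (Surface.lam_ne_zero (hb p hp)))
    (p.unif_ne_zero hq)

/-- A Wronskian of regular families divided by `2λ(λ + k)` is analytic on the surface. -/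
theorem analyticOnSurface_scat (hq : 0 < q₀) {f g : ℂ → Fin 2 → ℂ} {Z U : Set ℂ}
    (hf : RegularOn f Z) (hg : RegularOn g Z) (hUo : IsOpen U) (hUZ : U ⊆ Z)
    (hU0 : ∀ z ∈ U, z ≠ 0 ∧ lamOf q₀ z ≠ 0) {F : Surface q₀ → ℂ} {V : Set (Surface q₀)}
    (hV : ∀ p ∈ V, p.unif ∈ U) (s : ℂ)
    (hF : ∀ p : Surface q₀, p.unif ∈ U →
      F p = s * (wronskian (f p.unif) (g p.unif) / (2 * p.lam * (p.lam + p.k)))) :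
    AnalyticOnSurface F V := by
  refine analyticOnSurface_of_differentiableOn hUo
    (g := fun z => s * (wronskian (f z) (g z) / (2 * lamOf q₀ z * z))) ?_ hV fun p hp => ?_
  · have hU : U ⊆ {0}ᶜ := fun z hz => (hU0 z hz).1
    exact ((hf.differentiableOn_wronskian hg hUZ hUo).div
      (((differentiableOn_lamOf.mono hU).const_mul 2).mul differentiableOn_id)
      fun z hz => mul_ne_zero (mul_ne_zero two_ne_zero (hU0 z hz).2) (hU0 z hz).1).const_mul s
  · rw [hF p hp, p.lamOf_unif hq]; rfl

/-- A Wronskian of families that are regular for all bounded `Im λ`, divided by `λ + k`, is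
analytic on the whole surface. -/
theorem analyticOnSurface_wronskian_div (hq : 0 < q₀) {f g : ℂ → Fin 2 → ℂ}
    (hf : ∀ ν, 0 ≤ ν → RegularOn f (upperSet q₀ ν ∩ lowerSet q₀ ν))
    (hg : ∀ ν, 0 ≤ ν → RegularOn g (upperSet q₀ ν ∩ lowerSet q₀ ν)) (s : ℂ) :
    AnalyticOnSurface (fun p : Surface q₀ => s * (wronskian (f p.unif) (g p.unif) / (2 * p.unif)))
      Set.univ := by
  intro p _
  -- The extra 1 makes p an interior point of the region |Im λ| < ν.
  set ν := |p.lam.im| + 1 with hν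
  have hν0 : 0 ≤ ν := by positivity
  set U : Set ℂ := {z | z ≠ 0 ∧ -ν < (lamOf q₀ z).im} ∩ {z | z ≠ 0 ∧ (lamOf q₀ z).im < ν} with hU
  have hUo : IsOpen U := (isOpen_strictUpper q₀ ν).inter (isOpen_strictLower q₀ ν)
  have hUZ : U ⊆ upperSet q₀ ν ∩ lowerSet q₀ ν := fun z hz =>
    ⟨⟨hz.1.1, hz.1.2.le⟩, ⟨hz.2.1, hz.2.2.le⟩⟩
  have hpU : p.unif ∈ U := by
    have h0 := p.unif_ne_zero hq
    refine ⟨⟨h0, ?_⟩, ⟨h0, ?_⟩⟩ <;> rw [p.lamOf_unif hq]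
    · linarith [neg_abs_le p.lam.im]
    · linarith [le_abs_self p.lam.im]
  refine analyticOnSurface_of_differentiableOn (V := {p}) hUo
    (g := fun z => s * (wronskian (f z) (g z) / (2 * z))) ?_ ?_ (fun _ _ => rfl) p rfl
  · exact (((hf ν hν0).differentiableOn_wronskian (hg ν hν0) hUZ hUo).div
      (differentiableOn_id.const_mul 2) fun z hz => mul_ne_zero two_ne_zero hz.1.1).const_mul s
  · rintro _ rfl
    exact hpU

end Analytic

/-! ### The eigenfunctions at the origin in the variable λ + k -/

section Values

variable {D : Potential} {t ν : ℝ} {p : Surface D.q₀}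

theorem mem_upperSet_unif (hq : 0 < D.q₀) (h : -ν ≤ p.lam.im) : p.unif ∈ upperSet D.q₀ ν :=
  ⟨p.unif_ne_zero hq, by rwa [p.lamOf_unif hq]⟩

theorem mem_lowerSet_unif (hq : 0 < D.q₀) (h : p.lam.im ≤ ν) : p.unif ∈ lowerSet D.q₀ ν :=
  ⟨p.unif_ne_zero hq, by rwa [p.lamOf_unif hq]⟩

theorem phi_zero (hq : 0 < D.q₀) (hp : p ∉ branchPoints D.q₀) (hθ : D.θp + D.θm = Real.pi)
    (hB : WeightIntegrable ν (pertOp D t (D.Qm t))) (hν : 0 ≤ ν) (him : -ν ≤ p.lam.im) :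
    phi D t p 0 = jostPhi D t (kOf D.q₀ p.unif) (lamOf D.q₀ p.unif) 0 := by
  rw [(existsUnique_isPhi hp hθ hB hν him).2.2, p.kOf_unif hq, p.lamOf_unif hq]

theorem phiBar_zero (hq : 0 < D.q₀) (hp : p ∉ branchPoints D.q₀) (hθ : D.θp + D.θm = Real.pi)
    (hB : WeightIntegrable ν (pertOp D t (D.Qm t))) (hν : 0 ≤ ν) (him : p.lam.im ≤ ν) :
    phiBar D t p 0 = jostPhiBar D t (kOf D.q₀ p.unif) (lamOf D.q₀ p.unif) 0 := by
  rw [(existsUnique_isPhiBar hp hθ hB hν him).2.2, p.kOf_unif hq, p.lamOf_unif hq]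

theorem psi_zero (hq : 0 < D.q₀) (hp : p ∉ branchPoints D.q₀) (hθ : D.θp + D.θm = Real.pi)
    (hB : WeightIntegrable ν fun s => -pertOp D t (D.Qp t) (-s)) (hν : 0 ≤ ν)
    (him : -ν ≤ p.lam.im) :
    psi D t p 0 = jostPsi D t (kOf D.q₀ p.unif) (lamOf D.q₀ p.unif) 0 := by
  rw [(existsUnique_isPsi hp hθ hB hν him).2.2, p.kOf_unif hq, p.lamOf_unif hq]
  simp only [neg_zero]

theorem psiBar_zero (hq : 0 < D.q₀) (hp : p ∉ branchPoints D.q₀) (hθ : D.θp + D.θm = Real.pi)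
    (hB : WeightIntegrable ν fun s => -pertOp D t (D.Qp t) (-s)) (hν : 0 ≤ ν)
    (him : p.lam.im ≤ ν) :
    psiBar D t p 0 = jostPsiBar D t (kOf D.q₀ p.unif) (lamOf D.q₀ p.unif) 0 := by
  rw [(existsUnique_isPsiBar hp hθ hB hν him).2.2, p.kOf_unif hq, p.lamOf_unif hq]
  simp only [neg_zero]

theorem notMem_branchPoints_of_lam_ne_zero {q₀ : ℝ} {p : Surface q₀} (h : p.lam ≠ 0) :
    p ∉ branchPoints q₀ := by
  have hI := Complex.I_sq
  have h1 := p.lam_sq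
  rintro (h' | h') <;> rw [h'] at h1 <;> refine h (pow_eq_zero_iff two_ne_zero |>.1 ?_)
  · linear_combination h1 + (q₀ : ℂ) ^ 2 * hI
  · linear_combination h1 + (q₀ : ℂ) ^ 2 * hI

end Values

end RST

end

/-! ### Assembly of the theorem -/

theorem mainTheorem4 (D : RST.Potential) (hq₀ : 0 < D.q₀) (hθ : D.θp + D.θm = Real.pi) (t : ℝ)
    (hL : D.DecayL11 t) :
    -- the eigenfunctions are well defined, and so are the scattering coefficients
    (∀ p : Surface D.q₀, p ∉ branchPoints D.q₀ → 0 ≤ p.lam.im →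
      (∃! u, IsPhi D t p u) ∧ (∃! u, IsPsi D t p u) ∧
      ∀ x, wronskian (phi D t p x) (psi D t p x) = 2 * p.lam * (p.lam + p.k) * scatA D t p) ∧
    (∀ p : Surface D.q₀, p ∉ branchPoints D.q₀ → p.lam.im ≤ 0 →
      (∃! u, IsPhiBar D t p u) ∧ (∃! u, IsPsiBar D t p u) ∧
      ∀ x, wronskian (phiBar D t p x) (psiBar D t p x) =
        -(2 * p.lam * (p.lam + p.k) * scatABar D t p)) ∧
    (∀ p : Surface D.q₀, p ∉ branchPoints D.q₀ → p.lam.im = 0 → ScatteringRelations D t p) ∧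
    -- `a` and `ā`
    ContinuousOn (scatA D t)
      ((closure (Kplus D.q₀) ∪ frontier (Kminus D.q₀)) \ branchPoints D.q₀) ∧
    AnalyticOnSurface (scatA D t) (Kplus D.q₀) ∧
    ContinuousOn (scatABar D t)
      ((closure (Kminus D.q₀) ∪ frontier (Kplus D.q₀)) \ branchPoints D.q₀) ∧
    AnalyticOnSurface (scatABar D t) (Kminus D.q₀) ∧
    -- `b` and `b̄`
    ContinuousOn (scatB D t) (continuousSpectrum D.q₀) ∧
    ContinuousOn (scatBBar D t) (continuousSpectrum D.q₀) ∧
    -- Gaussian decay: everything is defined off the branch points, and `aλ`, `āλ`, `bλ`, `b̄λ`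
    -- are analytic on the whole surface, the branch points being removable
    (D.DecayGaussian t →
      (∀ p : Surface D.q₀, p ∉ branchPoints D.q₀ →
        (∃! u, IsPhi D t p u) ∧ (∃! u, IsPhiBar D t p u) ∧
        (∃! u, IsPsi D t p u) ∧ (∃! u, IsPsiBar D t p u) ∧ ScatteringRelations D t p) ∧
      ∃ FA FABar FB FBBar : Surface D.q₀ → ℂ,
        AnalyticOnSurface FA Set.univ ∧ AnalyticOnSurface FABar Set.univ ∧
        AnalyticOnSurface FB Set.univ ∧ AnalyticOnSurface FBBar Set.univ ∧
        ∀ p : Surface D.q₀, p ∉ branchPoints D.q₀ →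
          FA p = scatA D t p * p.lam ∧ FABar p = scatABar D t p * p.lam ∧
          FB p = scatB D t p * p.lam ∧ FBBar p = scatBBar D t p * p.lam) := by
  have hBm := hL.weightIntegrable_left
  have hBp := hL.weightIntegrable_right
  have rPhi := regularOn_phi hθ hBm le_rfl
  have rPhiBar := regularOn_phiBar hθ hBm le_rfl
  have rPsi := regularOn_psi hθ hBp le_rfl
  have rPsiBar := regularOn_psiBar hθ hBp le_rfl
  have up : ∀ {p : Surface D.q₀}, 0 ≤ p.lam.im → -0 ≤ p.lam.im := fun h => by rwa [neg_zero]
  have hApos : ∀ p ∈ (closure (Kplus D.q₀) ∪ frontier (Kminus D.q₀)) \ branchPoints D.q₀,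
      0 ≤ p.lam.im := by
    rintro p ⟨hp | hp, -⟩
    · exact (closure_Kplus_subset hq₀ hp).2
    · exact (frontier_Kminus_subset hq₀ hp).ge
  have hAneg : ∀ p ∈ (closure (Kminus D.q₀) ∪ frontier (Kplus D.q₀)) \ branchPoints D.q₀,
      p.lam.im ≤ 0 := by
    rintro p ⟨hp | hp, -⟩
    · exact (closure_Kminus_subset hq₀ hp).2
    · exact (frontier_Kplus_subset hq₀ hp).le
  refine ⟨fun p hp him => ?_, fun p hp him => ?_, fun p hp him => ?_, ?_, ?_, ?_, ?_, ?_, ?_,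
    fun hG => ⟨fun p hp => ?_, ?_⟩⟩
  · obtain ⟨e1, s1, -⟩ := existsUnique_isPhi hp hθ hBm le_rfl (up him)
    obtain ⟨e2, s2, -⟩ := existsUnique_isPsi hp hθ hBp le_rfl (up him)
    refine ⟨e1, e2, fun x => ?_⟩
    rw [s1.1.wronskian_eq hL s2.1 0 x, scatA,
      mul_div_cancel₀ _ (Surface.two_lam_mul_ne_zero hq₀ hp)]
  · obtain ⟨e1, s1, -⟩ := existsUnique_isPhiBar hp hθ hBm le_rfl him
    obtain ⟨e2, s2, -⟩ := existsUnique_isPsiBar hp hθ hBp le_rfl him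
    refine ⟨e1, e2, fun x => ?_⟩
    rw [s1.1.wronskian_eq hL s2.1 0 x, scatABar, mul_neg, neg_neg,
      mul_div_cancel₀ _ (Surface.two_lam_mul_ne_zero hq₀ hp)]
  · exact scatteringRelations_of_isJost hL hq₀ hθ hp
      (existsUnique_isPhi hp hθ hBm le_rfl (up him.ge)).2.1
      (existsUnique_isPhiBar hp hθ hBm le_rfl him.le).2.1
      (existsUnique_isPsi hp hθ hBp le_rfl (up him.ge)).2.1
      (existsUnique_isPsiBar hp hθ hBp le_rfl him.le).2.1
  · refine continuousOn_scat hq₀ rPhi rPsi (fun p hp => mem_upperSet_unif hq₀ (up (hApos p hp)))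
      (fun p hp => hp.2) fun p hp => ?_
    rw [scatA, phi_zero hq₀ hp.2 hθ hBm le_rfl (up (hApos p hp)),
      psi_zero hq₀ hp.2 hθ hBp le_rfl (up (hApos p hp))]
  -- Where Im λ > 0 strictly, λ ≠ 0 is automatic, so the branch points need no separate exclusion.
  · refine analyticOnSurface_scat hq₀ rPhi rPsi (isOpen_strictUpper D.q₀ 0)
      (fun z hz => ⟨hz.1, hz.2.le⟩) (fun z hz => ⟨hz.1, fun h => ?_⟩) (fun p hp => ?_) 1
      fun p hp => ?_
    · have := hz.2
      simp [h] at this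
    · rw [Kplus_eq hq₀] at hp
      refine ⟨p.unif_ne_zero hq₀, ?_⟩
      rw [p.lamOf_unif hq₀, neg_zero]
      exact hp.2
    · have h1 := hp.2
      rw [p.lamOf_unif hq₀] at h1
      have h2 : p ∉ branchPoints D.q₀ := notMem_branchPoints_of_lam_ne_zero fun h => by
        simp [h] at h1
      rw [scatA, phi_zero hq₀ h2 hθ hBm le_rfl h1.le, psi_zero hq₀ h2 hθ hBp le_rfl h1.le, one_mul]
  · refine (continuousOn_scat hq₀ rPhiBar rPsiBar
      (F := fun p => wronskian (phiBar D t p 0) (psiBar D t p 0) / (2 * p.lam * (p.lam + p.k)))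
      (fun p hp => mem_lowerSet_unif hq₀ (hAneg p hp)) (fun p hp => hp.2) fun p hp => ?_).neg
    rw [phiBar_zero hq₀ hp.2 hθ hBm le_rfl (hAneg p hp),
      psiBar_zero hq₀ hp.2 hθ hBp le_rfl (hAneg p hp)]
  · refine analyticOnSurface_scat hq₀ rPhiBar rPsiBar (isOpen_strictLower D.q₀ 0)
      (fun z hz => ⟨hz.1, hz.2.le⟩) (fun z hz => ⟨hz.1, fun h => ?_⟩) (fun p hp => ?_) (-1)
      fun p hp => ?_
    · have := hz.2
      simp [h] at this
    · rw [Kminus_eq hq₀] at hp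
      refine ⟨p.unif_ne_zero hq₀, ?_⟩
      rw [p.lamOf_unif hq₀]
      exact hp.2
    · have h1 := hp.2
      rw [p.lamOf_unif hq₀] at h1
      have h2 : p ∉ branchPoints D.q₀ := notMem_branchPoints_of_lam_ne_zero fun h => by
        simp [h] at h1
      rw [scatABar, phiBar_zero hq₀ h2 hθ hBm le_rfl h1.le,
        psiBar_zero hq₀ h2 hθ hBp le_rfl h1.le, neg_one_mul]
  -- φ needs Im λ ≥ 0 and ψ̄ needs Im λ ≤ 0; the common domain is Im λ = 0, which contains the
  -- continuous spectrum.
  · refine (continuousOn_scat hq₀ (rPhi.mono Set.inter_subset_left)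
      (rPsiBar.mono Set.inter_subset_right)
      (F := fun p => wronskian (phi D t p 0) (psiBar D t p 0) / (2 * p.lam * (p.lam + p.k)))
      (V := continuousSpectrum D.q₀) (fun p hp => ?_) (fun p hp => ?_) fun p hp => ?_).neg
    · have him := (continuousSpectrum_subset hq₀ hp).1
      exact ⟨mem_upperSet_unif hq₀ (up him.ge), mem_lowerSet_unif hq₀ him.le⟩
    · exact (continuousSpectrum_subset hq₀ hp).2
    · obtain ⟨him, hb⟩ := continuousSpectrum_subset hq₀ hp
      rw [phi_zero hq₀ hb hθ hBm le_rfl (up him.ge), psiBar_zero hq₀ hb hθ hBp le_rfl him.le]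
  · refine continuousOn_scat hq₀ (rPhiBar.mono Set.inter_subset_right)
      (rPsi.mono Set.inter_subset_left) (fun p hp => ?_) (fun p hp => ?_) fun p hp => ?_
    · have him := (continuousSpectrum_subset hq₀ hp).1
      exact ⟨mem_upperSet_unif hq₀ (up him.ge), mem_lowerSet_unif hq₀ him.le⟩
    · exact (continuousSpectrum_subset hq₀ hp).2
    · obtain ⟨him, hb⟩ := continuousSpectrum_subset hq₀ hp
      rw [scatBBar, phiBar_zero hq₀ hb hθ hBm le_rfl him.le,
        psi_zero hq₀ hb hθ hBp le_rfl (up him.ge)]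
  -- With ν = |Im λ| both -ν ≤ Im λ and Im λ ≤ ν hold, so all four eigenfunctions exist at p.
  · have hν := abs_nonneg p.lam.im
    obtain ⟨e1, s1, -⟩ := existsUnique_isPhi hp hθ (hG.weightIntegrable_left hL hν) hν
      (neg_abs_le _)
    obtain ⟨e2, s2, -⟩ := existsUnique_isPhiBar hp hθ (hG.weightIntegrable_left hL hν) hν
      (le_abs_self _)
    obtain ⟨e3, s3, -⟩ := existsUnique_isPsi hp hθ (hG.weightIntegrable_right hL hν) hν
      (neg_abs_le _)
    obtain ⟨e4, s4, -⟩ := existsUnique_isPsiBar hp hθ (hG.weightIntegrable_right hL hν) hν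
      (le_abs_self _)
    exact ⟨e1, e2, e3, e4, scatteringRelations_of_isJost hL hq₀ hθ hp s1 s2 s3 s4⟩
  · have gPhi := fun ν (hν : (0 : ℝ) ≤ ν) => (regularOn_phi hθ
      (hG.weightIntegrable_left hL hν) hν).mono (Set.inter_subset_left (t := lowerSet D.q₀ ν))
    have gPhiBar := fun ν (hν : (0 : ℝ) ≤ ν) => (regularOn_phiBar hθ
      (hG.weightIntegrable_left hL hν) hν).mono (Set.inter_subset_right (s := upperSet D.q₀ ν))
    have gPsi := fun ν (hν : (0 : ℝ) ≤ ν) => (regularOn_psi hθ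
      (hG.weightIntegrable_right hL hν) hν).mono (Set.inter_subset_left (t := lowerSet D.q₀ ν))
    have gPsiBar := fun ν (hν : (0 : ℝ) ≤ ν) => (regularOn_psiBar hθ
      (hG.weightIntegrable_right hL hν) hν).mono (Set.inter_subset_right (s := upperSet D.q₀ ν))
    -- The extensions are ± the Wronskians of the Jost solutions over 2(λ + k), with the signs of
    -- the definitions of a, ā, b, b̄; λ has cancelled from the denominator.
    refine ⟨_, _, _, _, analyticOnSurface_wronskian_div hq₀ gPhi gPsi 1,
      analyticOnSurface_wronskian_div hq₀ gPhiBar gPsiBar (-1),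
      analyticOnSurface_wronskian_div hq₀ gPhi gPsiBar (-1),
      analyticOnSurface_wronskian_div hq₀ gPhiBar gPsi 1, fun p hp => ?_⟩
    have hν := abs_nonneg p.lam.im
    have h1 := Surface.lam_ne_zero hp
    have h2 : p.lam + p.k ≠ 0 := p.unif_ne_zero hq₀
    have hu : p.unif = p.lam + p.k := rfl
    rw [scatA, scatABar, scatB, scatBBar,
      phi_zero hq₀ hp hθ (hG.weightIntegrable_left hL hν) hν (neg_abs_le _),
      phiBar_zero hq₀ hp hθ (hG.weightIntegrable_left hL hν) hν (le_abs_self _),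
      psi_zero hq₀ hp hθ (hG.weightIntegrable_right hL hν) hν (neg_abs_le _),
      psiBar_zero hq₀ hp hθ (hG.weightIntegrable_right hL hν) hν (le_abs_self _), ← hu]
    rw [← hu] at h2
    refine ⟨?_, ?_, ?_, ?_⟩ <;> field_simp
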